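/- \textbf{Theorem 1.} Call a real function $h$ slowly varying (at $\infty$) if for some $A>0$ it is positive and measurable on $[A,\infty)$, and $\lim_{x\to\infty}h(\lambda x)/h(x)=1$ for every $\lambda>0$. Let $(\varepsilon_k)_{k\in\mathbb Z}$ be independent identically distributed real random variables with $E\varepsilon_0=0$ (possibly with infinite variance) such that $l(x)=E\,\varepsilon_0^2 I(|\varepsilon_0|\le x)$ is slowly varying. Let $1/2<\alpha<1$, let $L(n)=h(n)$ for some slowly varying function $h$, and let $(a_i)_{i\ge 0}$ be real constants with $a_n=n^{-\alpha}L(n)$ for all $n\ge 1$ ($a_0$ is arbitrary). Put $b=\inf\{x\ge 1: l(x)>0\}$, $$\eta_j=\inf\Big\{s\ge b+1:\ \frac{l(s)}{s^2}\le \frac1j\Big\}\quad (j\ge1),\qquad l_n=l(\eta_n),$$ $$c_\alpha=\frac{1}{(1-\alpha)^2}\int_0^\infty\big[x^{1-\alpha}-\max(x-1,0)^{1-\alpha}\big]^2dx,\qquad B_n^2=c_\alpha\, l_n\, n^{3-2\alpha}L^2(n),\quad B_n\ge 0 .$$ Then, for every $k\in\mathbb Z$, the series $X_k=\sum_{i\ge0}a_i\varepsilon_{k-i}$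 converges almost surely (as the limit of its partial sums). With $S_n=\sum_{i=1}^nX_i$ (and $S_0=0$), the random functions $W_n(t)=S_{[nt]}/B_n$, $0\le t\le1$, converge weakly in the space $D[0,1]$ of right-continuous functions with left-hand limits, endowed with the Skorokhod ($J_1$) topology, to the fractional Brownian motion $W_H$ with Hurst index $H=3/2-\alpha$, that is, to the centered Gaussian process with continuous paths and covariance $\frac12\big(s^{2H}+t^{2H}-|t-s|^{2H}\big)$. In particular, $S_n/B_n$ converges in distribution to a standard normal random variable. -/

import Mathlib

open MeasureTheory ProbabilityTheory Filter Topology Set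

noncomputable section

/-! ### The space `D[0,1]` with the Skorokhod topology -/

/-- `D[0,1]`: real functions on `[0,1]` that are right-continuous and have left-hand limits. -/
structure CadlagPath where
  toFun : unitInterval → ℝ
  right_continuous : ∀ t, ContinuousWithinAt toFun (Ici t) t
  left_limit : ∀ t, ∃ y : ℝ, Tendsto toFun (𝓝[<] t) (𝓝 y)

namespace CadlagPath

instance : CoeFun CadlagPath (fun _ => unitInterval → ℝ) := ⟨CadlagPath.toFun⟩

/-- The cost of the time change `τ` (an increasing bijection of `[0,1]`, automatically a
homeomorphism) for the pair `x, y`: the larger of `sup |τ t - t|` and `sup |x t - y (τ t)|`. -/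
def timeChangeCost (x y : CadlagPath) (τ : unitInterval ≃o unitInterval) : ENNReal :=
  max (⨆ t, edist (τ t) t) (⨆ t, edist (x t) (y (τ t)))

theorem timeChangeCost_symm_le (x y : CadlagPath) (τ : unitInterval ≃o unitInterval) :
    timeChangeCost y x τ.symm ≤ timeChangeCost x y τ := by
  refine max_le_max (iSup_le fun t => ?_) (iSup_le fun t => ?_)
  · refine le_trans (le_of_eq ?_) (le_iSup (fun s => edist (τ s) s) (τ.symm t))
    simp [edist_comm]
  · refine le_trans (le_of_eq ?_) (le_iSup (fun s => edist (x s) (y (τ s))) (τ.symm t))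
    simp [edist_comm]

theorem timeChangeCost_trans_le (x y z : CadlagPath) (τ ρ : unitInterval ≃o unitInterval) :
    timeChangeCost x z (τ.trans ρ) ≤ timeChangeCost x y τ + timeChangeCost y z ρ := by
  refine max_le (iSup_le fun t => ?_) (iSup_le fun t => ?_)
  · refine (edist_triangle _ (τ t) _).trans ?_
    rw [add_comm]
    refine add_le_add ?_ ?_
    · exact (le_iSup (fun s => edist (τ s) s) t).trans (le_max_left _ _)
    · exact (le_iSup (fun s => edist (ρ s) s) (τ t)).trans (le_max_left _ _)
  · refine (edist_triangle _ (y (τ t)) _).trans (add_le_add ?_ ?_)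
    · exact (le_iSup (fun s => edist (x s) (y (τ s))) t).trans (le_max_right _ _)
    · exact (le_iSup (fun s => edist (y s) (z (ρ s))) (τ t)).trans (le_max_right _ _)

/-- The Skorokhod metric: the infimum over all time changes of the cost. Its topology is the
Skorokhod (`J₁`) topology, the one that `D[0,1]` carries below. -/
instance : PseudoEMetricSpace CadlagPath where
  edist x y := ⨅ τ : unitInterval ≃o unitInterval, timeChangeCost x y τ
  edist_self x := by
    refine le_antisymm (iInf_le_of_le (OrderIso.refl _) ?_) bot_le
    simp [timeChangeCost]
  edist_comm x y := by
    refine le_antisymm ?_ ?_ <;>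
    exact le_iInf fun τ => (iInf_le _ τ.symm).trans (timeChangeCost_symm_le _ _ τ)
  edist_triangle x y z := by
    rw [ENNReal.iInf_add]
    refine le_iInf fun τ => ?_
    rw [ENNReal.add_iInf]
    exact le_iInf fun ρ => (iInf_le _ (τ.trans ρ)).trans (timeChangeCost_trans_le x y z τ ρ)

instance : MeasurableSpace CadlagPath := borel _

instance : BorelSpace CadlagPath := ⟨rfl⟩

end CadlagPath

/-- The path `t ↦ s ⌊n t⌋`, `t ∈ [0,1]`, of a real sequence `s`, as an element of `D[0,1]`. -/
def stepPath (s : ℕ → ℝ) (n : ℕ) : CadlagPath where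
  toFun t := s ⌊(n : ℝ) * (t : ℝ)⌋₊
  right_continuous t := by
    have hc : Tendsto (fun u : unitInterval => (n : ℝ) * (u : ℝ)) (𝓝[≥] t)
        (𝓝 ((n : ℝ) * (t : ℝ))) :=
      (Continuous.tendsto (by fun_prop) t).mono_left nhdsWithin_le_nhds
    have h : ∀ᶠ u : unitInterval in 𝓝[≥] t, (n : ℝ) * (u : ℝ) < ⌊(n : ℝ) * (t : ℝ)⌋₊ + 1 :=
      hc.eventually (gt_mem_nhds (Nat.lt_floor_add_one _))
    refine Tendsto.congr' (f₁ := fun _ => s ⌊(n : ℝ) * (t : ℝ)⌋₊) ?_ tendsto_const_nhds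
    filter_upwards [h, self_mem_nhdsWithin] with u hu htu
    have htu' : (t : ℝ) ≤ (u : ℝ) := htu
    have h1 : (n : ℝ) * (t : ℝ) ≤ (n : ℝ) * (u : ℝ) := by gcongr
    have h2 : ⌊(n : ℝ) * (u : ℝ)⌋₊ < ⌊(n : ℝ) * (t : ℝ)⌋₊ + 1 :=
      (Nat.floor_lt (mul_nonneg n.cast_nonneg u.2.1)).2 (by exact_mod_cast hu)
    have h3 := Nat.floor_mono h1
    have h4 : ⌊(n : ℝ) * (u : ℝ)⌋₊ = ⌊(n : ℝ) * (t : ℝ)⌋₊ := by omega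
    simp only [h4]
  left_limit t := by
    refine ⟨s (⌈(n : ℝ) * (t : ℝ)⌉₊ - 1), ?_⟩
    have hc : Tendsto (fun u : unitInterval => (n : ℝ) * (u : ℝ)) (𝓝[<] t)
        (𝓝 ((n : ℝ) * (t : ℝ))) :=
      (Continuous.tendsto (by fun_prop) t).mono_left nhdsWithin_le_nhds
    refine Tendsto.congr' (f₁ := fun _ => s (⌈(n : ℝ) * (t : ℝ)⌉₊ - 1)) ?_ tendsto_const_nhds
    rcases (mul_nonneg n.cast_nonneg t.2.1 : 0 ≤ (n : ℝ) * (t : ℝ)).eq_or_lt with h0 | h0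
    · filter_upwards [self_mem_nhdsWithin] with u hu
      have hu' : (u : ℝ) ≤ (t : ℝ) := le_of_lt hu
      have h1 : (n : ℝ) * (u : ℝ) ≤ 0 := h0.symm ▸ mul_le_mul_of_nonneg_left hu' n.cast_nonneg
      rw [← h0, Nat.floor_of_nonpos h1]
      simp
    · have hpos : 0 < ⌈(n : ℝ) * (t : ℝ)⌉₊ := Nat.ceil_pos.2 h0
      have hlt : ((⌈(n : ℝ) * (t : ℝ)⌉₊ - 1 : ℕ) : ℝ) < (n : ℝ) * (t : ℝ) :=
        Nat.lt_ceil.1 (by omega)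
      have hn : (0 : ℝ) < n := by
        rcases (Nat.cast_nonneg n : (0 : ℝ) ≤ n).eq_or_lt with h | h
        · rw [← h] at h0; simp at h0
        · exact h
      filter_upwards [hc.eventually (lt_mem_nhds hlt), self_mem_nhdsWithin] with u hu hut
      have hut' : (u : ℝ) < (t : ℝ) := hut
      have h1 : (n : ℝ) * (u : ℝ) < ⌈(n : ℝ) * (t : ℝ)⌉₊ :=
        (mul_lt_mul_of_pos_left hut' hn).trans_le (Nat.le_ceil _)
      have h2 : ⌊(n : ℝ) * (u : ℝ)⌋₊ < ⌈(n : ℝ) * (t : ℝ)⌉₊ :=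
        (Nat.floor_lt (mul_nonneg n.cast_nonneg u.2.1)).2 h1
      have h3 : ⌈(n : ℝ) * (t : ℝ)⌉₊ - 1 ≤ ⌊(n : ℝ) * (u : ℝ)⌋₊ := Nat.le_floor hu.le
      have h4 : ⌊(n : ℝ) * (u : ℝ)⌋₊ = ⌈(n : ℝ) * (t : ℝ)⌉₊ - 1 := by omega
      rw [h4]

/-! ### Slowly varying functions and fractional Brownian motion -/

/-- `h` is slowly varying at infinity: positive and measurable on `[A, ∞)` for some `A > 0`, and
`h (c x) / h x → 1` as `x → ∞` for every `c > 0`. -/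
def SlowlyVarying (h : ℝ → ℝ) : Prop :=
  (∃ A : ℝ, 0 < A ∧ (∀ x, A ≤ x → 0 < h x) ∧ Measurable fun x : Ici A => h x) ∧
    ∀ c : ℝ, 0 < c → Tendsto (fun x => h (c * x) / h x) atTop (𝓝 1)

/-- `W` is a (standard) fractional Brownian motion on `[0,1]` with Hurst index `H`: a centered
Gaussian process with covariance `(s^{2H} + t^{2H} - |t - s|^{2H}) / 2` and almost surely
continuous paths. -/
structure IsFractionalBrownianMotion {Ω : Type*} [MeasurableSpace Ω] (H : ℝ)
    (W : unitInterval → Ω → ℝ) (P : Measure Ω) : Prop where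
  gaussian : IsGaussianProcess W P
  centered : ∀ t, ∫ ω, W t ω ∂P = 0
  covariance : ∀ s t, cov[W s, W t; P] =
    ((s : ℝ) ^ (2 * H) + (t : ℝ) ^ (2 * H) - |(t : ℝ) - (s : ℝ)| ^ (2 * H)) / 2
  continuous_paths : ∀ᵐ ω ∂P, Continuous fun t => W t ω

/-! ### Linear processes and their normalization -/

/-- Partial sums `∑_{i < N} a_i ε_{k-i}` of the series that defines the linear process. -/
def linearPartial {Ω : Type*} (a : ℕ → ℝ) (ε : ℤ → Ω → ℝ) (k : ℤ) (ω : Ω) (N : ℕ) : ℝ :=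
  ∑ i ∈ Finset.range N, a i * ε (k - (i : ℤ)) ω

/-- The causal linear process `X_k = ∑_{i ≥ 0} a_i ε_{k-i}`, the limit of the partial sums (the
series need not converge absolutely). -/
def linearProcess {Ω : Type*} (a : ℕ → ℝ) (ε : ℤ → Ω → ℝ) (k : ℤ) (ω : Ω) : ℝ :=
  limUnder atTop (linearPartial a ε k ω)

/-- `S_m = X_1 + ⋯ + X_m`. -/
def linearSum {Ω : Type*} (a : ℕ → ℝ) (ε : ℤ → Ω → ℝ) (m : ℕ) (ω : Ω) : ℝ :=
  ∑ k ∈ Finset.Icc 1 m, linearProcess a ε (k : ℤ) ω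

/-- The truncated second moment `E ξ² 1(|ξ| ≤ x)` of a random variable `ξ`. -/
def truncSecondMoment {Ω : Type*} [MeasurableSpace Ω] (P : Measure Ω) (ξ : Ω → ℝ) (x : ℝ) : ℝ :=
  ∫ ω, {ω | |ξ ω| ≤ x}.indicator (fun ω => ξ ω ^ 2) ω ∂P

/-- `η_j = inf {s : s ≥ b + 1, l s / s² ≤ 1 / j}` with `b = inf {x ≥ 1 : l x > 0}`. -/
def truncLevel (l : ℝ → ℝ) (j : ℕ) : ℝ :=
  sInf {s : ℝ | sInf {x : ℝ | 1 ≤ x ∧ 0 < l x} + 1 ≤ s ∧ l s / s ^ 2 ≤ 1 / (j : ℝ)}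

/-- `c_α = (∫_0^∞ (x^{1-α} - max(x-1,0)^{1-α})² dx) / (1-α)²`. -/
def cAlpha (α : ℝ) : ℝ :=
  (∫ x in Ioi (0 : ℝ), (x ^ (1 - α) - (max (x - 1) 0) ^ (1 - α)) ^ 2) / (1 - α) ^ 2

/-- The normalization `B_n`, the nonnegative root of `B_n² = c_α l(η_n) n^{3-2α} L(n)²`. -/
def normalizer (α : ℝ) (l : ℝ → ℝ) (L : ℕ → ℝ) (n : ℕ) : ℝ :=
  Real.sqrt (cAlpha α * l (truncLevel l n) * (n : ℝ) ^ (3 - 2 * α) * L n ^ 2)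

end

/-!
The innovations may have infinite variance, so they are truncated and centered before second moments
are used. At the time horizon `n` the innovation `ε_r` is cut at the level `η_{n+|r|}`, which grows
with the distance of `r` to the origin because a partial sum depends on the whole past. Slow
variation of `l` makes the tail `E |ε| 1(|ε| > x)` and the truncated third moment
`E |ε|³ 1(|ε| ≤ x)` negligible against `l x / x` and `x l x`
(`exists_lawTailMoment_le`, `exists_lawTruncThirdMoment_le`). Together with
Potter's bounds for the coefficients this shows that the part of the partial sums up to time `n`
that the truncation removes is `o(B_n)` in probability, uniformly (`LinearModel.exists_truncError_le`).
The same decomposition gives the almost sure convergence of the series `X_k`: the centered bounded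
part has summable variances, so its partial sums form a martingale bounded in `L²`, and the remainder
converges absolutely (`LinearModel.ae_exists_tendsto_linearPartial_one`).

For the truncated sums, the coefficients of the innovations in an increment `S_k - S_j` are window
sums of `a`, which after rescaling are Riemann sums for the moving average kernel
`((t - x)₊^{1-α} - (s - x)₊^{1-α}) / (1 - α)`. Dominated convergence gives the limit of the variances
(`tendsto_sum_sq_windowCoeff`); the squared norm of the kernel is `c_α (t - s)^{3-2α}`
(`integral_sq_fbmKernel`), and polarization yields the covariance of fractional Brownian motion.
Lindeberg's comparison of characteristic functions, in the presence of the third moment bound, then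
gives the Gaussian finite-dimensional limits (`norm_charFun_sum_sub_le`,
`LinearModel.tendsto_charFun_truncSum`).

Tightness comes from second moments alone: the variance of an increment over relative length `u` is
at most of order `u^q` with `q = 3 - 2α - 2δ > 1`
(`LinearModel.exists_lintegral_truncSum_sub_sq_le`). This carries over to the polygonal paths, and
dyadic chaining gives tightness in `C[0,1]` (`lintegral_polygon_le`,
`isTightMeasureSet_of_second_moment`). Prokhorov's theorem and the characteristic functions identify
a limit law on `C[0,1]` (`exists_tendsto_of_tight_of_charFun`), whose coordinate process is the
fractional Brownian motion. Since `C[0,1]` is a closed subspace of `D[0,1]`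
(`CadlagPath.isClosedEmbedding_ofContinuous`) and the step paths of `S` are uniformly close in
probability to the polygons of the truncated sums, the step paths converge to the same limit
(`CadlagPath.tendstoInDistribution_of_close`). Evaluation at `1` is continuous on `D[0,1]`, which
gives the central limit theorem.
-/

/-! ### Slowly varying functions -/

/-- The uniform convergence theorem in additive form. The set of exceptional shifts `u ∈ [0, 2]` has
small measure at `x` and at `x + u₀`, so some `u ∈ [1, 2]` serves both base points. -/
theorem uniform_shift_of_tendsto {f : ℝ → ℝ} (hf : Measurable f)
    (h : ∀ u, Tendsto (fun x => f (x + u) - f x) atTop (𝓝 0)) {ε : ℝ} (hε : 0 < ε) :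
    ∃ X, ∀ x, X ≤ x → ∀ u ∈ Icc (0 : ℝ) 1, |f (x + u) - f x| < ε := by
  let bad : ℝ → Set ℝ := fun x => {u | ε / 2 ≤ |f (x + u) - f x|}
  have hbm : ∀ x, MeasurableSet (bad x) := fun x =>
    measurableSet_le measurable_const (by fun_prop)
  -- pointwise convergence gives convergence in measure on `[0, 2]`
  have key : Tendsto (fun x => volume (bad x ∩ Icc 0 2)) atTop (𝓝 0) := by
    have h1 : Tendsto (fun x => ∫⁻ u in Icc (0 : ℝ) 2, (bad x).indicator 1 u) atTop
        (𝓝 (∫⁻ u in Icc (0 : ℝ) 2, 0)) := by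
      refine tendsto_lintegral_filter_of_dominated_convergence (fun _ => 1) ?_ ?_ ?_ ?_
      · exact Eventually.of_forall fun x => measurable_one.indicator (hbm x)
      · refine Eventually.of_forall fun x => Eventually.of_forall fun u => ?_
        exact indicator_le_self' (by simp) u
      · simp
      · refine Eventually.of_forall fun u => ?_
        refine tendsto_const_nhds.congr' ?_
        have := (h u).abs
        rw [abs_zero] at this
        filter_upwards [this.eventually (gt_mem_nhds (half_pos hε))] with x hx
        rw [indicator_of_notMem]
        simpa [bad] using hx
    simp only [lintegral_zero] at h1
    refine h1.congr fun x => ?_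
    rw [lintegral_indicator_one (hbm x), Measure.restrict_apply (hbm x)]
  have hhalf : (0 : ENNReal) < 1 / 2 := by simp
  obtain ⟨X, hX⟩ := eventually_atTop.1 (key.eventually (gt_mem_nhds hhalf))
  refine ⟨X, fun x hx u₀ hu₀ => ?_⟩
  have hxu : X ≤ x + u₀ := by linarith [hu₀.1]
  have hb1 := hX x hx
  have hb2 := hX (x + u₀) hxu
  -- otherwise `[1, 2]`, of length one, is covered by two sets of measure below `1 / 2`
  have hex : ∃ u ∈ Icc (1 : ℝ) 2, u ∉ (bad x ∩ Icc 0 2) ∪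
      (fun v => v - u₀) ⁻¹' (bad (x + u₀) ∩ Icc 0 2) := by
    by_contra! hcon
    have hsub : Icc (1 : ℝ) 2 ⊆ (bad x ∩ Icc 0 2) ∪
      (fun v => v - u₀) ⁻¹' (bad (x + u₀) ∩ Icc 0 2) := fun u hu => hcon u hu
    have h3 := (measure_mono hsub).trans (measure_union_le (μ := volume) _ _)
    rw [(measurePreserving_sub_right volume u₀).measure_preimage
      (((hbm _).inter measurableSet_Icc).nullMeasurableSet), Real.volume_Icc] at h3
    have h4 := ENNReal.add_lt_add hb1 hb2
    rw [ENNReal.add_halves] at h4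
    have h5 : ENNReal.ofReal ((2 : ℝ) - 1) = 1 := by norm_num
    rw [h5] at h3
    exact absurd (h3.trans_lt h4) (lt_irrefl _)
  obtain ⟨u, hu, hnot⟩ := hex
  have hn1 : u ∉ bad x := fun hb => hnot (Or.inl ⟨hb, by linarith [hu.1], hu.2⟩)
  have hn2 : u - u₀ ∉ bad (x + u₀) := fun hb =>
    hnot (Or.inr ⟨hb, by linarith [hu.1, hu₀.2], by linarith [hu.2, hu₀.1]⟩)
  simp only [bad, mem_ofPred_eq, not_le] at hn1 hn2
  have e : x + u₀ + (u - u₀) = x + u := by ring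
  rw [e] at hn2
  rw [abs_lt] at *
  constructor <;> linarith [hn1.1, hn1.2, hn2.1, hn2.2]

namespace SlowlyVarying

variable {h : ℝ → ℝ}

theorem eventually_pos (hh : SlowlyVarying h) : ∃ A, 0 < A ∧ ∀ x, A ≤ x → 0 < h x :=
  let ⟨A, hA, hp, _⟩ := hh.1
  ⟨A, hA, hp⟩

/-- Karamata's uniform convergence theorem on the ratios in `[1, 2]`. -/
theorem uniform_log (hh : SlowlyVarying h) {ε : ℝ} (hε : 0 < ε) :
    ∃ X, 0 < X ∧ (∀ x, X ≤ x → 0 < h x) ∧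
      ∀ x y, X ≤ x → x ≤ y → y ≤ 2 * x → |Real.log (h y) - Real.log (h x)| ≤ ε := by
  obtain ⟨⟨A, hA, hpos, hmeas⟩, hlim⟩ := hh
  -- below `A` nothing is known about `h`, so it is replaced there by `1` to be measurable
  let g : ℝ → ℝ := fun x => if A ≤ x then h x else 1
  have hg : Measurable g := by
    refine measurable_of_restrict_of_restrict_compl (measurableSet_Ici (a := A)) ?_ ?_
    · convert hmeas using 1
      ext x
      have : A ≤ (x : ℝ) := x.2
      simp [g, this]
    · have : (Ici A)ᶜ.domRestrict g = fun _ => 1 := by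
        ext x
        have : ¬ A ≤ (x : ℝ) := x.2
        simp [g, this]
      rw [this]; exact measurable_const
  let f : ℝ → ℝ := fun t => Real.log (g (Real.exp t))
  have hf : Measurable f := Real.measurable_log.comp (hg.comp Real.measurable_exp)
  have hfl : ∀ u, Tendsto (fun x => f (x + u) - f x) atTop (𝓝 0) := by
    intro u
    have h1 := (hlim (Real.exp u) (Real.exp_pos u)).comp Real.tendsto_exp_atTop
    have h2 := h1.log one_ne_zero
    rw [Real.log_one] at h2
    refine h2.congr' ?_
    filter_upwards [Real.tendsto_exp_atTop.eventually_ge_atTop A,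
      (tendsto_atTop_add_const_right atTop u tendsto_id).eventually
        (Real.tendsto_exp_atTop.eventually_ge_atTop A)] with x hx hxu
    simp only [id] at hxu
    have e : Real.exp u * Real.exp x = Real.exp (x + u) := by rw [Real.exp_add, mul_comm]
    simp only [Function.comp, f, g, hx, hxu, if_true, e]
    rw [Real.log_div (hpos _ hxu).ne' (hpos _ hx).ne']
  obtain ⟨T, hT⟩ := uniform_shift_of_tendsto hf hfl hε
  refine ⟨max A (Real.exp T), by positivity, fun x hx => hpos x ((le_max_left _ _).trans hx), ?_⟩
  intro x y hx hxy hy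
  have hAx : A ≤ x := (le_max_left _ _).trans hx
  have hx0 : 0 < x := hA.trans_le hAx
  have hy0 : 0 < y := hx0.trans_le hxy
  have hTx : T ≤ Real.log x := by
    rw [Real.le_log_iff_exp_le hx0]; exact (le_max_right _ _).trans hx
  have hu : Real.log y - Real.log x ∈ Icc (0 : ℝ) 1 := by
    constructor
    · linarith [Real.log_le_log hx0 hxy]
    · have h1 := Real.log_le_log hy0 hy
      rw [Real.log_mul two_ne_zero hx0.ne'] at h1
      linarith [Real.log_two_lt_d9]
  have := hT _ hTx _ hu
  rw [add_sub_cancel] at this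
  simp only [f, g, Real.exp_log hx0, Real.exp_log hy0, hAx, hAx.trans hxy, if_true] at this
  exact this.le

/-- Potter's bound in logarithmic form. -/
theorem potter_log (hh : SlowlyVarying h) {δ : ℝ} (hδ : 0 < δ) :
    ∃ X, 0 < X ∧ (∀ x, X ≤ x → 0 < h x) ∧
      ∀ x y, X ≤ x → x ≤ y → |Real.log (h y) - Real.log (h x)| ≤ δ * (Real.log (y / x) + 1) := by
  obtain ⟨X, hX, hpos, hX2⟩ := hh.uniform_log (ε := δ / 2) (by positivity)
  -- each doubling costs at most `δ / 2`, and `log 2 > 1 / 2` turns the number of doublings into a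
  -- logarithm
  have key : ∀ k : ℕ, ∀ x y, X ≤ x → x ≤ y → y ≤ 2 ^ k * x → 2 ^ k * x ≤ 2 * y →
      |Real.log (h y) - Real.log (h x)| ≤ δ / 2 * (k + 1) := by
    intro k
    induction k with
    | zero =>
      intro x y hx hxy hy _
      refine (hX2 x y hx hxy (by linarith)).trans ?_
      simp
    | succ k ih =>
      intro x y hx hxy hy hy2
      rw [pow_succ] at hy hy2
      have hx0 : 0 < x := hX.trans_le hx
      have h1 : (1 : ℝ) ≤ 2 ^ k := one_le_pow₀ (by norm_num)
      have h2 : x ≤ y := hxy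
      by_cases hc : y ≤ 2 * x
      · refine (hX2 x y hx hxy hc).trans ?_
        push_cast
        nlinarith [(Nat.cast_nonneg k : (0 : ℝ) ≤ k)]
      push Not at hc
      have h3 := ih x (y / 2) hx (by linarith) (by linarith) (by linarith)
      have h4 := hX2 (y / 2) y (by linarith) (by linarith) (by linarith)
      push_cast
      rw [abs_le] at *
      constructor <;> nlinarith [h3.1, h3.2, h4.1, h4.2]
  refine ⟨X, hX, hpos, fun x y hx hxy => ?_⟩
  have hx0 : 0 < x := hX.trans_le hx
  have hr : 1 ≤ y / x := (one_le_div hx0).2 hxy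
  obtain ⟨n, hn1, hn2⟩ := exists_nat_pow_near hr (by norm_num : (1 : ℝ) < 2)
  have hn2' := hn2.le
  rw [div_le_iff₀ hx0] at hn2'
  have hn1' := hn1
  rw [le_div_iff₀ hx0] at hn1'
  have := key (n + 1) x y hx hxy hn2' (by rw [pow_succ]; linarith)
  refine this.trans ?_
  have h5 := Real.log_le_log (by positivity) hn1
  rw [Real.log_pow] at h5
  have h6 := Real.log_two_gt_d9
  push_cast
  have h7 : (n : ℝ) / 2 ≤ Real.log (y / x) := by nlinarith [(Nat.cast_nonneg n : (0 : ℝ) ≤ n)]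
  nlinarith

/-- Potter's bound. -/
theorem potter (hh : SlowlyVarying h) {δ : ℝ} (hδ : 0 < δ) :
    ∃ X, 0 < X ∧ (∀ x, X ≤ x → 0 < h x) ∧ ∀ x y, X ≤ x → x ≤ y →
      h y ≤ Real.exp δ * (y / x) ^ δ * h x ∧ h x ≤ Real.exp δ * (y / x) ^ δ * h y := by
  obtain ⟨X, hX, hpos, hX2⟩ := hh.potter_log hδ
  refine ⟨X, hX, hpos, fun x y hx hxy => ?_⟩
  have hx0 : 0 < x := hX.trans_le hx
  have hy0 : 0 < y := hx0.trans_le hxy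
  have hhx := hpos x hx
  have hhy := hpos y (hx.trans hxy)
  have hm := abs_le.1 (hX2 x y hx hxy)
  have e : Real.exp δ * (y / x) ^ δ = Real.exp (δ * (Real.log (y / x) + 1)) := by
    rw [Real.rpow_def_of_pos (by positivity), ← Real.exp_add]
    ring_nf
  rw [e]
  constructor
  · calc h y = Real.exp (Real.log (h y) - Real.log (h x)) * h x := by
          rw [Real.exp_sub, Real.exp_log hhx, Real.exp_log hhy, div_mul_cancel₀ _ hhx.ne']
      _ ≤ _ := mul_le_mul_of_nonneg_right (Real.exp_le_exp.2 hm.2) hhx.le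
  · calc h x = Real.exp (Real.log (h x) - Real.log (h y)) * h y := by
          rw [Real.exp_sub, Real.exp_log hhx, Real.exp_log hhy, div_mul_cancel₀ _ hhy.ne']
      _ ≤ _ := mul_le_mul_of_nonneg_right (Real.exp_le_exp.2 (by linarith [hm.1])) hhy.le

/-- A slowly varying function takes asymptotically equal values along sequences whose ratio
converges to a positive limit. -/
theorem tendsto_ratio (hh : SlowlyVarying h) {ι : Type*} {F : Filter ι} {x y : ι → ℝ}
    (hx : Tendsto x F atTop) {c : ℝ} (hc : 0 < c) (hxy : Tendsto (fun i => y i / x i) F (𝓝 c)) :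
    Tendsto (fun i => h (y i) / h (x i)) F (𝓝 1) := by
  have h1 : Tendsto (fun i => h (c * x i) / h (x i)) F (𝓝 1) := (hh.2 c hc).comp hx
  have hcx : Tendsto (fun i => c * x i) F atTop := hx.const_mul_atTop hc
  have hy : Tendsto y F atTop := by
    refine (Tendsto.pos_mul_atTop hc hxy hx).congr' ?_
    filter_upwards [hx.eventually_gt_atTop 0] with i hi
    field_simp
  have h2 : Tendsto (fun i => Real.log (h (y i)) - Real.log (h (c * x i))) F (𝓝 0) := by
    rw [Metric.tendsto_nhds]
    intro ε hε
    obtain ⟨X, hX, hpos, hX2⟩ := hh.uniform_log (half_pos hε)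
    have ha : ∀ᶠ i in F, c / 2 < y i / x i := hxy.eventually (lt_mem_nhds (by linarith))
    have hb : ∀ᶠ i in F, y i / x i < c * 2 := hxy.eventually (gt_mem_nhds (by linarith))
    filter_upwards [ha, hb, hcx.eventually_ge_atTop X, hy.eventually_ge_atTop X,
      hx.eventually_gt_atTop 0] with i ha hb h3 h4 h5
    rw [div_lt_iff₀ h5] at hb
    rw [lt_div_iff₀ h5] at ha
    rw [Real.dist_eq, sub_zero]
    rcases le_total (c * x i) (y i) with hle | hle
    · exact (hX2 _ _ h3 hle (by linarith)).trans_lt (by linarith)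
    · rw [abs_sub_comm]
      exact (hX2 _ _ h4 hle (by linarith)).trans_lt (by linarith)
  have h3 := (Real.continuous_exp.tendsto 0).comp h2
  rw [Real.exp_zero] at h3
  obtain ⟨A, hA, hpos⟩ := hh.eventually_pos
  have h4 := h3.mul h1
  rw [one_mul] at h4
  refine h4.congr' ?_
  filter_upwards [hcx.eventually_ge_atTop A, hy.eventually_ge_atTop A] with i hi1 hi2
  have p1 := hpos _ hi1
  have p2 := hpos _ hi2
  simp only [Function.comp, Real.exp_sub, Real.exp_log p1, Real.exp_log p2]
  field_simp

end SlowlyVarying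

/-! ### Truncation levels of a monotone slowly varying function -/

section TruncLevel

variable {l : ℝ → ℝ}

/-- The base point `b + 1`, `b = inf {x ≥ 1 : l x > 0}`, below which no truncation level lies. -/
noncomputable def levelBase (l : ℝ → ℝ) : ℝ := sInf {x : ℝ | 1 ≤ x ∧ 0 < l x} + 1

theorem levelBase_aux (hl : SlowlyVarying l) (hm : Monotone l) :
    2 ≤ levelBase l ∧ 0 < l (levelBase l) := by
  obtain ⟨A, hA, hpos⟩ := hl.eventually_pos
  have hne : {x : ℝ | 1 ≤ x ∧ 0 < l x}.Nonempty :=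
    ⟨max 1 A, le_max_left _ _, hpos _ (le_max_right _ _)⟩
  constructor
  · have : (1 : ℝ) ≤ sInf {x : ℝ | 1 ≤ x ∧ 0 < l x} := le_csInf hne fun x hx => hx.1
    unfold levelBase; linarith
  · obtain ⟨x, hx, hlt⟩ := exists_lt_of_csInf_lt hne (lt_add_one _)
    exact hx.2.trans_le (hm hlt.le)

theorem truncLevel_set_nonempty (hl : SlowlyVarying l) {j : ℕ} (hj : 1 ≤ j) :
    {s : ℝ | levelBase l ≤ s ∧ l s / s ^ 2 ≤ 1 / (j : ℝ)}.Nonempty := by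
  obtain ⟨X, hX, hpos, hp⟩ := hl.potter one_pos
  have hj0 : (0 : ℝ) < j := by exact_mod_cast hj
  have hlX := hpos X le_rfl
  set s := max (max X (levelBase l)) (Real.exp 1 * l X / X * j) with hs
  have h1 : X ≤ s := (le_max_left _ _).trans (le_max_left _ _)
  have hs0 : 0 < s := hX.trans_le h1
  refine ⟨s, (le_max_right _ _).trans (le_max_left _ _), ?_⟩
  have h2 := (hp X s le_rfl h1).1
  rw [Real.rpow_one] at h2
  have h3 : Real.exp 1 * l X / X * j ≤ s := le_max_right _ _
  rw [div_le_div_iff₀ (by positivity) hj0]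
  calc l s * j ≤ Real.exp 1 * (s / X) * l X * j := by gcongr
    _ = s * (Real.exp 1 * l X / X * j) := by ring
    _ ≤ s * s := by gcongr
    _ = 1 * s ^ 2 := by ring

theorem truncLevel_set_bddBelow {j : ℕ} :
    BddBelow {s : ℝ | levelBase l ≤ s ∧ l s / s ^ 2 ≤ 1 / (j : ℝ)} :=
  ⟨levelBase l, fun _ hs => hs.1⟩

theorem levelBase_le_truncLevel (hl : SlowlyVarying l) {j : ℕ} (hj : 1 ≤ j) :
    levelBase l ≤ truncLevel l j :=
  le_csInf (truncLevel_set_nonempty hl hj) fun _ hs => hs.1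

theorem truncLevel_pos (hl : SlowlyVarying l) (hm : Monotone l) {j : ℕ} (hj : 1 ≤ j) :
    0 < truncLevel l j := by
  linarith [levelBase_le_truncLevel hl hj, (levelBase_aux hl hm).1]

theorem le_truncMoment_truncLevel (hl : SlowlyVarying l) (hm : Monotone l) {j : ℕ} (hj : 1 ≤ j) :
    l (levelBase l) ≤ l (truncLevel l j) := hm (levelBase_le_truncLevel hl hj)

theorem truncMoment_truncLevel_pos (hl : SlowlyVarying l) (hm : Monotone l) {j : ℕ} (hj : 1 ≤ j) :
    0 < l (truncLevel l j) :=
  (levelBase_aux hl hm).2.trans_le (le_truncMoment_truncLevel hl hm hj)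

theorem truncLevel_mono (hl : SlowlyVarying l) {j m : ℕ} (hj : 1 ≤ j) (hjm : j ≤ m) :
    truncLevel l j ≤ truncLevel l m := by
  refine csInf_le_csInf truncLevel_set_bddBelow (truncLevel_set_nonempty hl (hj.trans hjm)) ?_
  rintro s ⟨h1, h2⟩
  refine ⟨h1, h2.trans ?_⟩
  have : (0 : ℝ) < j := by exact_mod_cast hj
  gcongr

/-- The infimum that defines the truncation level is attained, by right continuity. -/
theorem mul_truncMoment_le_sq (hl : SlowlyVarying l) (hm : Monotone l)
    (hr : ∀ x, ContinuousWithinAt l (Ici x) x) {j : ℕ} (hj : 1 ≤ j) :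
    j * l (truncLevel l j) ≤ truncLevel l j ^ 2 := by
  set E := {s : ℝ | levelBase l ≤ s ∧ l s / s ^ 2 ≤ 1 / (j : ℝ)} with hE
  have hj0 : (0 : ℝ) < j := by exact_mod_cast hj
  have hη : truncLevel l j = sInf E := rfl
  have hpos := truncLevel_pos hl hm hj
  have hcl : sInf E ∈ closure E :=
    csInf_mem_closure (truncLevel_set_nonempty hl hj) truncLevel_set_bddBelow
  have hsub : E ⊆ Ici (sInf E) := fun s hs => csInf_le truncLevel_set_bddBelow hs
  rw [← hη] at hcl hsub
  have : (𝓝[E] truncLevel l j).NeBot := mem_closure_iff_nhdsWithin_neBot.1 hcl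
  have ht : Tendsto (fun s => l s / s ^ 2) (𝓝[E] truncLevel l j)
      (𝓝 (l (truncLevel l j) / truncLevel l j ^ 2)) := by
    refine Tendsto.div ((hr _).mono hsub) ?_ (by positivity)
    exact (Continuous.tendsto (by fun_prop) _).mono_left nhdsWithin_le_nhds
  have h1 := le_of_tendsto ht (eventually_mem_nhdsWithin.mono fun s hs => hs.2)
  rw [div_le_div_iff₀ (by positivity) hj0] at h1
  linarith

/-- The converse of `mul_truncMoment_le_sq` up to a constant: half the truncation level either
violates the defining inequality or lies below the base point, and then the level is bounded. -/
theorem exists_sq_le_mul_truncMoment (hl : SlowlyVarying l) (hm : Monotone l) :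
    ∃ C, 0 < C ∧ ∀ j : ℕ, 1 ≤ j → truncLevel l j ^ 2 ≤ C * (j * l (truncLevel l j)) := by
  obtain ⟨hb, hlb⟩ := levelBase_aux hl hm
  refine ⟨4 + 4 * levelBase l ^ 2 / l (levelBase l), by positivity, fun j hj => ?_⟩
  have hj1 : (1 : ℝ) ≤ j := by exact_mod_cast hj
  have hj0 : (0 : ℝ) < j := by linarith
  have hpos := truncLevel_pos hl hm hj
  have hle := le_truncMoment_truncLevel hl hm hj
  rw [add_mul]
  by_cases hc : levelBase l ≤ truncLevel l j / 2
  · have hn : truncLevel l j / 2 ∉ {s : ℝ | levelBase l ≤ s ∧ l s / s ^ 2 ≤ 1 / (j : ℝ)} :=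
      fun hmem => by
        have : truncLevel l j ≤ truncLevel l j / 2 := csInf_le truncLevel_set_bddBelow hmem
        linarith
    -- minimality of the level: the inequality fails at half of it
    have h1 : 1 / (j : ℝ) < l (truncLevel l j / 2) / (truncLevel l j / 2) ^ 2 := by
      by_contra! h
      exact hn ⟨hc, h⟩
    rw [div_lt_div_iff₀ hj0 (by positivity)] at h1
    have h2 : l (truncLevel l j / 2) ≤ l (truncLevel l j) := hm (by linarith)
    have h3 : 0 ≤ 4 * levelBase l ^ 2 / l (levelBase l) * (j * l (truncLevel l j)) := by
      have := hlb.trans_le hle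
      positivity
    nlinarith
  · push Not at hc
    have h1 : truncLevel l j ^ 2 ≤ 4 * levelBase l ^ 2 := by nlinarith
    have h2 : 4 * levelBase l ^ 2 ≤
        4 * levelBase l ^ 2 / l (levelBase l) * (j * l (truncLevel l j)) := by
      rw [div_mul_eq_mul_div, le_div_iff₀ hlb]
      have : l (levelBase l) ≤ j * l (truncLevel l j) := by nlinarith
      gcongr
    have := hlb.trans_le hle
    have h3 : 0 ≤ 4 * (j * l (truncLevel l j)) := by positivity
    linarith

theorem tendsto_truncLevel (hl : SlowlyVarying l) (hm : Monotone l)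
    (hr : ∀ x, ContinuousWithinAt l (Ici x) x) : Tendsto (truncLevel l) atTop atTop := by
  obtain ⟨hb, hlb⟩ := levelBase_aux hl hm
  have h1 : Tendsto (fun j : ℕ => Real.sqrt (j * l (levelBase l))) atTop atTop :=
    Real.tendsto_sqrt_atTop.comp (tendsto_natCast_atTop_atTop.atTop_mul_const hlb)
  refine tendsto_atTop_mono' _ ?_ h1
  filter_upwards [eventually_ge_atTop 1] with j hj
  rw [Real.sqrt_le_left (truncLevel_pos hl hm hj).le]
  refine le_trans ?_ (mul_truncMoment_le_sq hl hm hr hj)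
  have := le_truncMoment_truncLevel hl hm hj
  gcongr

/-- By Potter's bound with exponent one the point `e (m / n) η_n` satisfies the inequality that
defines `η_m`. -/
theorem exists_truncLevel_growth (hl : SlowlyVarying l) (hm : Monotone l)
    (hr : ∀ x, ContinuousWithinAt l (Ici x) x) :
    ∃ N : ℕ, 1 ≤ N ∧ ∀ n m : ℕ, N ≤ n → n ≤ m →
      truncLevel l m ≤ Real.exp 1 * (m / n) * truncLevel l n := by
  obtain ⟨X, hX, hpos, hp⟩ := hl.potter one_pos
  obtain ⟨N, hN⟩ := eventually_atTop.1 ((tendsto_truncLevel hl hm hr).eventually_ge_atTop X)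
  refine ⟨max N 1, le_max_right _ _, fun n m hn hnm => ?_⟩
  have hn1 : 1 ≤ n := (le_max_right _ _).trans hn
  have hη := hN n ((le_max_left _ _).trans hn)
  have hη0 := truncLevel_pos hl hm hn1
  have hn0 : (0 : ℝ) < n := by exact_mod_cast hn1
  have hm0 : (0 : ℝ) < m := by exact_mod_cast hn1.trans hnm
  have hr1 : (1 : ℝ) ≤ m / n := (one_le_div hn0).2 (by exact_mod_cast hnm)
  have he : 1 ≤ Real.exp 1 := Real.one_le_exp zero_le_one
  set c := Real.exp 1 * ((m : ℝ) / n) with hcdef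
  have hc : 1 ≤ c := one_le_mul_of_one_le_of_one_le he hr1
  have hle : truncLevel l n ≤ c * truncLevel l n := by nlinarith
  refine csInf_le truncLevel_set_bddBelow ⟨(levelBase_le_truncLevel hl hn1).trans hle, ?_⟩
  have h1 := (hp _ _ hη hle).1
  rw [Real.rpow_one, mul_div_cancel_right₀ _ hη0.ne'] at h1
  have h2 := mul_truncMoment_le_sq hl hm hr hn1
  rw [div_le_div_iff₀ (by positivity) hm0]
  have hmc : (m : ℝ) * Real.exp 1 = c * n := by rw [hcdef]; field_simp
  calc l (c * truncLevel l n) * m ≤ Real.exp 1 * c * l (truncLevel l n) * m := by gcongr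
    _ = c * (m * Real.exp 1) * l (truncLevel l n) := by ring
    _ = c ^ 2 * (n * l (truncLevel l n)) := by rw [hmc]; ring
    _ ≤ c ^ 2 * truncLevel l n ^ 2 := by gcongr
    _ = 1 * (c * truncLevel l n) ^ 2 := by ring

/-- Potter's bound for `n ↦ l (η_n)`, from index `1` on. -/
theorem exists_truncMoment_growth (hl : SlowlyVarying l) (hm : Monotone l)
    (hr : ∀ x, ContinuousWithinAt l (Ici x) x) {δ : ℝ} (hδ : 0 < δ) :
    ∃ C, 0 < C ∧ ∀ n m : ℕ, 1 ≤ n → n ≤ m →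
      l (truncLevel l m) ≤ C * ((m : ℝ) / n) ^ δ * l (truncLevel l n) := by
  obtain ⟨X, hX, hpos, hp⟩ := hl.potter hδ
  obtain ⟨N₁, hN₁⟩ := eventually_atTop.1 ((tendsto_truncLevel hl hm hr).eventually_ge_atTop X)
  obtain ⟨N₂, hN₂, hg⟩ := exists_truncLevel_growth hl hm hr
  set N := max N₁ N₂ with hN
  have he : 1 ≤ Real.exp 1 := Real.one_le_exp zero_le_one
  have key : ∀ n m : ℕ, N ≤ n → n ≤ m → l (truncLevel l m) ≤
      (Real.exp δ * Real.exp 1 ^ δ) * ((m : ℝ) / n) ^ δ * l (truncLevel l n) := by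
    intro n m hn hnm
    have hn1 : 1 ≤ n := hN₂.trans ((le_max_right _ _).trans hn)
    have hn0 : (0 : ℝ) < n := by exact_mod_cast hn1
    have hη0 := truncLevel_pos hl hm hn1
    have hr1 : (1 : ℝ) ≤ m / n := (one_le_div hn0).2 (by exact_mod_cast hnm)
    have h1 := hm (hg n m ((le_max_right _ _).trans hn) hnm)
    have hc : 1 ≤ Real.exp 1 * ((m : ℝ) / n) := one_le_mul_of_one_le_of_one_le he hr1
    have h2 := (hp (truncLevel l n) (Real.exp 1 * (m / n) * truncLevel l n)
      (hN₁ n ((le_max_left _ _).trans hn)) (by nlinarith)).1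
    rw [mul_div_cancel_right₀ _ hη0.ne', Real.mul_rpow (by positivity) (by positivity)] at h2
    refine h1.trans (h2.trans (le_of_eq (by ring)))
  have hN1 : 1 ≤ N := hN₂.trans (le_max_right _ _)
  have hv1 := truncMoment_truncLevel_pos hl hm le_rfl
  have hvN := truncMoment_truncLevel_pos hl hm hN1
  set C₀ := Real.exp δ * Real.exp 1 ^ δ with hC₀
  have hC₀1 : 1 ≤ C₀ := one_le_mul_of_one_le_of_one_le (Real.one_le_exp hδ.le)
    (Real.one_le_rpow he hδ.le)
  -- the quotient `l (η_N) / l (η_1)` pays for the finitely many indices below `N`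
  have hKpos : 1 ≤ l (truncLevel l N) / l (truncLevel l 1) :=
    (one_le_div hv1).2 (hm (truncLevel_mono hl le_rfl hN1))
  refine ⟨C₀ * (l (truncLevel l N) / l (truncLevel l 1)), by positivity, fun n m hn hnm => ?_⟩
  have hn0 : (0 : ℝ) < n := by exact_mod_cast hn
  have hvn := truncMoment_truncLevel_pos hl hm hn
  have hN0 : (0 : ℝ) < N := by exact_mod_cast hN1
  have h1 : l (truncLevel l m) ≤ l (truncLevel l (max m N)) :=
    hm (truncLevel_mono hl (hn.trans hnm) (le_max_left _ _))
  have h2 := key (max n N) (max m N) (le_max_right _ _) (max_le_max hnm le_rfl)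
  have h3 : ((max m N : ℕ) : ℝ) / ((max n N : ℕ) : ℝ) ≤ m / n := by
    have hmn : (n : ℝ) ≤ m := by exact_mod_cast hnm
    have hm0 : (0 : ℝ) < m := hn0.trans_le hmn
    rw [div_le_div_iff₀ (by positivity) hn0]
    push_cast
    rcases le_total (m : ℝ) N with h | h
    · rw [max_eq_right h, max_eq_right (hmn.trans h)]; nlinarith
    · rw [max_eq_left h]
      gcongr; exact le_max_left _ _
  have h4 : l (truncLevel l (max n N)) ≤
      l (truncLevel l N) / l (truncLevel l 1) * l (truncLevel l n) := by
    rcases le_total n N with h | h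
    · rw [max_eq_right h, div_mul_eq_mul_div, le_div_iff₀ hv1]
      have : l (truncLevel l 1) ≤ l (truncLevel l n) := hm (truncLevel_mono hl le_rfl hn)
      gcongr
    · rw [max_eq_left h]
      exact le_mul_of_one_le_left hvn.le hKpos
  have h5 := truncMoment_truncLevel_pos hl hm (hn.trans (le_max_left n N))
  calc l (truncLevel l m) ≤ _ := h1.trans h2
    _ ≤ C₀ * ((m : ℝ) / n) ^ δ *
        (l (truncLevel l N) / l (truncLevel l 1) * l (truncLevel l n)) := by gcongr
    _ = _ := by ring

/-- Over indices of comparable size `l (η_n)` is asymptotically constant: the levels differ by a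
bounded factor, and `l` is monotone and slowly varying. -/
theorem tendsto_truncMoment_ratio (hl : SlowlyVarying l) (hm : Monotone l)
    (hr : ∀ x, ContinuousWithinAt l (Ici x) x) {m : ℕ → ℕ} {y : ℝ} (hy : 0 < y)
    (hnm : ∀ᶠ n in atTop, n ≤ m n ∧ (m n : ℝ) ≤ y * n) :
    Tendsto (fun n => l (truncLevel l (m n)) / l (truncLevel l n)) atTop (𝓝 1) := by
  obtain ⟨N, hN1, hg⟩ := exists_truncLevel_growth hl hm hr
  have hη := tendsto_truncLevel hl hm hr
  have hup : Tendsto (fun n => l (Real.exp 1 * y * truncLevel l n) / l (truncLevel l n)) atTop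
      (𝓝 1) := (hl.2 (Real.exp 1 * y) (by positivity)).comp hη
  refine tendsto_of_tendsto_of_tendsto_of_le_of_le' tendsto_const_nhds hup ?_ ?_
  · filter_upwards [hnm, eventually_ge_atTop 1] with n hn hn1
    exact (one_le_div (truncMoment_truncLevel_pos hl hm hn1)).2 (hm (truncLevel_mono hl hn1 hn.1))
  · filter_upwards [hnm, eventually_ge_atTop N] with n hn hnN
    have hn1 := hN1.trans hnN
    have hn0 : (0 : ℝ) < n := by exact_mod_cast hn1
    have hv := truncMoment_truncLevel_pos hl hm hn1
    have hη0 := truncLevel_pos hl hm hn1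
    gcongr
    refine hm ((hg n (m n) hnN hn.1).trans ?_)
    gcongr
    rw [div_le_iff₀ hn0]; exact hn.2

end TruncLevel

/-! ### Truncated moments of a law on the line -/

section TruncatedMoments

variable (ν : Measure ℝ)

/-- The truncated second moment of a law on the line. -/
noncomputable def lawTruncSecondMoment (x : ℝ) : ℝ := ∫ y in {y : ℝ | |y| ≤ x}, y ^ 2 ∂ν

/-- The truncated third absolute moment of a law on the line. -/
noncomputable def lawTruncThirdMoment (x : ℝ) : ℝ := ∫ y in {y : ℝ | |y| ≤ x}, |y| ^ 3 ∂ν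

/-- The tail of the first absolute moment of a law on the line. -/
noncomputable def lawTailMoment (x : ℝ) : ℝ := ∫ y in {y : ℝ | x < |y|}, |y| ∂ν

theorem measurableSet_abs_le (x : ℝ) : MeasurableSet {y : ℝ | |y| ≤ x} :=
  measurableSet_le (by fun_prop) measurable_const

theorem measurableSet_lt_abs (x : ℝ) : MeasurableSet {y : ℝ | x < |y|} :=
  measurableSet_lt measurable_const (by fun_prop)

theorem truncSecondMoment_eq_law {Ω : Type*} [MeasurableSpace Ω] {P : Measure Ω} {ξ : Ω → ℝ}
    (hξ : AEMeasurable ξ P) :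
    truncSecondMoment P ξ = lawTruncSecondMoment (P.map ξ) := by
  ext x
  rw [truncSecondMoment, lawTruncSecondMoment, ← integral_indicator (measurableSet_abs_le x),
    integral_map hξ]
  · rfl
  · exact ((by fun_prop : Measurable fun y : ℝ => y ^ 2).indicator
      (measurableSet_abs_le x)).aestronglyMeasurable

variable {ν}

theorem lawTruncSecondMoment_nonneg (x : ℝ) : 0 ≤ lawTruncSecondMoment ν x :=
  integral_nonneg fun y => sq_nonneg y

theorem lawTruncThirdMoment_nonneg (x : ℝ) : 0 ≤ lawTruncThirdMoment ν x :=
  integral_nonneg fun y => by positivity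

theorem lawTailMoment_nonneg (x : ℝ) : 0 ≤ lawTailMoment ν x :=
  integral_nonneg fun y => abs_nonneg y

/-- Splitting of the range `{|y| ≤ b}` at the height `a`. -/
theorem abs_le_diff {a b : ℝ} :
    {y : ℝ | |y| ≤ b} \ {y : ℝ | |y| ≤ a} = {y : ℝ | a < |y| ∧ |y| ≤ b} := by
  ext y
  simp only [Set.mem_sdiff, mem_ofPred_eq, not_le]
  tauto

variable [IsFiniteMeasure ν]

theorem integrableOn_pow_abs_le (p : ℕ) (x : ℝ) :
    IntegrableOn (fun y : ℝ => |y| ^ p) {y : ℝ | |y| ≤ x} ν := by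
  refine Measure.integrableOn_of_bounded (measure_ne_top ν _) (M := |x| ^ p) (by fun_prop) ?_
  refine (ae_restrict_mem (measurableSet_abs_le x)).mono fun y hy => ?_
  have hy : |y| ≤ x := hy
  rw [Real.norm_eq_abs, abs_pow, abs_abs]
  exact pow_le_pow_left₀ (abs_nonneg _) (hy.trans (le_abs_self x)) p

theorem integrableOn_sq_abs_le (x : ℝ) :
    IntegrableOn (fun y : ℝ => y ^ 2) {y : ℝ | |y| ≤ x} ν := by
  simpa only [sq_abs] using integrableOn_pow_abs_le (ν := ν) 2 x

theorem lawTruncSecondMoment_mono : Monotone (lawTruncSecondMoment ν) := by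
  intro x y hxy
  refine setIntegral_mono_set (integrableOn_sq_abs_le y)
    (Eventually.of_forall fun z => sq_nonneg z) (Eventually.of_forall fun z hz => ?_)
  exact le_trans (show |z| ≤ x from hz) hxy

theorem lawTruncSecondMoment_rightCont (x : ℝ) :
    ContinuousWithinAt (lawTruncSecondMoment ν) (Ici x) x := by
  have h : ∀ z, lawTruncSecondMoment ν z =
      ∫ y, {y : ℝ | |y| ≤ z}.indicator (fun y => y ^ 2) y ∂ν := fun z => by
    rw [lawTruncSecondMoment, integral_indicator (measurableSet_abs_le z)]
  rw [funext h]
  show Tendsto (fun z => ∫ y, {y : ℝ | |y| ≤ z}.indicator (fun y => y ^ 2) y ∂ν) (𝓝[≥] x)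
    (𝓝 (∫ y, {y : ℝ | |y| ≤ x}.indicator (fun y => y ^ 2) y ∂ν))
  refine tendsto_integral_filter_of_dominated_convergence
    ({y : ℝ | |y| ≤ x + 1}.indicator (fun y => y ^ 2)) ?_ ?_ ?_ ?_
  · exact Eventually.of_forall fun z => ((by fun_prop : Measurable fun y : ℝ => y ^ 2).indicator
      (measurableSet_abs_le z)).aestronglyMeasurable
  · have h1 : ∀ᶠ z in 𝓝[≥] x, z < x + 1 := nhdsWithin_le_nhds (gt_mem_nhds (by linarith))
    filter_upwards [h1] with z hz
    refine Eventually.of_forall fun y => ?_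
    rw [norm_indicator_eq_indicator_norm]
    simp only [norm_pow, Real.norm_eq_abs, sq_abs]
    refine indicator_le_indicator_of_subset (fun w hw => ?_) (fun w => sq_nonneg w) y
    exact le_trans (show |w| ≤ z from hw) hz.le
  · exact (integrable_indicator_iff (measurableSet_abs_le _)).2 (integrableOn_sq_abs_le _)
  · refine Eventually.of_forall fun y => tendsto_const_nhds.congr' ?_
    by_cases hy : |y| ≤ x
    · filter_upwards [self_mem_nhdsWithin] with z hz
      rw [indicator_of_mem (show y ∈ {y : ℝ | |y| ≤ x} from hy),
        indicator_of_mem (show y ∈ {y : ℝ | |y| ≤ z} from hy.trans hz)]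
    · push Not at hy
      have h1 : ∀ᶠ z in 𝓝[≥] x, z < |y| := nhdsWithin_le_nhds (gt_mem_nhds hy)
      filter_upwards [h1] with z hz
      rw [indicator_of_notMem (show y ∉ {y : ℝ | |y| ≤ x} from hy.not_ge),
        indicator_of_notMem (show y ∉ {y : ℝ | |y| ≤ z} from hz.not_ge)]

theorem lawTruncSecondMoment_sub {a b : ℝ} (hab : a ≤ b) :
    lawTruncSecondMoment ν b - lawTruncSecondMoment ν a =
      ∫ y in {y : ℝ | a < |y| ∧ |y| ≤ b}, y ^ 2 ∂ν := by
  rw [← abs_le_diff, setIntegral_sdiff (measurableSet_abs_le a) (integrableOn_sq_abs_le b)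
    (fun y hy => le_trans (show |y| ≤ a from hy) hab)]
  rfl

/-- Below the height `a` one factor `|y|` is at most `a`, above it at most `b`. -/
theorem lawTruncThirdMoment_le {a b : ℝ} (hab : a ≤ b) :
    lawTruncThirdMoment ν b ≤ a * lawTruncSecondMoment ν a +
      b * (lawTruncSecondMoment ν b - lawTruncSecondMoment ν a) := by
  have h1 : lawTruncThirdMoment ν b = lawTruncThirdMoment ν a +
      ∫ y in {y : ℝ | a < |y| ∧ |y| ≤ b}, |y| ^ 3 ∂ν := by
    rw [← abs_le_diff, setIntegral_sdiff (measurableSet_abs_le a) (integrableOn_pow_abs_le 3 b)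
      (fun y hy => le_trans (show |y| ≤ a from hy) hab)]
    simp [lawTruncThirdMoment]
  rw [h1, lawTruncSecondMoment_sub hab, lawTruncSecondMoment, ← integral_const_mul,
    ← integral_const_mul]
  have hsub : {y : ℝ | a < |y| ∧ |y| ≤ b} ⊆ {y : ℝ | |y| ≤ b} := fun y hy => hy.2
  refine add_le_add ?_ ?_
  · refine setIntegral_mono_on (integrableOn_pow_abs_le 3 a)
      ((integrableOn_sq_abs_le a).const_mul a) (measurableSet_abs_le a) fun y hy => ?_
    have hy : |y| ≤ a := hy
    rw [← sq_abs, pow_succ, mul_comm]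
    gcongr
  · refine setIntegral_mono_on ((integrableOn_pow_abs_le 3 b).mono_set hsub)
      (((integrableOn_sq_abs_le b).mono_set hsub).const_mul b)
      ((measurableSet_lt_abs a).inter (measurableSet_abs_le b)) fun y hy => ?_
    have hy : |y| ≤ b := hy.2
    rw [← sq_abs, pow_succ, mul_comm]
    gcongr

/-- `E |ξ|³ 1(|ξ| ≤ x) = o(x l(x))`. -/
theorem exists_lawTruncThirdMoment_le (hl : SlowlyVarying (lawTruncSecondMoment ν)) {δ : ℝ}
    (hδ : 0 < δ) :
    ∃ X, ∀ x, X ≤ x → lawTruncThirdMoment ν x ≤ δ * (x * lawTruncSecondMoment ν x) := by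
  set c := min (δ / 2) 1 with hc
  have hc0 : 0 < c := by positivity
  obtain ⟨A, hA, hpos⟩ := hl.eventually_pos
  have h1 : ∀ᶠ x in atTop, 1 - δ / 2 < lawTruncSecondMoment ν (c * x) / lawTruncSecondMoment ν x :=
    (hl.2 c hc0).eventually (lt_mem_nhds (by linarith))
  obtain ⟨X, hX⟩ := eventually_atTop.1 (h1.and (eventually_ge_atTop A))
  refine ⟨X, fun x hx => ?_⟩
  obtain ⟨h2, h3⟩ := hX x hx
  have hx0 : 0 < x := hA.trans_le h3
  have hlx := hpos x h3
  rw [lt_div_iff₀ hlx] at h2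
  -- split at the height `c x`: below it one factor is at most `δ x / 2`, above it the increment of
  -- the truncated second moment is a small fraction of its value
  have hcx : c * x ≤ x := by nlinarith [min_le_right (δ / 2) (1 : ℝ)]
  refine (lawTruncThirdMoment_le hcx).trans ?_
  have h4 : lawTruncSecondMoment ν (c * x) ≤ lawTruncSecondMoment ν x :=
    lawTruncSecondMoment_mono hcx
  have h5 : c * x * lawTruncSecondMoment ν (c * x) ≤ δ / 2 * (x * lawTruncSecondMoment ν x) := by
    have : c ≤ δ / 2 := min_le_left _ _
    have h6 := lawTruncSecondMoment_nonneg (ν := ν) (c * x)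
    calc c * x * lawTruncSecondMoment ν (c * x)
        ≤ δ / 2 * x * lawTruncSecondMoment ν x := by gcongr
      _ = _ := by ring
  have h7 : x * (lawTruncSecondMoment ν x - lawTruncSecondMoment ν (c * x)) ≤
      x * (δ / 2 * lawTruncSecondMoment ν x) := by
    gcongr; linarith
  linarith

/-- Induction over the dyadic shells. The first shell contributes `δ l(x)`, the others, by the
bound at `2 x`, at most `2 δ (1 + δ) l(x)`; together this is at most `4 δ l(x)` for `δ ≤ 1 / 2`. -/
theorem integral_shell_le (hl : SlowlyVarying (lawTruncSecondMoment ν)) {δ : ℝ}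
    (hδ : 0 < δ) (hδ1 : δ ≤ 1 / 2) :
    ∃ X, 0 < X ∧ ∀ (N : ℕ) (x : ℝ), X ≤ x →
      x * ∫ y in {y : ℝ | x < |y| ∧ |y| ≤ 2 ^ N * x}, |y| ∂ν ≤
        4 * δ * lawTruncSecondMoment ν x := by
  obtain ⟨A, hA, hpos⟩ := hl.eventually_pos
  have h1 : ∀ᶠ x in atTop, lawTruncSecondMoment ν (2 * x) / lawTruncSecondMoment ν x < 1 + δ :=
    (hl.2 2 two_pos).eventually (gt_mem_nhds (by linarith))
  obtain ⟨X, hX⟩ := eventually_atTop.1 (h1.and (eventually_ge_atTop A))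
  refine ⟨max X A, by positivity, fun N => ?_⟩
  have hint : ∀ a b : ℝ, IntegrableOn (fun y : ℝ => |y|) {y : ℝ | a < |y| ∧ |y| ≤ b} ν := by
    intro a b
    have := integrableOn_pow_abs_le (ν := ν) 1 b
    simp only [pow_one] at this
    exact this.mono_set fun y hy => hy.2
  induction N with
  | zero =>
    intro x hx
    have he : {y : ℝ | x < |y| ∧ |y| ≤ 2 ^ 0 * x} = ∅ := by
      ext y
      simp only [pow_zero, one_mul, mem_ofPred_eq, mem_empty_iff_false, iff_false, not_and, not_le,
        imp_self]
    have hl0 := lawTruncSecondMoment_nonneg (ν := ν) x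
    rw [he, setIntegral_empty, mul_zero]
    positivity
  | succ N ih =>
    intro x hx
    obtain ⟨h2, h3⟩ := hX x ((le_max_left _ _).trans hx)
    have hx0 : 0 < x := hA.trans_le h3
    have hlx := hpos x h3
    rw [div_lt_iff₀ hlx] at h2
    have h4 := ih (2 * x) (by linarith)
    have hpow : (1 : ℝ) ≤ 2 ^ N := one_le_pow₀ (by norm_num)
    have hsplit : {y : ℝ | x < |y| ∧ |y| ≤ 2 ^ (N + 1) * x} =
        {y : ℝ | x < |y| ∧ |y| ≤ 2 * x} ∪ {y : ℝ | 2 * x < |y| ∧ |y| ≤ 2 ^ N * (2 * x)} := by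
      ext y
      have e : (2 : ℝ) ^ N * (2 * x) = 2 ^ (N + 1) * x := by ring
      have h5 : 2 * x ≤ 2 ^ (N + 1) * x := by rw [← e]; nlinarith
      simp only [mem_union, mem_ofPred_eq, e]
      constructor
      · rintro ⟨ha, hb⟩
        rcases le_or_gt |y| (2 * x) with h | h
        · exact Or.inl ⟨ha, h⟩
        · exact Or.inr ⟨h, hb⟩
      · rintro (⟨ha, hb⟩ | ⟨ha, hb⟩)
        · exact ⟨ha, hb.trans h5⟩
        · exact ⟨by linarith, hb⟩
    have hdisj : Disjoint {y : ℝ | x < |y| ∧ |y| ≤ 2 * x}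
        {y : ℝ | 2 * x < |y| ∧ |y| ≤ 2 ^ N * (2 * x)} := by
      rw [Set.disjoint_left]
      rintro y ⟨_, h⟩ ⟨h', _⟩
      exact absurd h h'.not_ge
    rw [hsplit, setIntegral_union hdisj ((measurableSet_lt_abs _).inter (measurableSet_abs_le _))
      (hint _ _) (hint _ _), mul_add]
    have h6 : x * ∫ y in {y : ℝ | x < |y| ∧ |y| ≤ 2 * x}, |y| ∂ν ≤
        lawTruncSecondMoment ν (2 * x) - lawTruncSecondMoment ν x := by
      rw [lawTruncSecondMoment_sub (by linarith), ← integral_const_mul]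
      refine setIntegral_mono_on ((hint _ _).const_mul x)
        ((integrableOn_sq_abs_le (2 * x)).mono_set fun y hy => hy.2)
        ((measurableSet_lt_abs _).inter (measurableSet_abs_le _)) fun y hy => ?_
      have hy : x < |y| := hy.1
      rw [← sq_abs, sq]
      gcongr
    have h7 : 4 * δ * lawTruncSecondMoment ν (2 * x) ≤
        4 * δ * ((1 + δ) * lawTruncSecondMoment ν x) := by gcongr
    have h8 : δ * (δ * lawTruncSecondMoment ν x) ≤ 1 / 2 * (δ * lawTruncSecondMoment ν x) := by
      gcongr
    linarith

/-- `E |ξ| 1(|ξ| > x) = o(l(x) / x)`: on the shells `2ʲ x < |ξ| ≤ 2ʲ⁺¹ x` the increments of `l`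
are at most `δ (1 + δ)ʲ l(x)`. -/
theorem exists_lawTailMoment_le (hl : SlowlyVarying (lawTruncSecondMoment ν))
    (hint : Integrable (fun y : ℝ => y) ν) {δ : ℝ} (hδ : 0 < δ) :
    ∃ X, ∀ x, X ≤ x → x * lawTailMoment ν x ≤ δ * lawTruncSecondMoment ν x := by
  obtain ⟨X, hX0, hX⟩ := integral_shell_le hl (δ := min (δ / 4) (1 / 2)) (by positivity)
    (min_le_right _ _)
  refine ⟨X, fun x hx => ?_⟩
  have hx0 : 0 < x := hX0.trans_le hx
  have hU : (⋃ N : ℕ, {y : ℝ | x < |y| ∧ |y| ≤ 2 ^ N * x}) = {y : ℝ | x < |y|} := by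
    ext y
    simp only [mem_iUnion, mem_ofPred_eq]
    refine ⟨fun ⟨_, h, _⟩ => h, fun h => ?_⟩
    obtain ⟨N, hN⟩ := pow_unbounded_of_one_lt (|y| / x) (by norm_num : (1 : ℝ) < 2)
    rw [div_lt_iff₀ hx0] at hN
    exact ⟨N, h, hN.le⟩
  have ht : Tendsto (fun N : ℕ => ∫ y in {y : ℝ | x < |y| ∧ |y| ≤ 2 ^ N * x}, |y| ∂ν) atTop
      (𝓝 (∫ y in ⋃ N : ℕ, {y : ℝ | x < |y| ∧ |y| ≤ 2 ^ N * x}, |y| ∂ν)) := by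
    refine tendsto_setIntegral_of_monotone
      (fun N => (measurableSet_lt_abs _).inter (measurableSet_abs_le _)) ?_ hint.abs.integrableOn
    intro N M hNM y hy
    refine ⟨hy.1, hy.2.trans ?_⟩
    gcongr
    norm_num
  rw [hU] at ht
  refine (le_of_tendsto (ht.const_mul x) (Eventually.of_forall fun N => hX N x hx)).trans ?_
  have := lawTruncSecondMoment_nonneg (ν := ν) x
  gcongr
  linarith [min_le_left (δ / 4) (1 / 2 : ℝ)]

end TruncatedMoments

/-! ### Sums over the integers as integrals of step functions -/

/-- The cells `⌊n x⌋ = z` have length `1 / n`, so sums over the integers are integrals of step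
functions. -/
theorem map_floor_mul_volume {n : ℕ} (hn : 1 ≤ n) :
    (volume : Measure ℝ).map (fun x : ℝ => ⌊(n : ℝ) * x⌋) =
      ENNReal.ofReal (1 / n) • (Measure.count : Measure ℤ) := by
  have hn0 : (0 : ℝ) < n := by exact_mod_cast hn
  refine Measure.ext_of_singleton fun z => ?_
  rw [Measure.map_apply (by fun_prop) (measurableSet_singleton z)]
  have : (fun x : ℝ => ⌊(n : ℝ) * x⌋) ⁻¹' {z} = Ico ((z : ℝ) / n) ((z + 1) / n) := by
    ext x
    simp only [mem_preimage, mem_singleton_iff, Int.floor_eq_iff, mem_Ico]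
    rw [div_le_iff₀ hn0, lt_div_iff₀ hn0, mul_comm]
  rw [this, Real.volume_Ico, Measure.smul_apply, Measure.count_singleton, smul_eq_mul, mul_one]
  congr 1
  ring

theorem summable_of_integrable_floor {n : ℕ} (hn : 1 ≤ n) {f : ℤ → ℝ}
    (hf : Integrable (fun x : ℝ => f ⌊(n : ℝ) * x⌋)) : Summable f := by
  have hn0 : (0 : ℝ) < n := by exact_mod_cast hn
  have hm : AEMeasurable (fun x : ℝ => ⌊(n : ℝ) * x⌋) volume :=
    (Int.measurable_floor.comp (by fun_prop)).aemeasurable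
  have h1 : Integrable f ((volume : Measure ℝ).map (fun x : ℝ => ⌊(n : ℝ) * x⌋)) :=
    (integrable_map_measure (measurable_of_countable f).aestronglyMeasurable hm).2 hf
  rw [map_floor_mul_volume hn, integrable_smul_measure (by simp; omega) (by simp)] at h1
  exact integrable_count_iff.1 h1 |>.of_norm

theorem integral_floor_mul {n : ℕ} (hn : 1 ≤ n) {f : ℤ → ℝ} (hf : Summable f) :
    ∫ x : ℝ, f ⌊(n : ℝ) * x⌋ = 1 / n * ∑' r, f r := by
  have hn0 : (0 : ℝ) < n := by exact_mod_cast hn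
  have hm : AEMeasurable (fun x : ℝ => ⌊(n : ℝ) * x⌋) volume :=
    (Int.measurable_floor.comp (by fun_prop)).aemeasurable
  rw [← integral_map (f := f) hm (measurable_of_countable f).aestronglyMeasurable,
    map_floor_mul_volume hn, integral_smul_measure,
    integral_countable (integrable_count_iff.2 hf.norm)]
  simp [Measure.real, ENNReal.toReal_ofReal]

/-- Dominated convergence for rescaled sums over the integers. -/
theorem tendsto_scaled_tsum {f : ℕ → ℤ → ℝ} {g G : ℝ → ℝ} (hG : Integrable G)
    (hdom : ∀ᶠ n : ℕ in atTop, ∀ᵐ x : ℝ, |f n ⌊(n : ℝ) * x⌋| ≤ G x)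
    (hlim : ∀ᵐ x : ℝ, Tendsto (fun n : ℕ => f n ⌊(n : ℝ) * x⌋) atTop (𝓝 (g x))) :
    (∀ᶠ n : ℕ in atTop, Summable (f n)) ∧
      Tendsto (fun n : ℕ => 1 / (n : ℝ) * ∑' r, f n r) atTop (𝓝 (∫ x, g x)) := by
  have hmeas : ∀ n : ℕ, AEStronglyMeasurable (fun x : ℝ => f n ⌊(n : ℝ) * x⌋) volume := fun n =>
    ((measurable_of_countable (f n)).comp
      (Int.measurable_floor.comp (by fun_prop))).aestronglyMeasurable
  have hs : ∀ᶠ n : ℕ in atTop, Summable (f n) := by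
    filter_upwards [hdom, eventually_ge_atTop 1] with n hn h1
    exact summable_of_integrable_floor h1 (hG.mono' (hmeas n) hn)
  refine ⟨hs, ?_⟩
  have := tendsto_integral_filter_of_dominated_convergence G (Eventually.of_forall hmeas)
    hdom hG hlim
  refine this.congr' ?_
  filter_upwards [hs, eventually_ge_atTop 1] with n hn h1
  exact integral_floor_mul h1 hn

/-- The discretization `⌊n x⌋ / n` loses at most a factor two in `1 + |x|`. -/
theorem one_add_abs_le_two_mul_floor {n : ℕ} (hn : 1 ≤ n) (x : ℝ) :
    1 + |x| ≤ 2 * (1 + |((⌊(n : ℝ) * x⌋ : ℤ) : ℝ)| / n) := by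
  have hn0 : (1 : ℝ) ≤ n := by exact_mod_cast hn
  have h1 : (n : ℝ) * |x| ≤ |((⌊(n : ℝ) * x⌋ : ℤ) : ℝ)| + 1 := by
    have ha := Int.floor_le ((n : ℝ) * x)
    have hb := Int.lt_floor_add_one ((n : ℝ) * x)
    rw [← abs_of_nonneg (show (0 : ℝ) ≤ n by linarith), ← abs_mul]
    rw [abs_of_nonneg (show (0 : ℝ) ≤ n by linarith)]
    rcases le_or_gt 0 ((n : ℝ) * x) with h | h
    · rw [abs_of_nonneg h]; linarith [le_abs_self ((⌊(n : ℝ) * x⌋ : ℤ) : ℝ)]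
    · rw [abs_of_neg h]; linarith [neg_abs_le ((⌊(n : ℝ) * x⌋ : ℤ) : ℝ)]
  have h2 : |x| ≤ |((⌊(n : ℝ) * x⌋ : ℤ) : ℝ)| / n + 1 / n := by
    rw [← add_div, le_div_iff₀ (by linarith)]; linarith
  have h3 : 1 / (n : ℝ) ≤ 1 := by
    rw [div_le_one (by linarith)]; exact hn0
  have h4 : 0 ≤ |((⌊(n : ℝ) * x⌋ : ℤ) : ℝ)| / n := by positivity
  linarith

theorem decay_floor_le {n : ℕ} (hn : 1 ≤ n) {p : ℝ} (hp : 0 ≤ p) (x : ℝ) :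
    (1 + |((⌊(n : ℝ) * x⌋ : ℤ) : ℝ)| / n) ^ (-p) ≤ 2 ^ p * (1 + ‖x‖) ^ (-p) := by
  have h := one_add_abs_le_two_mul_floor hn x
  rw [Real.norm_eq_abs]
  have h0 : 0 < 1 + |x| := by positivity
  have h1 : (1 + |x|) / 2 ≤ 1 + |((⌊(n : ℝ) * x⌋ : ℤ) : ℝ)| / n := by linarith
  calc (1 + |((⌊(n : ℝ) * x⌋ : ℤ) : ℝ)| / n) ^ (-p) ≤ ((1 + |x|) / 2) ^ (-p) :=
        Real.rpow_le_rpow_of_nonpos (by positivity) h1 (by linarith)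
    _ = 2 ^ p * (1 + |x|) ^ (-p) := by
        rw [Real.div_rpow h0.le zero_le_two, Real.rpow_neg zero_le_two, div_inv_eq_mul, mul_comm]

theorem integrable_decay {p : ℝ} (hp : 1 < p) :
    Integrable (fun x : ℝ => (2 : ℝ) ^ p * (1 + ‖x‖) ^ (-p)) :=
  (integrable_one_add_norm (by simpa using hp)).const_mul _

/-- A decay on the scale `n` with integrable power has a sum of order `n`. -/
theorem exists_tsum_decay_le {p : ℝ} (hp : 1 < p) :
    ∃ C, 0 < C ∧ ∀ n : ℕ, 1 ≤ n → Summable (fun r : ℤ => (1 + |(r : ℝ)| / n) ^ (-p)) ∧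
      ∑' r : ℤ, (1 + |(r : ℝ)| / n) ^ (-p) ≤ C * n := by
  have hI := integrable_decay hp
  have hI0 : 0 ≤ ∫ x : ℝ, (2 : ℝ) ^ p * (1 + ‖x‖) ^ (-p) :=
    integral_nonneg fun x => by positivity
  refine ⟨(∫ x : ℝ, (2 : ℝ) ^ p * (1 + ‖x‖) ^ (-p)) + 1, by positivity, fun n hn => ?_⟩
  have hn0 : (0 : ℝ) < n := by exact_mod_cast hn
  have hint : Integrable (fun x : ℝ => (1 + |((⌊(n : ℝ) * x⌋ : ℤ) : ℝ)| / n) ^ (-p)) := by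
    refine hI.mono' ?_ (Eventually.of_forall fun x => ?_)
    · exact ((measurable_of_countable (fun r : ℤ => (1 + |(r : ℝ)| / n) ^ (-p))).comp
        (Int.measurable_floor.comp (by fun_prop))).aestronglyMeasurable
    · rw [Real.norm_of_nonneg (by positivity)]
      exact decay_floor_le hn (by linarith) x
  have hs := summable_of_integrable_floor (f := fun r : ℤ => (1 + |(r : ℝ)| / n) ^ (-p)) hn hint
  refine ⟨hs, ?_⟩
  have h1 := integral_floor_mul hn hs
  have h2 := integral_mono hint hI fun x => decay_floor_le hn (by linarith) x
  rw [h1, one_div, inv_mul_le_iff₀ hn0] at h2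
  linarith

/-! ### Regularly varying coefficients -/

/-- A positive sequence that satisfies Potter's bounds with exponent `δ` and constant `K`, from
index `1` on. -/
structure PotterRegular (δ K : ℝ) (Λ : ℕ → ℝ) : Prop where
  exponent_pos : 0 < δ
  one_le : 1 ≤ K
  pos : ∀ n, 0 < Λ n
  le_mul : ∀ m n : ℕ, 1 ≤ m → m ≤ n → Λ n ≤ K * ((n : ℝ) / m) ^ δ * Λ m
  le_mul' : ∀ m n : ℕ, 1 ≤ m → m ≤ n → Λ m ≤ K * ((n : ℝ) / m) ^ δ * Λ n

/-- The sequence is `Λ n = h (max n X)`, with `X` the point from which Potter's bound holds. -/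
theorem SlowlyVarying.exists_potterRegular {h : ℝ → ℝ} (hh : SlowlyVarying h) {δ : ℝ}
    (hδ : 0 < δ) : ∃ K Λ, PotterRegular δ K Λ ∧ ∀ᶠ n : ℕ in atTop, h n = Λ n := by
  obtain ⟨X, hX, hpos, hp⟩ := hh.potter hδ
  have hratio : ∀ m n : ℕ, 1 ≤ m → m ≤ n → max (n : ℝ) X / max (m : ℝ) X ≤ n / m := by
    intro m n hm hmn
    have hm0 : (0 : ℝ) < m := by exact_mod_cast hm
    have hmn' : (m : ℝ) ≤ n := by exact_mod_cast hmn
    rw [div_le_div_iff₀ (by positivity) hm0]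
    rcases le_total (n : ℝ) X with h | h
    · rw [max_eq_right h, max_eq_right (hmn'.trans h)]; nlinarith
    · rw [max_eq_left h]
      have := le_max_left (m : ℝ) X
      gcongr
  refine ⟨Real.exp δ, fun n => h (max n X), ⟨hδ, Real.one_le_exp hδ.le,
    fun n => hpos _ (le_max_right _ _), ?_, ?_⟩, ?_⟩
  · intro m n hm hmn
    have hm0 : (0 : ℝ) < m := by exact_mod_cast hm
    have hmn' : (m : ℝ) ≤ n := by exact_mod_cast hmn
    refine (hp (max m X) (max n X) (le_max_right _ _) (max_le_max hmn' le_rfl)).1.trans ?_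
    have := hpos _ (le_max_right (m : ℝ) X)
    have := hratio m n hm hmn
    gcongr
  · intro m n hm hmn
    have hm0 : (0 : ℝ) < m := by exact_mod_cast hm
    have hmn' : (m : ℝ) ≤ n := by exact_mod_cast hmn
    refine (hp (max m X) (max n X) (le_max_right _ _) (max_le_max hmn' le_rfl)).2.trans ?_
    have := hpos _ (le_max_right (n : ℝ) X)
    have := hratio m n hm hmn
    gcongr
  · filter_upwards [tendsto_natCast_atTop_atTop.eventually_ge_atTop X] with n hn
    rw [max_eq_left hn]

/-- The coefficients extended by zero to the negative integers. -/
noncomputable def coeffExt (a : ℕ → ℝ) (z : ℤ) : ℝ := if 0 ≤ z then a z.toNat else 0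

/-- The coefficient of `ε_r` in `X_{j+1} + ⋯ + X_k`. -/
noncomputable def windowCoeff (a : ℕ → ℝ) (j k : ℕ) (r : ℤ) : ℝ :=
  ∑ i ∈ Finset.Ioc j k, coeffExt a (i - r)

/-- A majorant of all window coefficients with window inside `(0, d]`. -/
noncomputable def absWindow (a : ℕ → ℝ) (d : ℕ) (r : ℤ) : ℝ :=
  ∑ i ∈ Finset.Ioc 0 d, |coeffExt a (i - r)|

theorem abs_windowCoeff_le_absWindow (a : ℕ → ℝ) {j k n : ℕ} (hk : k ≤ n) (r : ℤ) :
    |windowCoeff a j k r| ≤ absWindow a n r := by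
  refine (Finset.abs_sum_le_sum_abs _ _).trans ?_
  exact Finset.sum_le_sum_of_subset_of_nonneg
    (Finset.Ioc_subset_Ioc (Nat.zero_le _) hk) fun _ _ _ => abs_nonneg _

theorem windowCoeff_sub (a : ℕ → ℝ) {j k : ℕ} (hjk : j ≤ k) (r : ℤ) :
    windowCoeff a 0 k r - windowCoeff a 0 j r = windowCoeff a j k r := by
  have := Finset.sum_Ioc_consecutive (fun i : ℕ => coeffExt a (i - r)) (Nat.zero_le j) hjk
  simp only [windowCoeff]
  linarith

theorem windowCoeff_shift (a : ℕ → ℝ) {j k : ℕ} (hjk : j ≤ k) (r : ℤ) :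
    windowCoeff a j k r = windowCoeff a 0 (k - j) (r - j) := by
  simp only [windowCoeff]
  refine Finset.sum_bij' (fun i _ => i - j) (fun i _ => i + j) ?_ ?_ ?_ ?_ ?_
  · intro i hi; simp only [Finset.mem_Ioc] at *; omega
  · intro i hi; simp only [Finset.mem_Ioc] at *; omega
  · intro i hi; simp only [Finset.mem_Ioc] at *; omega
  · intro i hi; simp only [Finset.mem_Ioc] at *; omega
  · intro i hi
    simp only [Finset.mem_Ioc] at hi
    congr 1
    push_cast [Nat.cast_sub hi.1.le]
    ring

/-- Comparison with the integral of `x ^ (-p)`; the step is Bernoulli's inequality. -/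
theorem sum_rpow_neg_le {p : ℝ} (hp0 : 0 ≤ p) (hp1 : p < 1) (N : ℕ) :
    ∑ i ∈ Finset.range N, ((i : ℝ) + 1) ^ (-p) ≤ (N : ℝ) ^ (1 - p) / (1 - p) := by
  have hq : 0 < 1 - p := by linarith
  induction N with
  | zero => simp [Real.zero_rpow hq.ne']
  | succ N ih =>
    rw [Finset.sum_range_succ]
    refine (add_le_add_left ih _).trans ?_
    have hN : (0 : ℝ) < N + 1 := by positivity
    have h1 := rpow_one_add_le_one_add_mul_self (s := -1 / ((N : ℝ) + 1))
      (by rw [le_div_iff₀ hN]; linarith [(Nat.cast_nonneg N : (0 : ℝ) ≤ N)]) hq.le (by linarith)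
    have h2 : 1 + -1 / ((N : ℝ) + 1) = N / (N + 1) := by field_simp; ring
    rw [h2, Real.div_rpow (by positivity) hN.le, div_le_iff₀ (by positivity)] at h1
    have h3 : ((N : ℝ) + 1) ^ (1 - p) = (N + 1) * (N + 1) ^ (-p) := by
      rw [sub_eq_add_neg, Real.rpow_add hN, Real.rpow_one]
    push_cast
    rw [div_add' _ _ _ hq.ne', div_le_div_iff_of_pos_right hq]
    have h4 : (1 + (1 - p) * (-1 / ((N : ℝ) + 1))) * ((N : ℝ) + 1) ^ (1 - p) =
        ((N : ℝ) + 1) ^ (1 - p) - (1 - p) * ((N : ℝ) + 1) ^ (-p) := by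
      rw [h3]; field_simp; ring
    linarith

section Coefficients

variable {a : ℕ → ℝ} {α δ K : ℝ} {Λ : ℕ → ℝ}

/-- The size of a coefficient relative to the index `d`. The two powers cover the indices below and
above `d`. -/
theorem abs_coeff_le (hΛ : PotterRegular δ K Λ)
    (ha : ∀ i : ℕ, |a i| ≤ K * ((i : ℝ) + 1) ^ (-α) * Λ (i + 1)) {d : ℕ} (hd : 1 ≤ d) (i : ℕ) :
    |a i| ≤ K ^ 2 * (Λ d * (d : ℝ) ^ (-α)) *
      ((((i : ℝ) + 1) / d) ^ (-α - δ) + (((i : ℝ) + 1) / d) ^ (-α + δ)) := by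
  have hd0 : (0 : ℝ) < d := by exact_mod_cast hd
  have hK := hΛ.one_le
  have hi0 : (0 : ℝ) < (i : ℝ) + 1 := by positivity
  set x := ((i : ℝ) + 1) / d with hx
  have hx0 : 0 < x := by positivity
  have hΛd := hΛ.pos d
  have e1 : ((i : ℝ) + 1) ^ (-α) = (d : ℝ) ^ (-α) * x ^ (-α) := by
    rw [← Real.mul_rpow hd0.le hx0.le, hx, mul_div_cancel₀ _ hd0.ne']
  have h1 : Λ (i + 1) ≤ K * (x ^ (-δ) + x ^ δ) * Λ d := by
    have p1 : 0 ≤ x ^ (-δ) := by positivity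
    have p2 : 0 ≤ x ^ δ := by positivity
    rcases le_total (i + 1) d with h | h
    · refine (hΛ.le_mul' (i + 1) d (by omega) h).trans ?_
      have : ((d : ℝ) / ((i + 1 : ℕ) : ℝ)) ^ δ = x ^ (-δ) := by
        rw [Real.rpow_neg hx0.le, ← Real.inv_rpow hx0.le, hx, inv_div]; push_cast; rfl
      rw [this]
      gcongr
      linarith
    · refine (hΛ.le_mul d (i + 1) hd h).trans ?_
      have : (((i + 1 : ℕ) : ℝ) / d) ^ δ = x ^ δ := by rw [hx]; push_cast; rfl
      rw [this]
      gcongr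
      linarith
  calc |a i| ≤ K * ((i : ℝ) + 1) ^ (-α) * Λ (i + 1) := ha i
    _ ≤ K * ((i : ℝ) + 1) ^ (-α) * (K * (x ^ (-δ) + x ^ δ) * Λ d) := by gcongr
    _ = _ := by
      rw [e1, sub_eq_add_neg, Real.rpow_add hx0, Real.rpow_add hx0]; ring

/-- A window of length `d` has coefficients of order `d ^ (1 - α) Λ d`, decaying with exponent `α -
δ` in the distance to the window on the scale `d`. -/
theorem exists_absWindow_le (hΛ : PotterRegular δ K Λ)
    (ha : ∀ i : ℕ, |a i| ≤ K * ((i : ℝ) + 1) ^ (-α) * Λ (i + 1))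
    (hδα : δ ≤ α) (hα1 : α + δ < 1) :
    ∃ C, 0 < C ∧ ∀ d : ℕ, 1 ≤ d → ∀ r : ℤ, absWindow a d r ≤
      C * (Λ d * (d : ℝ) ^ (1 - α)) * (1 + |(r : ℝ)| / d) ^ (-(α - δ)) := by
  have hδ := hΛ.exponent_pos
  have hK := hΛ.one_le
  have hq1 : 0 < 1 - (α + δ) := by linarith
  have hq2 : 0 < 1 - (α - δ) := by linarith
  refine ⟨K ^ 2 * 4 + K ^ 2 * (4 / (1 - (α + δ)) + 4 / (1 - (α - δ))) * 3, by positivity,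
    fun d hd r => ?_⟩
  have hd1 : (1 : ℝ) ≤ d := by exact_mod_cast hd
  have hd0 : (0 : ℝ) < d := by linarith
  have hΛd := hΛ.pos d
  set ρ := 1 + |(r : ℝ)| / d with hρ
  have hρ1 : 1 ≤ ρ := by rw [hρ]; linarith [show 0 ≤ |(r : ℝ)| / d by positivity]
  have hρp : 0 < ρ ^ (-(α - δ)) := by positivity
  have hdp : (d : ℝ) ^ (1 - α) = d * (d : ℝ) ^ (-α) := by
    rw [sub_eq_add_neg, Real.rpow_add hd0, Real.rpow_one]
  rcases lt_or_ge (d : ℤ) r with hrd | hrd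
  -- the window lies entirely to the left of `r`
  · have : absWindow a d r = 0 := by
      refine Finset.sum_eq_zero fun i hi => ?_
      simp only [Finset.mem_Ioc] at hi
      rw [coeffExt, if_neg (by omega), abs_zero]
    rw [this]; positivity
  rcases lt_or_ge r (-2 * (d : ℤ)) with hr | hr
  -- far from the window every coefficient is of the same order
  · have hrabs : |(r : ℝ)| = -r := abs_of_neg (by
      have : r < 0 := by omega
      exact_mod_cast this)
    have hrR : (r : ℝ) < -2 * d := by exact_mod_cast hr
    have hterm : ∀ i ∈ Finset.Ioc 0 d, |coeffExt a (i - r)| ≤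
        K ^ 2 * (Λ d * (d : ℝ) ^ (-α)) * (4 * ρ ^ (-(α - δ))) := by
      intro i hi
      simp only [Finset.mem_Ioc] at hi
      rw [coeffExt, if_pos (by omega)]
      refine (abs_coeff_le hΛ ha hd _).trans ?_
      set z := ((i : ℤ) - r).toNat with hz
      have hzR : (z : ℝ) = i - r := by
        have : (z : ℤ) = i - r := Int.toNat_of_nonneg (by omega)
        exact_mod_cast this
      set x := ((z : ℝ) + 1) / d with hx
      have hir : (0 : ℝ) ≤ i := by positivity
      have hx2 : ρ / 2 ≤ x := by
        rw [hx, hρ, hrabs, hzR, le_div_iff₀ hd0]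
        have : (1 + -(r : ℝ) / d) / 2 * d = (d - r) / 2 := by field_simp; ring
        rw [this]; linarith
      have hx1 : 1 ≤ x := by
        rw [hx, hzR, one_le_div hd0]; linarith
      have h1 : x ^ (-α - δ) ≤ x ^ (-α + δ) := Real.rpow_le_rpow_of_exponent_le hx1 (by linarith)
      have h2 : x ^ (-α + δ) ≤ 2 * ρ ^ (-(α - δ)) := by
        rw [show -α + δ = -(α - δ) by ring]
        calc x ^ (-(α - δ)) ≤ (ρ / 2) ^ (-(α - δ)) :=
              Real.rpow_le_rpow_of_nonpos (by positivity) hx2 (by linarith)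
          _ = 2 ^ (α - δ) * ρ ^ (-(α - δ)) := by
              rw [Real.div_rpow (by positivity) zero_le_two, Real.rpow_neg zero_le_two,
                div_inv_eq_mul, mul_comm]
          _ ≤ 2 ^ (1 : ℝ) * ρ ^ (-(α - δ)) := by
              gcongr
              · norm_num
              · linarith
          _ = _ := by rw [Real.rpow_one]
      gcongr
      linarith
    refine (Finset.sum_le_card_nsmul _ _ _ hterm).trans ?_
    rw [Nat.card_Ioc, nsmul_eq_mul, Nat.sub_zero, hdp]
    have h0 : 0 ≤ K ^ 2 * (4 / (1 - (α + δ)) + 4 / (1 - (α - δ))) * 3 *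
        (Λ d * (d * (d : ℝ) ^ (-α))) * ρ ^ (-(α - δ)) := by positivity
    nlinarith
  -- near the window: a partial sum of the coefficients
  · have hρ3 : ρ ≤ 3 := by
      have : |(r : ℝ)| ≤ 2 * d := by
        rw [abs_le]
        constructor
        · have : -2 * (d : ℝ) ≤ r := by exact_mod_cast hr
          linarith
        · have : (r : ℝ) ≤ d := by exact_mod_cast hrd
          linarith
      have : |(r : ℝ)| / d ≤ 2 := by rw [div_le_iff₀ hd0]; exact this
      linarith
    have hρ4 : 1 ≤ 3 * ρ ^ (-(α - δ)) := by
      have h1 : (3 : ℝ) ^ (-(1 : ℝ)) ≤ ρ ^ (-(α - δ)) :=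
        calc (3 : ℝ) ^ (-(1 : ℝ)) ≤ 3 ^ (-(α - δ)) :=
              Real.rpow_le_rpow_of_exponent_le (by norm_num) (by linarith)
          _ ≤ ρ ^ (-(α - δ)) := Real.rpow_le_rpow_of_nonpos (by linarith) hρ3 (by linarith)
      rw [Real.rpow_neg_one] at h1
      linarith
    have h1 : absWindow a d r ≤ ∑ i ∈ Finset.range (4 * d), |a i| := by
      have h2 : absWindow a d r =
          ∑ i ∈ (Finset.Ioc 0 d).filter (fun i : ℕ => 0 ≤ (i : ℤ) - r), |a ((i : ℤ) - r).toNat| := by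
        rw [Finset.sum_filter]
        refine Finset.sum_congr rfl fun i _ => ?_
        rw [coeffExt]
        split_ifs <;> simp
      rw [h2]
      rw [← Finset.sum_image (g := fun i : ℕ => ((i : ℤ) - r).toNat) (f := fun i => |a i|)]
      · refine Finset.sum_le_sum_of_subset_of_nonneg (fun z hz => ?_) fun _ _ _ => abs_nonneg _
        simp only [Finset.mem_image, Finset.mem_filter, Finset.mem_Ioc] at hz
        obtain ⟨i, ⟨⟨_, _⟩, _⟩, rfl⟩ := hz
        simp only [Finset.mem_range]
        omega
      · intro i hi j hj hij
        simp only [Finset.coe_filter, Finset.mem_Ioc] at hi hj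
        obtain ⟨⟨_, _⟩, _⟩ := hi
        obtain ⟨⟨_, _⟩, _⟩ := hj
        simp only at hij
        omega
    have hsum : ∀ p : ℝ, 0 ≤ p → p < 1 →
        ∑ i ∈ Finset.range (4 * d), (((i : ℝ) + 1) / d) ^ (-p) ≤ 4 / (1 - p) * d := by
      intro p hp0 hp1
      have e : ∀ i : ℕ, (((i : ℝ) + 1) / d) ^ (-p) = (d : ℝ) ^ p * ((i : ℝ) + 1) ^ (-p) := fun i => by
        rw [Real.div_rpow (by positivity) hd0.le, Real.rpow_neg hd0.le, div_inv_eq_mul, mul_comm]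
      simp_rw [e]
      rw [← Finset.mul_sum]
      have hq : 0 < 1 - p := by linarith
      calc (d : ℝ) ^ p * ∑ i ∈ Finset.range (4 * d), ((i : ℝ) + 1) ^ (-p)
          ≤ (d : ℝ) ^ p * (((4 * d : ℕ) : ℝ) ^ (1 - p) / (1 - p)) := by
            gcongr; exact sum_rpow_neg_le hp0 hp1 _
        _ = 4 ^ (1 - p) * ((d : ℝ) ^ p * (d : ℝ) ^ (1 - p)) / (1 - p) := by
            push_cast; rw [Real.mul_rpow (by norm_num) hd0.le]; ring
        _ = 4 ^ (1 - p) * d / (1 - p) := by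
            rw [← Real.rpow_add hd0, add_sub_cancel, Real.rpow_one]
        _ ≤ 4 ^ (1 : ℝ) * d / (1 - p) := by
            gcongr
            · norm_num
            · linarith
        _ = _ := by rw [Real.rpow_one]; ring
    calc absWindow a d r ≤ ∑ i ∈ Finset.range (4 * d), |a i| := h1
      _ ≤ ∑ i ∈ Finset.range (4 * d), K ^ 2 * (Λ d * (d : ℝ) ^ (-α)) *
          ((((i : ℝ) + 1) / d) ^ (-(α + δ)) + (((i : ℝ) + 1) / d) ^ (-(α - δ))) := by
          refine Finset.sum_le_sum fun i _ => ?_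
          have := abs_coeff_le hΛ ha hd i
          rwa [show -α - δ = -(α + δ) by ring, show -α + δ = -(α - δ) by ring] at this
      _ = K ^ 2 * (Λ d * (d : ℝ) ^ (-α)) *
          (∑ i ∈ Finset.range (4 * d), (((i : ℝ) + 1) / d) ^ (-(α + δ)) +
            ∑ i ∈ Finset.range (4 * d), (((i : ℝ) + 1) / d) ^ (-(α - δ))) := by
          rw [← Finset.mul_sum, Finset.sum_add_distrib]
      _ ≤ K ^ 2 * (Λ d * (d : ℝ) ^ (-α)) *
          (4 / (1 - (α + δ)) * d + 4 / (1 - (α - δ)) * d) := by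
          gcongr
          · exact hsum _ (by linarith) (by linarith)
          · exact hsum _ (by linarith) (by linarith)
      _ = K ^ 2 * (4 / (1 - (α + δ)) + 4 / (1 - (α - δ))) * (Λ d * (d : ℝ) ^ (1 - α)) * 1 := by
          rw [hdp]; ring
      _ ≤ K ^ 2 * (4 / (1 - (α + δ)) + 4 / (1 - (α - δ))) * (Λ d * (d : ℝ) ^ (1 - α)) *
          (3 * ρ ^ (-(α - δ))) := by gcongr
      _ ≤ _ := by
          have h0 : 0 ≤ K ^ 2 * 4 * (Λ d * (d : ℝ) ^ (1 - α)) * ρ ^ (-(α - δ)) := by positivity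
          nlinarith

end Coefficients

/-! ### Scaling limit of the window coefficients -/

section ScalingLimit

variable {a : ℕ → ℝ} {h : ℝ → ℝ} {α δ K : ℝ} {Λ : ℕ → ℝ}

theorem PotterRegular.mono (hΛ : PotterRegular δ K Λ) {K' : ℝ} (hK : K ≤ K') :
    PotterRegular δ K' Λ where
  exponent_pos := hΛ.exponent_pos
  one_le := hΛ.one_le.trans hK
  pos := hΛ.pos
  le_mul m n hm hmn := (hΛ.le_mul m n hm hmn).trans (by
    have := hΛ.pos m
    gcongr)
  le_mul' m n hm hmn := (hΛ.le_mul' m n hm hmn).trans (by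
    have := hΛ.pos n
    gcongr)

/-- The constant `K` is taken large enough for the bound to hold at the finitely many initial
coefficients as well, in particular at the arbitrary `a 0`. -/
theorem exists_potterRegular_coeff (hh : SlowlyVarying h) (hα : 0 ≤ α)
    (ha : ∀ n : ℕ, 1 ≤ n → a n = (n : ℝ) ^ (-α) * h n) (hδ : 0 < δ) :
    ∃ K Λ, PotterRegular δ K Λ ∧ (∀ᶠ n : ℕ in atTop, h n = Λ n) ∧
      ∀ i : ℕ, |a i| ≤ K * ((i : ℝ) + 1) ^ (-α) * Λ (i + 1) := by
  obtain ⟨K, Λ, hΛ, hΛh⟩ := hh.exists_potterRegular hδ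
  have hK := hΛ.one_le
  have hev : ∀ᶠ i : ℕ in atTop,
      |a i| / (((i : ℝ) + 1) ^ (-α) * Λ (i + 1)) ≤ 2 ^ α * (K * 2 ^ δ) := by
    filter_upwards [hΛh, eventually_ge_atTop 1] with i hi h1
    have hi0 : (1 : ℝ) ≤ i := by exact_mod_cast h1
    have hpos := hΛ.pos (i + 1)
    rw [div_le_iff₀ (by positivity), ha i h1, hi, abs_of_pos (by have := hΛ.pos i; positivity)]
    have h2 : (i : ℝ) ^ (-α) ≤ 2 ^ α * ((i : ℝ) + 1) ^ (-α) := by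
      calc (i : ℝ) ^ (-α) ≤ (((i : ℝ) + 1) / 2) ^ (-α) :=
            Real.rpow_le_rpow_of_nonpos (by positivity) (by linarith) (by linarith)
        _ = _ := by
            rw [Real.div_rpow (by positivity) zero_le_two, Real.rpow_neg zero_le_two,
              div_inv_eq_mul, mul_comm]
    have h3 : Λ i ≤ K * 2 ^ δ * Λ (i + 1) := by
      refine (hΛ.le_mul' i (i + 1) h1 (Nat.le_succ i)).trans ?_
      gcongr
      rw [div_le_iff₀ (by linarith)]
      push_cast; linarith
    have := hΛ.pos i
    calc (i : ℝ) ^ (-α) * Λ i ≤ (2 ^ α * ((i : ℝ) + 1) ^ (-α)) * (K * 2 ^ δ * Λ (i + 1)) := by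
          gcongr
      _ = _ := by ring
  obtain ⟨N, hN⟩ := eventually_atTop.1 hev
  set M := 2 ^ α * (K * 2 ^ δ) +
    ∑ i ∈ Finset.range N, |a i| / (((i : ℝ) + 1) ^ (-α) * Λ (i + 1)) with hM
  have hterm : ∀ i : ℕ, 0 ≤ |a i| / (((i : ℝ) + 1) ^ (-α) * Λ (i + 1)) := fun i => by
    have := hΛ.pos (i + 1); positivity
  have hMi : ∀ i : ℕ, |a i| / (((i : ℝ) + 1) ^ (-α) * Λ (i + 1)) ≤ M := by
    intro i
    rcases lt_or_ge i N with hi | hi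
    · have := Finset.single_le_sum (fun j _ => hterm j) (Finset.mem_range.2 hi)
      have h0 : 0 ≤ 2 ^ α * (K * 2 ^ δ) := by positivity
      rw [hM]; linarith
    · have := Finset.sum_nonneg (s := Finset.range N) fun j _ => hterm j
      rw [hM]; linarith [hN i hi]
  refine ⟨max K M, Λ, hΛ.mono (le_max_left _ _), hΛh, fun i => ?_⟩
  have hpos := hΛ.pos (i + 1)
  have h1 := (hMi i).trans (le_max_right K M)
  rw [div_le_iff₀ (by positivity)] at h1
  linarith

theorem tendsto_floor_mul_div (x : ℝ) :
    Tendsto (fun n : ℕ => ((⌊(n : ℝ) * x⌋ : ℤ) : ℝ) / n) atTop (𝓝 x) := by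
  have h1 : Tendsto (fun n : ℕ => x - 1 / (n : ℝ)) atTop (𝓝 (x - 0)) :=
    tendsto_const_nhds.sub tendsto_one_div_atTop_nhds_zero_nat
  rw [sub_zero] at h1
  refine tendsto_of_tendsto_of_tendsto_of_le_of_le' h1 tendsto_const_nhds ?_ ?_
  · filter_upwards [eventually_gt_atTop 0] with n hn
    have hn0 : (0 : ℝ) < n := by exact_mod_cast hn
    rw [le_div_iff₀ hn0, sub_mul, one_div, inv_mul_cancel₀ hn0.ne']
    linarith [Int.lt_floor_add_one ((n : ℝ) * x)]
  · filter_upwards [eventually_gt_atTop 0] with n hn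
    have hn0 : (0 : ℝ) < n := by exact_mod_cast hn
    rw [div_le_iff₀ hn0, mul_comm]
    exact Int.floor_le _

theorem tendsto_natFloor_mul_div {x : ℝ} (hx : 0 ≤ x) :
    Tendsto (fun n : ℕ => ((⌊(n : ℝ) * x⌋₊ : ℕ) : ℝ) / n) atTop (𝓝 x) := by
  refine (tendsto_floor_mul_div x).congr fun n => ?_
  rw [natCast_floor_eq_intCast_floor (by positivity)]

theorem tendsto_coeffExt (hh : SlowlyVarying h)
    (ha : ∀ n : ℕ, 1 ≤ n → a n = (n : ℝ) ^ (-α) * h n) (hΛh : ∀ᶠ n : ℕ in atTop, h n = Λ n)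
    {u : ℝ} (hu : 0 < u) :
    Tendsto (fun n : ℕ => coeffExt a ⌊(n : ℝ) * u⌋ / ((n : ℝ) ^ (-α) * Λ n)) atTop
      (𝓝 (u ^ (-α))) := by
  have h1 := tendsto_natFloor_mul_div hu.le
  have h2 : Tendsto (fun n : ℕ => h (⌊(n : ℝ) * u⌋₊ : ℕ) / h n) atTop (𝓝 1) :=
    hh.tendsto_ratio (x := fun n : ℕ => (n : ℝ)) (y := fun n : ℕ => ((⌊(n : ℝ) * u⌋₊ : ℕ) : ℝ))
      tendsto_natCast_atTop_atTop hu h1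
  have h3 := (h1.rpow_const (p := -α) (Or.inl hu.ne')).mul h2
  rw [mul_one] at h3
  refine h3.congr' ?_
  have h4 : ∀ᶠ n : ℕ in atTop, 1 ≤ (n : ℝ) * u :=
    (tendsto_natCast_atTop_atTop.atTop_mul_const hu).eventually_ge_atTop 1
  filter_upwards [h4, hΛh, eventually_gt_atTop 0] with n hn hΛn hn0
  have hn0' : (0 : ℝ) < n := by exact_mod_cast hn0
  have e : ⌊(n : ℝ) * u⌋.toNat = ⌊(n : ℝ) * u⌋₊ := rfl
  have h5 : 1 ≤ ⌊(n : ℝ) * u⌋₊ := Nat.le_floor (by simpa using hn)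
  rw [coeffExt, if_pos (Int.floor_nonneg.2 (by linarith)), e, ha _ h5, hΛn,
    Real.div_rpow (by positivity) hn0'.le]
  field_simp

theorem windowCoeff_eq_tsum (a : ℕ → ℝ) (j k : ℕ) (r : ℤ) :
    windowCoeff a j k r =
      ∑' z : ℤ, if (j : ℤ) < z + r ∧ z + r ≤ k then coeffExt a z else 0 := by
  rw [tsum_eq_sum (s := (Finset.Ioc j k).image fun i : ℕ => (i : ℤ) - r)]
  · rw [Finset.sum_image (by intro i _ i' _ hi; simpa using hi)]
    refine Finset.sum_congr rfl fun i hi => ?_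
    simp only [Finset.mem_Ioc] at hi
    rw [if_pos (by omega)]
  · intro z hz
    rw [if_neg]
    intro hz'
    refine hz (Finset.mem_image.2 ⟨(z + r).toNat, ?_, ?_⟩)
    · simp only [Finset.mem_Ioc]; omega
    · omega

theorem integrable_indicator_rpow {p U : ℝ} (hp : -1 < p) :
    Integrable ((Ioc 0 U).indicator fun u : ℝ => u ^ p) := by
  rw [integrable_indicator_iff measurableSet_Ioc]
  rcases le_total 0 U with hU | hU
  · rw [← intervalIntegrable_iff_integrableOn_Ioc_of_le hU]
    exact intervalIntegral.intervalIntegrable_rpow' hp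
  · rw [Ioc_eq_empty hU.not_gt]; exact integrableOn_empty

/-- The window coefficients are Riemann sums of `u ↦ u ^ (-α)` over the interval from `max (s - x)
0` to `max (t - x) 0`. -/
theorem tendsto_windowCoeff (hh : SlowlyVarying h)
    (ha : ∀ n : ℕ, 1 ≤ n → a n = (n : ℝ) ^ (-α) * h n) (hΛh : ∀ᶠ n : ℕ in atTop, h n = Λ n)
    (hΛ : PotterRegular δ K Λ) (haK : ∀ i : ℕ, |a i| ≤ K * ((i : ℝ) + 1) ^ (-α) * Λ (i + 1))
    (hδα : δ ≤ α) (hα1 : α + δ < 1) {s t : ℝ} (hs : 0 ≤ s) (hst : s ≤ t) (x : ℝ) :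
    Tendsto (fun n : ℕ => windowCoeff a ⌊(n : ℝ) * s⌋₊ ⌊(n : ℝ) * t⌋₊ ⌊(n : ℝ) * x⌋ /
        ((n : ℝ) ^ (1 - α) * Λ n)) atTop
      (𝓝 ((max (t - x) 0 ^ (1 - α) - max (s - x) 0 ^ (1 - α)) / (1 - α))) := by
  have hδ := hΛ.exponent_pos
  -- `f n ⌊n u⌋` is the step function of the Riemann sum and `G` its integrable majorant, where the
  -- lag never exceeds `U`
  set A := max (s - x) 0 with hA
  set B := max (t - x) 0 with hB
  have hAB : A ≤ B := max_le_max (by linarith) le_rfl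
  have hA0 : 0 ≤ A := le_max_right _ _
  set f : ℕ → ℤ → ℝ := fun n z =>
    (if ((⌊(n : ℝ) * s⌋₊ : ℕ) : ℤ) < z + ⌊(n : ℝ) * x⌋ ∧
      z + ⌊(n : ℝ) * x⌋ ≤ ((⌊(n : ℝ) * t⌋₊ : ℕ) : ℤ) then coeffExt a z else 0) /
      ((n : ℝ) ^ (-α) * Λ n) with hf
  set U := t - x + 2 with hU
  set G : ℝ → ℝ := fun u => K ^ 2 * ((Ioc 0 U).indicator (fun u : ℝ => u ^ (-α - δ)) u +
    (Ioc 0 U).indicator (fun u : ℝ => u ^ (-α + δ)) u) with hG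
  set g : ℝ → ℝ := (Ioc A B).indicator fun u : ℝ => u ^ (-α) with hg
  have hGint : Integrable G :=
    ((integrable_indicator_rpow (by linarith)).add
      (integrable_indicator_rpow (by linarith))).const_mul _
  have hdom : ∀ᶠ n : ℕ in atTop, ∀ᵐ u : ℝ, |f n ⌊(n : ℝ) * u⌋| ≤ G u := by
    filter_upwards [eventually_ge_atTop 1] with n hn
    have hn1 : (1 : ℝ) ≤ n := by exact_mod_cast hn
    have hn0 : (0 : ℝ) < n := by linarith
    have hΛn := hΛ.pos n
    filter_upwards [Measure.ae_ne volume (0 : ℝ)] with u hu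
    have hG0 : 0 ≤ G u := by
      have h1 : ∀ p : ℝ, 0 ≤ (Ioc 0 U).indicator (fun u : ℝ => u ^ p) u := fun p =>
        indicator_nonneg (fun u hu => Real.rpow_nonneg hu.1.le p) u
      have := h1 (-α - δ); have := h1 (-α + δ)
      positivity
    simp only [hf]
    split_ifs with hc
    swap
    · rw [zero_div, abs_zero]; exact hG0
    rcases lt_or_gt_of_ne hu with hneg | hpos
    · have : ⌊(n : ℝ) * u⌋ < 0 := Int.floor_lt.2 (by
        push_cast; nlinarith)
      rw [coeffExt, if_neg (by omega), zero_div, abs_zero]; exact hG0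
    · have hz0 : 0 ≤ ⌊(n : ℝ) * u⌋ := Int.floor_nonneg.2 (by positivity)
      have huU : u ≤ U := by
        have h1 : ((⌊(n : ℝ) * u⌋ : ℤ) : ℝ) + ((⌊(n : ℝ) * x⌋ : ℤ) : ℝ) ≤
          ((⌊(n : ℝ) * t⌋₊ : ℕ) : ℝ) := by exact_mod_cast hc.2
        have h2 := Nat.floor_le (show 0 ≤ (n : ℝ) * t by
          have := hs.trans hst; positivity)
        have h3 := Int.lt_floor_add_one ((n : ℝ) * u)
        have h4 := Int.lt_floor_add_one ((n : ℝ) * x)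
        have h5 : (n : ℝ) * u ≤ n * U := by rw [hU]; nlinarith
        exact le_of_mul_le_mul_left h5 hn0
      have hmem : u ∈ Ioc 0 U := ⟨hpos, huU⟩
      rw [coeffExt, if_pos hz0, abs_div, abs_of_pos (show 0 < (n : ℝ) ^ (-α) * Λ n by positivity),
        div_le_iff₀ (by positivity)]
      refine (abs_coeff_le hΛ haK hn _).trans ?_
      simp only [hG, indicator_of_mem hmem]
      have hzu : u ≤ (((⌊(n : ℝ) * u⌋.toNat : ℕ) : ℝ) + 1) / n := by
        rw [le_div_iff₀ hn0]
        have h3 := Int.lt_floor_add_one ((n : ℝ) * u)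
        have h4 : ((⌊(n : ℝ) * u⌋.toNat : ℕ) : ℝ) = ((⌊(n : ℝ) * u⌋ : ℤ) : ℝ) := by
          have := Int.toNat_of_nonneg hz0
          exact_mod_cast this
        rw [h4]; linarith
      have e1 := Real.rpow_le_rpow_of_nonpos hpos hzu (show -α - δ ≤ 0 by linarith)
      have e2 := Real.rpow_le_rpow_of_nonpos hpos hzu (show -α + δ ≤ 0 by linarith)
      calc _ ≤ K ^ 2 * (Λ n * (n : ℝ) ^ (-α)) * (u ^ (-α - δ) + u ^ (-α + δ)) := by gcongr
        _ = _ := by ring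
  -- away from the three boundary points `u` is eventually strictly inside or outside the window
  have hlim : ∀ᵐ u : ℝ, Tendsto (fun n : ℕ => f n ⌊(n : ℝ) * u⌋) atTop (𝓝 (g u)) := by
    filter_upwards [Measure.ae_ne volume (0 : ℝ), Measure.ae_ne volume (s - x),
      Measure.ae_ne volume (t - x)] with u hu0 hus hut
    have hzr : Tendsto (fun n : ℕ => (((⌊(n : ℝ) * u⌋ + ⌊(n : ℝ) * x⌋ : ℤ)) : ℝ) / n) atTop
        (𝓝 (u + x)) := by
      refine ((tendsto_floor_mul_div u).add (tendsto_floor_mul_div x)).congr fun n => ?_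
      push_cast; ring
    have hsn := tendsto_natFloor_mul_div hs
    have htn := tendsto_natFloor_mul_div (hs.trans hst)
    have hzero : ∀ {F : ℕ → ℝ}, (∀ᶠ n in atTop, F n = 0) → Tendsto F atTop (𝓝 0) := fun hF =>
      tendsto_const_nhds.congr' (hF.mono fun _ h => h.symm)
    rcases lt_or_gt_of_ne hu0 with hneg | hpos
    · rw [hg, indicator_of_notMem (fun hm => by linarith [hm.1])]
      refine hzero ?_
      filter_upwards [eventually_ge_atTop 1] with n hn
      have hn1 : (1 : ℝ) ≤ n := by exact_mod_cast hn
      have : ⌊(n : ℝ) * u⌋ < 0 := Int.floor_lt.2 (by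
        push_cast; nlinarith)
      simp only [hf, coeffExt, if_neg this.not_ge, ite_self, zero_div]
    rcases lt_or_gt_of_ne hus with hs1 | hs1
    · have hnm : u ∉ Ioc A B := fun hm => by
        have : s - x ≤ A := le_max_left _ _
        linarith [hm.1]
      rw [hg, indicator_of_notMem hnm]
      refine hzero ?_
      filter_upwards [hzr.eventually_lt hsn (by linarith), eventually_ge_atTop 1] with n hn h1
      have hn0 : (0 : ℝ) < n := by exact_mod_cast h1
      rw [div_lt_div_iff_of_pos_right hn0] at hn
      have : ⌊(n : ℝ) * u⌋ + ⌊(n : ℝ) * x⌋ < ((⌊(n : ℝ) * s⌋₊ : ℕ) : ℤ) := by exact_mod_cast hn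
      simp only [hf]
      rw [if_neg (by omega), zero_div]
    rcases lt_or_gt_of_ne hut with ht1 | ht1
    · have hm : u ∈ Ioc A B := ⟨max_lt hs1 hpos, ht1.le.trans (le_max_left _ _)⟩
      rw [hg, indicator_of_mem hm]
      refine (tendsto_coeffExt hh ha hΛh hpos).congr' ?_
      filter_upwards [hsn.eventually_lt hzr (by linarith), hzr.eventually_lt htn (by linarith),
        eventually_ge_atTop 1] with n hn1 hn2 h1
      have hn0 : (0 : ℝ) < n := by exact_mod_cast h1
      rw [div_lt_div_iff_of_pos_right hn0] at hn1 hn2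
      have e1 : ((⌊(n : ℝ) * s⌋₊ : ℕ) : ℤ) < ⌊(n : ℝ) * u⌋ + ⌊(n : ℝ) * x⌋ := by exact_mod_cast hn1
      have e2 : ⌊(n : ℝ) * u⌋ + ⌊(n : ℝ) * x⌋ < ((⌊(n : ℝ) * t⌋₊ : ℕ) : ℤ) := by exact_mod_cast hn2
      simp only [hf]
      rw [if_pos ⟨e1, e2.le⟩]
    · have hnm : u ∉ Ioc A B := fun hm => by
        have := hm.2
        rw [hB, le_max_iff] at this
        rcases this with h | h <;> linarith
      rw [hg, indicator_of_notMem hnm]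
      refine hzero ?_
      filter_upwards [htn.eventually_lt hzr (by linarith), eventually_ge_atTop 1] with n hn h1
      have hn0 : (0 : ℝ) < n := by exact_mod_cast h1
      rw [div_lt_div_iff_of_pos_right hn0] at hn
      have : ((⌊(n : ℝ) * t⌋₊ : ℕ) : ℤ) < ⌊(n : ℝ) * u⌋ + ⌊(n : ℝ) * x⌋ := by exact_mod_cast hn
      simp only [hf]
      rw [if_neg (by omega), zero_div]
  have key := (tendsto_scaled_tsum hGint hdom hlim).2
  have hgint : ∫ u, g u = (B ^ (1 - α) - A ^ (1 - α)) / (1 - α) := by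
    rw [hg, integral_indicator measurableSet_Ioc, ← intervalIntegral.integral_of_le hAB,
      integral_rpow (Or.inl (by linarith))]
    ring_nf
  rw [hgint] at key
  refine key.congr' ?_
  filter_upwards [eventually_ge_atTop 1] with n hn
  have hn0 : (0 : ℝ) < n := by exact_mod_cast hn
  rw [windowCoeff_eq_tsum]
  simp only [hf]
  rw [tsum_div_const, sub_eq_add_neg (1 : ℝ) α, Real.rpow_add hn0, Real.rpow_one]
  have := (hΛ.pos n).ne'
  have : (n : ℝ) ^ (-α) ≠ 0 := (Real.rpow_pos_of_pos hn0 _).ne'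
  field_simp

/-- The kernel of the moving average representation of fractional Brownian motion. -/
noncomputable def fbmKernel (α s t x : ℝ) : ℝ :=
  (max (t - x) 0 ^ (1 - α) - max (s - x) 0 ^ (1 - α)) / (1 - α)

/-- The rescaled variance of an increment of the truncated process converges to the squared
`L²` norm of the kernel; `V n r` stands for the variance of the `r`-th truncated innovation. -/
theorem tendsto_sum_sq_windowCoeff (hh : SlowlyVarying h)
    (ha : ∀ n : ℕ, 1 ≤ n → a n = (n : ℝ) ^ (-α) * h n) (hΛh : ∀ᶠ n : ℕ in atTop, h n = Λ n)
    (hΛ : PotterRegular δ K Λ) (haK : ∀ i : ℕ, |a i| ≤ K * ((i : ℝ) + 1) ^ (-α) * Λ (i + 1))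
    (hα1 : α + δ < 1) (hp : 1 < 2 * α - 3 * δ) {s t : ℝ} (hs : 0 ≤ s) (hst : s ≤ t) (ht : t ≤ 1)
    {v : ℕ → ℝ} (hv : ∀ n, 1 ≤ n → 0 < v n) {V : ℕ → ℤ → ℝ} {C : ℝ} (hV0 : ∀ n r, 0 ≤ V n r)
    (hV : ∀ n : ℕ, 1 ≤ n → ∀ r : ℤ, V n r ≤ C * (1 + |(r : ℝ)| / n) ^ δ * v n)
    (hVlim : ∀ x : ℝ, Tendsto (fun n : ℕ => V n ⌊(n : ℝ) * x⌋ / v n) atTop (𝓝 1)) :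
    (∀ᶠ n : ℕ in atTop, Summable fun r : ℤ =>
      windowCoeff a ⌊(n : ℝ) * s⌋₊ ⌊(n : ℝ) * t⌋₊ r ^ 2 * V n r) ∧
    Tendsto (fun n : ℕ => (∑' r : ℤ, windowCoeff a ⌊(n : ℝ) * s⌋₊ ⌊(n : ℝ) * t⌋₊ r ^ 2 * V n r) /
        (v n * (n : ℝ) ^ (3 - 2 * α) * Λ n ^ 2)) atTop (𝓝 (∫ x, fbmKernel α s t x ^ 2)) ∧
    Integrable fun x => fbmKernel α s t x ^ 2 := by
  have hδ := hΛ.exponent_pos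
  obtain ⟨D, hD, hDle⟩ := exists_absWindow_le hΛ haK (by linarith) hα1
  set f : ℕ → ℤ → ℝ := fun n r =>
    windowCoeff a ⌊(n : ℝ) * s⌋₊ ⌊(n : ℝ) * t⌋₊ r ^ 2 * V n r /
      (v n * (n : ℝ) ^ (2 - 2 * α) * Λ n ^ 2) with hf
  have hC : 0 ≤ C := by
    have h1 := (hV0 1 0).trans (hV 1 le_rfl 0)
    have := hv 1 le_rfl
    simp only [Int.cast_zero, abs_zero, zero_div, add_zero, Real.one_rpow, mul_one] at h1
    exact nonneg_of_mul_nonneg_left h1 this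
  -- the weights decay with exponent `α - δ` and `V` grows with exponent `δ`, which leaves the
  -- integrable exponent `2α - 3δ`
  have hdom : ∀ᶠ n : ℕ in atTop, ∀ x : ℝ, |f n ⌊(n : ℝ) * x⌋| ≤
      D ^ 2 * C * (2 ^ (2 * α - 3 * δ) * (1 + ‖x‖) ^ (-(2 * α - 3 * δ))) := by
    filter_upwards [eventually_ge_atTop 1] with n hn x
    have hn1 : (1 : ℝ) ≤ n := by exact_mod_cast hn
    have hn0 : (0 : ℝ) < n := by linarith
    have hvn := hv n hn
    have hΛn := hΛ.pos n
    set r := ⌊(n : ℝ) * x⌋ with hr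
    have hk : ⌊(n : ℝ) * t⌋₊ ≤ n := Nat.floor_le_of_le (by nlinarith)
    have h1 := (abs_windowCoeff_le_absWindow a (j := ⌊(n : ℝ) * s⌋₊) hk r).trans (hDle n hn r)
    have h2 := hV n hn r
    set ρ := 1 + |(r : ℝ)| / n with hρ
    have hρ0 : 0 < ρ := by positivity
    have hV0' := hV0 n r
    have e1 : ρ ^ (-(2 * α - 3 * δ)) = (ρ ^ (-(α - δ))) ^ 2 * ρ ^ δ := by
      rw [← Real.rpow_natCast (ρ ^ (-(α - δ))) 2, ← Real.rpow_mul hρ0.le, ← Real.rpow_add hρ0]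
      congr 1; push_cast; ring
    have e2 : (n : ℝ) ^ (2 - 2 * α) = ((n : ℝ) ^ (1 - α)) ^ 2 := by
      rw [← Real.rpow_natCast, ← Real.rpow_mul hn0.le]
      congr 1; push_cast; ring
    have h3 : f n r ≤ D ^ 2 * C * ρ ^ (-(2 * α - 3 * δ)) := by
      simp only [hf]
      rw [div_le_iff₀ (by positivity), ← sq_abs, e1, e2]
      calc |windowCoeff a ⌊(n : ℝ) * s⌋₊ ⌊(n : ℝ) * t⌋₊ r| ^ 2 * V n r
          ≤ (D * (Λ n * (n : ℝ) ^ (1 - α)) * ρ ^ (-(α - δ))) ^ 2 * (C * ρ ^ δ * v n) := by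
            gcongr
        _ = _ := by ring
    have h4 : 0 ≤ f n r := by simp only [hf]; positivity
    rw [abs_of_nonneg h4]
    refine h3.trans ?_
    gcongr
    exact decay_floor_le hn (by linarith) x
  have hlim : ∀ x : ℝ, Tendsto (fun n : ℕ => f n ⌊(n : ℝ) * x⌋) atTop
      (𝓝 (fbmKernel α s t x ^ 2)) := by
    intro x
    have h1 := ((tendsto_windowCoeff hh ha hΛh hΛ haK (by linarith) hα1 hs hst x).pow 2).mul
      (hVlim x)
    rw [mul_one] at h1
    refine h1.congr' ?_
    filter_upwards [eventually_ge_atTop 1] with n hn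
    have hn0 : (0 : ℝ) < n := by exact_mod_cast hn
    have e2 : (n : ℝ) ^ (2 - 2 * α) = ((n : ℝ) ^ (1 - α)) ^ 2 := by
      rw [← Real.rpow_natCast, ← Real.rpow_mul hn0.le]
      congr 1; push_cast; ring
    simp only [hf, e2]
    have := (hv n hn).ne'
    have := (hΛ.pos n).ne'
    field_simp
  have hGint := (integrable_decay hp).const_mul (D ^ 2 * C)
  have hint : Integrable fun x => fbmKernel α s t x ^ 2 := by
    refine hGint.mono' ?_ (Eventually.of_forall fun x => ?_)
    · unfold fbmKernel; fun_prop
    · rw [Real.norm_eq_abs]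
      exact le_of_tendsto (hlim x).abs (hdom.mono fun n hn => hn x)
  obtain ⟨hs1, hs2⟩ := tendsto_scaled_tsum hGint
    (hdom.mono fun n hn => Eventually.of_forall hn) (Eventually.of_forall hlim)
  refine ⟨?_, ?_, hint⟩
  · filter_upwards [hs1, eventually_ge_atTop 1] with n hn h1
    have hn0 : (0 : ℝ) < n := by exact_mod_cast h1
    have hne : v n * (n : ℝ) ^ (2 - 2 * α) * Λ n ^ 2 ≠ 0 := by
      have := hv n h1
      have := hΛ.pos n
      positivity
    refine (hn.mul_right (v n * (n : ℝ) ^ (2 - 2 * α) * Λ n ^ 2)).congr fun r => ?_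
    simp only [hf]
    exact div_mul_cancel₀ _ hne
  · refine hs2.congr' ?_
    filter_upwards [eventually_ge_atTop 1] with n h1
    have hn0 : (0 : ℝ) < n := by exact_mod_cast h1
    simp only [hf]
    rw [tsum_div_const, show (3 : ℝ) - 2 * α = 1 + (2 - 2 * α) by ring, Real.rpow_add hn0,
      Real.rpow_one, one_div_mul_eq_div, div_div]
    congr 1
    ring

/-- The substitution `x = t - (t - s) y` reduces the norm of the kernel to `cAlpha`. -/
theorem integral_sq_fbmKernel (hα1 : α < 1) {s t : ℝ} (hst : s ≤ t) :
    ∫ x, fbmKernel α s t x ^ 2 = (t - s) ^ (3 - 2 * α) * cAlpha α := by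
  have hq : 0 < 1 - α := by linarith
  rcases hst.eq_or_lt with rfl | hlt
  · simp [fbmKernel, Real.zero_rpow (show 3 - 2 * α ≠ 0 by linarith)]
  set d := t - s with hd
  have hd0 : 0 < d := by rw [hd]; linarith
  have hscale : ∀ y : ℝ, fbmKernel α s t (t - d * y) ^ 2 =
      d ^ (2 - 2 * α) * ((max y 0 ^ (1 - α) - max (y - 1) 0 ^ (1 - α)) ^ 2 / (1 - α) ^ 2) := by
    intro y
    have e1 : max (t - (t - d * y)) 0 = d * max y 0 := by
      rw [mul_max_of_nonneg _ _ hd0.le]; congr 1 <;> ring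
    have e2 : max (s - (t - d * y)) 0 = d * max (y - 1) 0 := by
      rw [mul_max_of_nonneg _ _ hd0.le]; congr 1 <;> rw [hd] <;> ring
    rw [fbmKernel, e1, e2, Real.mul_rpow hd0.le (le_max_right _ _),
      Real.mul_rpow hd0.le (le_max_right _ _), ← mul_sub, div_pow, mul_pow,
      ← Real.rpow_natCast (d ^ (1 - α)), ← Real.rpow_mul hd0.le]
    have : (1 - α) * ((2 : ℕ) : ℝ) = 2 - 2 * α := by push_cast; ring
    rw [this]; ring
  have h1 : ∫ y, fbmKernel α s t (t - d * y) ^ 2 = d⁻¹ * ∫ x, fbmKernel α s t x ^ 2 := by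
    have := Measure.integral_comp_mul_left (fun x => fbmKernel α s t (t - x) ^ 2) d
    rw [this, integral_sub_left_eq_self (fun x => fbmKernel α s t x ^ 2) volume t,
      abs_of_pos (inv_pos.2 hd0), smul_eq_mul]
  have h2 : ∫ y, fbmKernel α s t (t - d * y) ^ 2 = d ^ (2 - 2 * α) * cAlpha α := by
    simp_rw [hscale]
    rw [integral_const_mul, integral_div, cAlpha]
    congr 2
    rw [← integral_indicator measurableSet_Ioi]
    refine integral_congr_ae (Eventually.of_forall fun y => ?_)
    -- the integrand vanishes for negative `y`
    by_cases hy : 0 < y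
    · rw [indicator_of_mem (mem_Ioi.2 hy)]
      simp only [max_eq_left hy.le]
    · rw [indicator_of_notMem (by simpa using hy)]
      push Not at hy
      simp only [max_eq_right hy, max_eq_right (show y - 1 ≤ 0 by linarith)]
      simp
  rw [h2] at h1
  have h3 : ∫ x, fbmKernel α s t x ^ 2 = d * (d ^ (2 - 2 * α) * cAlpha α) := by
    rw [h1, mul_inv_cancel_left₀ hd0.ne']
  rw [h3, show (3 : ℝ) - 2 * α = 1 + (2 - 2 * α) by ring, Real.rpow_add hd0, Real.rpow_one]
  ring

theorem cAlpha_pos (hα1 : α < 1) (hint : Integrable fun x => fbmKernel α 0 1 x ^ 2) :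
    0 < cAlpha α := by
  have hq : 0 < 1 - α := by linarith
  have h1 := integral_sq_fbmKernel hα1 (zero_le_one' ℝ)
  rw [sub_zero, Real.one_rpow, one_mul] at h1
  rw [← h1, integral_pos_iff_support_of_nonneg (fun x => sq_nonneg _) hint]
  have hsub : Ioo (0 : ℝ) 1 ⊆ Function.support fun x => fbmKernel α 0 1 x ^ 2 := by
    intro x hx
    have e1 : max (1 - x) 0 = 1 - x := max_eq_left (by linarith [hx.2])
    have e2 : max (0 - x) 0 = 0 := max_eq_right (by linarith [hx.1])
    have : 0 < (1 - x) ^ (1 - α) := Real.rpow_pos_of_pos (by linarith [hx.2]) _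
    rw [Function.mem_support, fbmKernel, e1, e2, Real.zero_rpow hq.ne', sub_zero]
    positivity
  refine lt_of_lt_of_le ?_ (measure_mono hsub)
  simp

end ScalingLimit

/-! ### Tightness and convergence in `C[0,1]` -/

/-- `C[0,1]` carries its Borel `σ`-algebra. -/
instance : MeasurableSpace C(unitInterval, ℝ) := borel _

instance : BorelSpace C(unitInterval, ℝ) := ⟨rfl⟩

theorem floor_two_mul (y : ℝ) (hy : 0 ≤ y) :
    ⌊2 * y⌋₊ = 2 * ⌊y⌋₊ ∨ ⌊2 * y⌋₊ = 2 * ⌊y⌋₊ + 1 := by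
  have h1 := Nat.floor_le hy
  have h2 := Nat.lt_floor_add_one y
  have h3 := Nat.floor_le (show 0 ≤ 2 * y by linarith)
  have h4 := Nat.lt_floor_add_one (2 * y)
  have h5 : (⌊2 * y⌋₊ : ℝ) < ((2 * ⌊y⌋₊ + 2 : ℕ) : ℝ) := by push_cast; linarith
  have h6 : ((2 * ⌊y⌋₊ : ℕ) : ℝ) < ((⌊2 * y⌋₊ + 1 : ℕ) : ℝ) := by push_cast; linarith
  have h7 : ⌊2 * y⌋₊ < 2 * ⌊y⌋₊ + 2 := by exact_mod_cast h5
  have h8 : 2 * ⌊y⌋₊ < ⌊2 * y⌋₊ + 1 := by exact_mod_cast h6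
  omega

/-- Chaining along the dyadic numbers: bounds on the increments between neighbouring dyadic points
control the modulus of continuity of a continuous function. -/
theorem modulus_of_dyadic {W : ℝ → ℝ} (hW : Continuous W) {M r : ℝ} (hM : 0 ≤ M) (hr : 0 < r)
    (hr1 : r < 1) (H : ∀ m k : ℕ, |W (((k : ℝ) + 1) / 2 ^ m) - W ((k : ℝ) / 2 ^ m)| ≤ M * r ^ m)
    (m : ℕ) {x y : ℝ} (hx : 0 ≤ x) (hxy : x ≤ y) (hm : y - x ≤ 1 / 2 ^ m) :
    |W y - W x| ≤ (1 + 2 / (1 - r)) * M * r ^ m := by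
  have hfl : ∀ {z : ℝ}, 0 ≤ z → Tendsto (fun m : ℕ => (⌊2 ^ m * z⌋₊ : ℝ) / 2 ^ m) atTop (𝓝 z) := by
    intro z hz
    have := (tendsto_natFloor_mul_div hz).comp
      (tendsto_pow_atTop_atTop_of_one_lt (by norm_num : 1 < 2))
    refine this.congr fun m => ?_
    simp
  have hstep : ∀ {z : ℝ}, 0 ≤ z → ∀ m : ℕ,
      dist (W ((⌊2 ^ m * z⌋₊ : ℝ) / 2 ^ m)) (W ((⌊2 ^ (m + 1) * z⌋₊ : ℝ) / 2 ^ (m + 1))) ≤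
        M * r ^ m := by
    intro z hz m
    have e : (2 : ℝ) ^ (m + 1) * z = 2 * (2 ^ m * z) := by ring
    rcases floor_two_mul (2 ^ m * z) (by positivity) with h | h
    · have e2 : (⌊(2 : ℝ) ^ (m + 1) * z⌋₊ : ℝ) / 2 ^ (m + 1) = (⌊2 ^ m * z⌋₊ : ℝ) / 2 ^ m := by
        rw [e, h]; push_cast; rw [pow_succ]; field_simp
      rw [e2, dist_self]; positivity
    · have h1 := H (m + 1) (2 * ⌊2 ^ m * z⌋₊)
      have e2 : ((2 * ⌊(2 : ℝ) ^ m * z⌋₊ : ℕ) : ℝ) / 2 ^ (m + 1) = (⌊2 ^ m * z⌋₊ : ℝ) / 2 ^ m := by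
        push_cast; rw [pow_succ]; field_simp
      rw [e2] at h1
      have e3 : (⌊(2 : ℝ) ^ (m + 1) * z⌋₊ : ℝ) = ((2 * ⌊(2 : ℝ) ^ m * z⌋₊ : ℕ) : ℝ) + 1 := by
        rw [e, h]; push_cast; ring
      rw [e3, dist_comm, Real.dist_eq]
      refine h1.trans ?_
      gcongr M * ?_
      exact pow_le_pow_of_le_one hr.le hr1.le (Nat.le_succ m)
  -- the dyadic approximations of a point from below form a sequence with geometric steps
  have happrox : ∀ {z : ℝ}, 0 ≤ z →
      dist (W ((⌊2 ^ m * z⌋₊ : ℝ) / 2 ^ m)) (W z) ≤ M * r ^ m / (1 - r) := fun hz =>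
    dist_le_of_le_geometric_of_tendsto r M hr1 (hstep hz) ((hW.tendsto _).comp (hfl hz)) m
  have hx' := happrox hx
  have hy' := happrox (hx.trans hxy)
  -- at level `m` the approximations of `x` and `y` are equal or neighbours
  have hmid : |W ((⌊2 ^ m * y⌋₊ : ℝ) / 2 ^ m) - W ((⌊2 ^ m * x⌋₊ : ℝ) / 2 ^ m)| ≤ M * r ^ m := by
    have h2 : (0 : ℝ) < 2 ^ m := by positivity
    have h3 : (2 : ℝ) ^ m * y ≤ 2 ^ m * x + 1 := by
      rw [le_div_iff₀ h2] at hm; nlinarith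
    have h4 : ⌊2 ^ m * x⌋₊ ≤ ⌊2 ^ m * y⌋₊ := Nat.floor_mono (by gcongr)
    have h5 : ⌊2 ^ m * y⌋₊ ≤ ⌊2 ^ m * x⌋₊ + 1 := by
      rw [← Nat.floor_add_one (by positivity)]
      exact Nat.floor_mono h3
    rcases Nat.eq_or_lt_of_le h4 with h | h
    · rw [← h, sub_self, abs_zero]; positivity
    · have h6 : ⌊2 ^ m * y⌋₊ = ⌊2 ^ m * x⌋₊ + 1 := by omega
      rw [h6]
      push_cast
      exact H m _
  rw [Real.dist_eq] at hx' hy'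
  have e : (1 + 2 / (1 - r)) * M * r ^ m =
      M * r ^ m / (1 - r) + M * r ^ m + M * r ^ m / (1 - r) := by ring
  rw [e]
  rw [abs_le] at *
  constructor <;> linarith [hx'.1, hx'.2, hy'.1, hy'.2, hmid.1, hmid.2]

/-- The paths that start at `0` and have modulus of continuity `C rᵐ` at distance `2⁻ᵐ`. -/
def modulusSet (C r : ℝ) : Set C(unitInterval, ℝ) :=
  {w | w 0 = 0 ∧ ∀ (m : ℕ) (x y : unitInterval), |(x : ℝ) - y| ≤ 1 / 2 ^ m →
    |w x - w y| ≤ C * r ^ m}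

/-- The Arzelà–Ascoli theorem, transported from the bounded continuous functions. -/
theorem isCompact_modulusSet {C r : ℝ} (hr : 0 ≤ r) (hr1 : r < 1) :
    IsCompact (modulusSet C r) := by
  set A : Set (BoundedContinuousFunction unitInterval ℝ) :=
    {w | w 0 = 0 ∧ ∀ (m : ℕ) (x y : unitInterval), |(x : ℝ) - y| ≤ 1 / 2 ^ m →
      |w x - w y| ≤ C * r ^ m} with hA
  have hcl : IsClosed A := by
    have he : ∀ x : unitInterval, Continuous fun w : BoundedContinuousFunction unitInterval ℝ =>
      w x := fun x => continuous_eval_const x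
    have : A = {w | w 0 = 0} ∩ ⋂ (m : ℕ) (x : unitInterval) (y : unitInterval)
        (_ : |(x : ℝ) - y| ≤ 1 / 2 ^ m), {w | |w x - w y| ≤ C * r ^ m} := by
      ext w; simp only [hA, mem_inter_iff, mem_iInter, mem_ofPred_eq]
    rw [this]
    refine (isClosed_eq (he 0) continuous_const).inter ?_
    refine isClosed_iInter fun m => isClosed_iInter fun x => isClosed_iInter fun y =>
      isClosed_iInter fun _ => isClosed_le ((he x).sub (he y)).abs continuous_const
  have hcomp : IsCompact A := by
    refine BoundedContinuousFunction.arzela_ascoli₂ (Icc (-C) C) isCompact_Icc A hcl ?_ ?_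
    · intro f x hf
      have h1 := hf.2 0 x 0 (by
        rw [pow_zero, div_one, abs_le]
        constructor
        · simp; linarith [x.2.1]
        · simp; exact x.2.2)
      rw [hf.1, sub_zero, pow_zero, mul_one, abs_le] at h1
      exact h1
    · refine UniformEquicontinuous.equicontinuous (Metric.uniformEquicontinuous_iff.2 ?_)
      intro ε hε
      have ht : Tendsto (fun m : ℕ => C * r ^ m) atTop (𝓝 (C * 0)) :=
        (tendsto_pow_atTop_nhds_zero_of_lt_one hr hr1).const_mul C
      rw [mul_zero] at ht
      obtain ⟨m, hm⟩ := (ht.eventually (gt_mem_nhds hε)).exists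
      refine ⟨1 / 2 ^ m, by positivity, fun x y hxy f => ?_⟩
      rw [Real.dist_eq]
      exact (f.2.2 m x y (by rw [Subtype.dist_eq, Real.dist_eq] at hxy; exact hxy.le)).trans_lt hm
  have himg : modulusSet C r = (ContinuousMap.equivBoundedOfCompact unitInterval ℝ).symm '' A := by
    ext w
    constructor
    · intro hw
      exact ⟨ContinuousMap.equivBoundedOfCompact unitInterval ℝ w, hw, rfl⟩
    · rintro ⟨f, hf, rfl⟩
      exact hf
  rw [himg]
  exact hcomp.image (ContinuousMap.isometryEquivBoundedOfCompact unitInterval ℝ).symm.continuous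

/-- Kolmogorov's tightness criterion with second moments. -/
theorem isTightMeasureSet_of_second_moment {S : Set (Measure C(unitInterval, ℝ))} {C q : ℝ}
    (hC : 0 ≤ C) (hq : 1 < q) (h0 : ∀ μ ∈ S, ∀ᵐ w ∂μ, w 0 = 0)
    (hS : ∀ μ ∈ S, ∀ x y : unitInterval,
      ∫⁻ w, ENNReal.ofReal ((w y - w x) ^ 2) ∂μ ≤ ENNReal.ofReal (C * |(y : ℝ) - x| ^ q)) :
    IsTightMeasureSet S := by
  set κ := q - 1 with hκ
  have hκ0 : 0 < κ := by rw [hκ]; linarith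
  -- the chaining ratio is chosen so that `2 ^ m · (2 ^ (-m)) ^ q / r ^ (2 m)` is summable
  set r : ℝ := 2 ^ (-(κ / 4)) with hr
  have hr0 : 0 < r := by positivity
  have hr1 : r < 1 := Real.rpow_lt_one_of_one_lt_of_neg (by norm_num) (by linarith)
  set θ : ℝ := 2 ^ (-(κ / 2)) with hθ
  have hθ0 : 0 < θ := by positivity
  have hθ1 : θ < 1 := Real.rpow_lt_one_of_one_lt_of_neg (by norm_num) (by linarith)
  have hkey : ∀ m : ℕ, (2 : ℝ) ^ m * (1 / 2 ^ m) ^ q / (r ^ m) ^ 2 = θ ^ m := by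
    intro m
    have e1 : (2 : ℝ) ^ m = 2 ^ (m : ℝ) := (Real.rpow_natCast _ _).symm
    have e2 : ((1 : ℝ) / 2 ^ m) ^ q = 2 ^ (-(m * q)) := by
      rw [one_div, Real.inv_rpow (by positivity), e1, ← Real.rpow_mul zero_le_two,
        Real.rpow_neg zero_le_two]
    have e3 : (r ^ m) ^ 2 = 2 ^ (-(m * (κ / 2))) := by
      rw [hr, ← pow_mul, ← Real.rpow_natCast, ← Real.rpow_mul zero_le_two]
      congr 1; push_cast; ring
    have e4 : θ ^ m = 2 ^ (-(m * (κ / 2))) := by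
      rw [hθ, ← Real.rpow_natCast, ← Real.rpow_mul zero_le_two]
      congr 1; ring
    rw [e2, e3, e4, e1, ← Real.rpow_add two_pos, ← Real.rpow_sub two_pos]
    congr 1
    rw [hκ]; ring
  rw [isTightMeasureSet_iff_exists_isCompact_measure_compl_le]
  intro ε hε
  -- a level `M` at which the union bound is below `ε`
  obtain ⟨M, hM0, hM⟩ : ∃ M : ℝ, 0 < M ∧ ENNReal.ofReal (C / M ^ 2 * (1 - θ)⁻¹) ≤ ε := by
    have ht : Tendsto (fun M : ℝ => ENNReal.ofReal (C / M ^ 2 * (1 - θ)⁻¹)) atTop (𝓝 0) := by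
      rw [← ENNReal.ofReal_zero]
      refine ENNReal.tendsto_ofReal ?_
      have := ((tendsto_pow_atTop (α := ℝ) two_ne_zero).const_div_atTop C).mul_const (1 - θ)⁻¹
      rwa [zero_mul] at this
    obtain ⟨M, hM, hM'⟩ := ((ht.eventually_lt_const hε).and (eventually_gt_atTop 0)).exists
    exact ⟨M, hM', hM.le⟩
  refine ⟨modulusSet ((1 + 2 / (1 - r)) * M) r, isCompact_modulusSet hr0.le hr1, fun μ hμ => ?_⟩
  -- the dyadic points, with those beyond `1` moved to `1`, and the paths with a large increment
  -- between neighbours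
  set D : ℕ → ℕ → unitInterval := fun m k => projIcc 0 1 zero_le_one ((k : ℝ) / 2 ^ m) with hD
  set bad : ℕ → ℕ → Set C(unitInterval, ℝ) := fun m k =>
    {w | M * r ^ m < |w (D m (k + 1)) - w (D m k)|} with hbad
  have hDdist : ∀ m k, |((D m (k + 1) : unitInterval) : ℝ) - D m k| ≤ 1 / 2 ^ m := by
    intro m k
    have h1 := (abs_le.1 (abs_projIcc_sub_projIcc (h := zero_le_one' ℝ)
      (c := ((k + 1 : ℕ) : ℝ) / 2 ^ m) (d := (k : ℝ) / 2 ^ m)))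
    have e : ((k + 1 : ℕ) : ℝ) / 2 ^ m - (k : ℝ) / 2 ^ m = 1 / 2 ^ m := by push_cast; ring
    rw [e, abs_of_pos (by positivity)] at h1
    exact abs_le.2 h1
  -- Chebyshev's inequality
  have hbadle : ∀ m k, μ (bad m k) ≤ ENNReal.ofReal (C / M ^ 2 * ((1 / 2 ^ m) ^ q / (r ^ m) ^ 2)) := by
    intro m k
    have hpos : 0 < (M * r ^ m) ^ 2 := by positivity
    have h1 : ENNReal.ofReal ((M * r ^ m) ^ 2) * μ (bad m k) ≤
        ENNReal.ofReal (C * (1 / 2 ^ m) ^ q) := by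
      have hmeas : Measurable fun w : C(unitInterval, ℝ) =>
          ENNReal.ofReal ((w (D m (k + 1)) - w (D m k)) ^ 2) := by
        refine ENNReal.measurable_ofReal.comp (Continuous.measurable ?_)
        exact ((continuous_eval_const _).sub
          (continuous_eval_const _)).pow 2
      refine le_trans ?_ ((hS μ hμ (D m k) (D m (k + 1))).trans (ENNReal.ofReal_le_ofReal ?_))
      · refine le_trans ?_ (mul_meas_ge_le_lintegral hmeas (ENNReal.ofReal ((M * r ^ m) ^ 2)))
        gcongr
        intro w hw
        have hw : M * r ^ m < |w (D m (k + 1)) - w (D m k)| := hw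
        refine ENNReal.ofReal_le_ofReal ?_
        rw [← sq_abs (w (D m (k + 1)) - w (D m k))]
        gcongr
      · have := hDdist m k
        gcongr
    have h2 : μ (bad m k) ≤ ENNReal.ofReal (C * (1 / 2 ^ m) ^ q) /
        ENNReal.ofReal ((M * r ^ m) ^ 2) := by
      rw [ENNReal.le_div_iff_mul_le (Or.inl (by simpa using hpos.not_ge)) (Or.inl (by simp)),
        mul_comm]
      exact h1
    rw [← ENNReal.ofReal_div_of_pos hpos] at h2
    refine h2.trans (le_of_eq ?_)
    congr 1
    rw [mul_pow]; field_simp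
  have hsub : (modulusSet ((1 + 2 / (1 - r)) * M) r)ᶜ ⊆
      {w : C(unitInterval, ℝ) | ¬ w 0 = 0} ∪ ⋃ m : ℕ, ⋃ k ∈ Finset.range (2 ^ m), bad m k := by
    intro w hw
    by_contra hcon
    simp only [mem_union, mem_iUnion, not_or, not_exists, mem_ofPred_eq, not_not] at hcon
    obtain ⟨hw0, hgood⟩ := hcon
    refine hw ⟨hw0, fun m x y hxy => ?_⟩
    have hW : Continuous (fun z : ℝ => w (projIcc 0 1 zero_le_one z)) :=
      w.continuous.comp continuous_projIcc
    have H : ∀ m k : ℕ, |w (projIcc 0 1 zero_le_one (((k : ℝ) + 1) / 2 ^ m)) -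
        w (projIcc 0 1 zero_le_one ((k : ℝ) / 2 ^ m))| ≤ M * r ^ m := by
      intro m k
      have h2 : (0 : ℝ) < 2 ^ m := by positivity
      rcases lt_or_ge k (2 ^ m) with hk | hk
      · have := hgood m k (Finset.mem_range.2 hk)
        simp only [hbad, hD, mem_ofPred_eq, not_lt] at this
        push_cast at this
        exact this
      · have hk' : (2 : ℝ) ^ m ≤ k := by exact_mod_cast hk
        rw [projIcc_of_right_le _ ((one_le_div h2).2 (by linarith)),
          projIcc_of_right_le _ ((one_le_div h2).2 hk'), sub_self, abs_zero]
        positivity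
    wlog hle : (y : ℝ) ≤ x generalizing x y
    · rw [abs_sub_comm]
      exact this y x (by rwa [abs_sub_comm]) (le_of_not_ge hle)
    have := modulus_of_dyadic hW hM0.le hr0 hr1 H m y.2.1 hle (by
      rwa [abs_of_nonneg (by linarith)] at hxy)
    simpa only [projIcc_val] using this
  refine (measure_mono hsub).trans ((measure_union_le _ _).trans ?_)
  have hz : μ {w : C(unitInterval, ℝ) | ¬ w 0 = 0} = 0 := h0 μ hμ
  rw [hz, zero_add]
  refine (measure_iUnion_le _).trans ?_
  have hterm : ∀ m : ℕ, μ (⋃ k ∈ Finset.range (2 ^ m), bad m k) ≤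
      ENNReal.ofReal (C / M ^ 2 * θ ^ m) := by
    intro m
    refine (measure_biUnion_finset_le _ _).trans ?_
    refine (Finset.sum_le_sum fun k _ => hbadle m k).trans ?_
    rw [Finset.sum_const, Finset.card_range, nsmul_eq_mul, ← hkey m]
    rw [show C / M ^ 2 * ((2 : ℝ) ^ m * (1 / 2 ^ m) ^ q / (r ^ m) ^ 2) =
      ((2 ^ m : ℕ) : ℝ) * (C / M ^ 2 * ((1 / 2 ^ m) ^ q / (r ^ m) ^ 2)) by push_cast; ring,
      ENNReal.ofReal_mul (p := ((2 ^ m : ℕ) : ℝ)) (by positivity), ENNReal.ofReal_natCast]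
  refine (ENNReal.tsum_le_tsum hterm).trans (le_trans (le_of_eq ?_) hM)
  rw [← ENNReal.ofReal_tsum_of_nonneg (fun m => by positivity)
    ((summable_geometric_of_lt_one hθ0.le hθ1).mul_left _), tsum_mul_left,
    tsum_geometric_of_lt_one hθ0.le hθ1]

/-- The pairing of `C[0,1]` with the finitely supported functions on `[0,1]`, that is, with the
finite linear combinations of evaluations. -/
noncomputable def evalPairing : C(unitInterval, ℝ) →ₗ[ℝ] (unitInterval →₀ ℝ) →ₗ[ℝ] ℝ :=
  LinearMap.mk₂ ℝ (fun w u => Finsupp.linearCombination ℝ (fun t => w t) u)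
    (fun w w' u => by simp [Finsupp.linearCombination_apply, Finsupp.sum, mul_add,
      Finset.sum_add_distrib])
    (fun c w u => by simp [Finsupp.linearCombination_apply, Finsupp.sum, Finset.mul_sum,
      mul_left_comm])
    (fun w u u' => map_add _ _ _)
    (fun c w u => map_smul _ _ _)

theorem evalPairing_apply (w : C(unitInterval, ℝ)) (u : unitInterval →₀ ℝ) :
    evalPairing w u = u.sum fun t c => c * w t := by
  simp [evalPairing, Finsupp.linearCombination_apply]

theorem continuous_evalPairing_left (u : unitInterval →₀ ℝ) :
    Continuous fun w : C(unitInterval, ℝ) => evalPairing w u := by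
  simp only [evalPairing_apply, Finsupp.sum]
  exact continuous_finsetSum _ fun t _ =>
    continuous_const.mul (continuous_eval_const t)

/-- A tight sequence of laws on `C[0,1]` with converging finite-dimensional characteristic functions
converges weakly: Prokhorov's theorem provides a cluster point, and the trigonometric polynomials in
the evaluations form an algebra that separates points. -/
theorem exists_tendsto_of_tight_of_charFun {μ : ℕ → ProbabilityMeasure C(unitInterval, ℝ)}
    (htight : IsTightMeasureSet {((μ n : ProbabilityMeasure C(unitInterval, ℝ)) :
      Measure C(unitInterval, ℝ)) | n}) {φ : (unitInterval →₀ ℝ) → ℂ}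
    (hφ : ∀ u, Tendsto (fun n => ∫ w, Complex.exp (evalPairing w u * Complex.I) ∂(μ n : Measure _))
      atTop (𝓝 (φ u))) :
    ∃ ν : ProbabilityMeasure C(unitInterval, ℝ), Tendsto μ atTop (𝓝 ν) ∧
      ∀ u, ∫ w, Complex.exp (evalPairing w u * Complex.I) ∂(ν : Measure _) = φ u := by
  -- only continuity in the path is needed, so the dual side carries the discrete topology
  let : TopologicalSpace (unitInterval →₀ ℝ) := ⊥
  have : DiscreteTopology (unitInterval →₀ ℝ) := ⟨rfl⟩
  have hL : Continuous fun p : C(unitInterval, ℝ) × (unitInterval →₀ ℝ) => evalPairing p.1 p.2 :=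
    continuous_prod_of_discrete_right.2 fun u => continuous_evalPairing_left u
  have hcompact : IsCompact (closure {μ n | n}) :=
    isCompact_closure_of_isTightMeasureSet (by simpa using htight)
  obtain ⟨ν, -, hν⟩ := hcompact.exists_mapClusterPt (f := atTop) (u := μ)
    (tendsto_principal.2 (Eventually.of_forall fun n => subset_closure ⟨n, rfl⟩))
  have hchar : ∀ (w : C(unitInterval, ℝ)) (u : unitInterval →₀ ℝ),
      ((Real.probChar (evalPairing w u) : Circle) : ℂ) =
        Complex.exp (evalPairing w u * Complex.I) := fun w u => by
    simp [Real.probChar_apply]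
  have hcont : ∀ f : BoundedContinuousFunction C(unitInterval, ℝ) ℂ,
      Tendsto (fun ρ : ProbabilityMeasure C(unitInterval, ℝ) => ∫ w, f w ∂(ρ : Measure _)) (𝓝 ν)
        (𝓝 (∫ w, f w ∂(ν : Measure _))) :=
    (ProbabilityMeasure.tendsto_iff_forall_integral_rclike_tendsto ℂ).1 tendsto_id
  -- the cluster point has the prescribed characteristic functions, by uniqueness of limits
  have hval : ∀ u, ∫ w, Complex.exp (evalPairing w u * Complex.I) ∂(ν : Measure _) = φ u := by
    intro u
    have h1 := hcont (BoundedContinuousFunction.char Real.continuous_probChar hL u)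
    simp only [BoundedContinuousFunction.char_apply, hchar] at h1
    have h2 := hν.tendsto_comp h1
    by_contra hne
    obtain ⟨U, V, hU, hV, hx, hy, hd⟩ := t2_separation hne
    have h3 := h2.frequently (hU.mem_nhds hx)
    have h4 := (hφ u).eventually (hV.mem_nhds hy)
    obtain ⟨n, hn1, hn2⟩ := (h3.and_eventually h4).exists
    exact Set.disjoint_left.1 hd hn1 hn2
  refine ⟨ν, ?_, hval⟩
  refine ProbabilityMeasure.tendsto_of_tight_of_separatesPoints ℂ htight
    (A := BoundedContinuousFunction.charPoly Real.continuous_probChar hL) ?_ ?_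
  · refine BoundedContinuousFunction.separatesPoints_charPoly _ Real.probChar_ne_one _ ?_
    intro w hw
    obtain ⟨t, ht⟩ := DFunLike.ne_iff.1 hw
    refine DFunLike.ne_iff.2 ⟨Finsupp.single t 1, ?_⟩
    rw [evalPairing_apply, Finsupp.sum_single_index (by simp), one_mul]
    exact ht
  · intro g hg
    obtain ⟨c, hc⟩ := (BoundedContinuousFunction.mem_charPoly _).1 hg
    have hint : ∀ (ρ : ProbabilityMeasure C(unitInterval, ℝ)), ∫ w, g w ∂(ρ : Measure _) =
        ∑ u ∈ c.coeff.support, c.coeff u *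
          ∫ w, Complex.exp (evalPairing w u * Complex.I) ∂(ρ : Measure _) := by
      intro ρ
      simp only [hc, Finsupp.sum, hchar]
      rw [integral_finsetSum]
      · exact Finset.sum_congr rfl fun u _ => integral_const_mul _ _
      · intro u _
        have h1 := (BoundedContinuousFunction.char Real.continuous_probChar hL u).integrable
          (ρ : Measure C(unitInterval, ℝ))
        exact (h1.congr (Eventually.of_forall fun w => hchar w u)).const_mul _
    rw [funext fun n => hint (μ n), hint ν]
    refine tendsto_finsetSum _ fun u _ => Tendsto.const_mul _ ?_
    rw [hval u]
    exact hφ u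

/-! ### Polygonal paths -/

/-- The path that rises linearly from `0` to `1` on `[i/n, (i+1)/n]`. -/
noncomputable def ramp (n i : ℕ) : C(unitInterval, ℝ) where
  toFun t := max 0 (min 1 ((n : ℝ) * t - i))
  continuous_toFun := by fun_prop

/-- The polygonal path with value `s k` at `k / n`, as a continuous path on `[0,1]`. -/
noncomputable def polygon (s : ℕ → ℝ) (n : ℕ) : C(unitInterval, ℝ) :=
  s 0 • (1 : C(unitInterval, ℝ)) + ∑ i ∈ Finset.range n, (s (i + 1) - s i) • ramp n i

theorem polygon_apply (s : ℕ → ℝ) {n k : ℕ} (hk : k < n) {t : unitInterval}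
    (h1 : (k : ℝ) ≤ n * t) (h2 : (n : ℝ) * t ≤ k + 1) :
    polygon s n t = s k + (n * t - k) * (s (k + 1) - s k) := by
  have e : polygon s n t = s 0 + ∑ i ∈ Finset.range n, (s (i + 1) - s i) *
      max 0 (min 1 ((n : ℝ) * t - i)) := by
    simp [polygon, ramp]
  have e2 : ∑ i ∈ Finset.range n, (s (i + 1) - s i) * max 0 (min 1 ((n : ℝ) * t - i)) =
      ∑ i ∈ Finset.range (k + 1), (s (i + 1) - s i) * max 0 (min 1 ((n : ℝ) * t - i)) := by
    symm
    refine Finset.sum_subset (Finset.range_subset_range.2 hk) fun i _ hi => ?_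
    rw [Finset.mem_range, not_lt] at hi
    have hi' : (k : ℝ) + 1 ≤ i := by exact_mod_cast hi
    rw [max_eq_left ((min_le_right _ _).trans (by linarith)), mul_zero]
  have e3 : ∑ i ∈ Finset.range k, (s (i + 1) - s i) * max 0 (min 1 ((n : ℝ) * t - i)) =
      s k - s 0 := by
    rw [← Finset.sum_range_sub s k]
    refine Finset.sum_congr rfl fun i hi => ?_
    have hi' : (i : ℝ) + 1 ≤ k := by exact_mod_cast Finset.mem_range.1 hi
    rw [min_eq_left (by linarith), max_eq_right zero_le_one, mul_one]
  rw [e, e2, Finset.sum_range_succ, e3, min_eq_right (by linarith), max_eq_right (by linarith)]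
  ring

/-- The index `k < n` of a cell `[k / n, (k + 1) / n]` that contains `t`; the minimum puts `t = 1`
into the last cell. -/
theorem exists_cell {n : ℕ} (hn : 1 ≤ n) (t : unitInterval) :
    min ⌊(n : ℝ) * t⌋₊ (n - 1) < n ∧ ((min ⌊(n : ℝ) * t⌋₊ (n - 1) : ℕ) : ℝ) ≤ n * t ∧
      (n : ℝ) * t ≤ ((min ⌊(n : ℝ) * t⌋₊ (n - 1) : ℕ) : ℝ) + 1 := by
  have h0 : 0 ≤ (n : ℝ) * t := mul_nonneg n.cast_nonneg t.2.1
  have h1 : (n : ℝ) * t ≤ n := mul_le_of_le_one_right n.cast_nonneg t.2.2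
  refine ⟨by omega, ?_, ?_⟩
  · exact le_trans (by exact_mod_cast min_le_left _ _) (Nat.floor_le h0)
  · rcases le_total ⌊(n : ℝ) * t⌋₊ (n - 1) with h | h
    · rw [min_eq_left h]; exact (Nat.lt_floor_add_one _).le
    · rw [min_eq_right h, Nat.cast_sub hn]; simpa using h1

theorem polygon_zero (s : ℕ → ℝ) {n : ℕ} (hn : 1 ≤ n) : polygon s n 0 = s 0 := by
  have := polygon_apply s (n := n) (k := 0) hn (t := 0) (by simp) (by simp)
  simpa using this

theorem aemeasurable_polygon {Ω : Type*} [MeasurableSpace Ω] {P : Measure Ω} {X : ℕ → Ω → ℝ}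
    (hX : ∀ k, AEMeasurable (X k) P) (n : ℕ) :
    AEMeasurable (fun ω => polygon (fun k => X k ω) n) P := by
  unfold polygon
  refine ((hX 0).smul_const _).add (Finset.aemeasurable_fun_sum _ fun i _ => ?_)
  exact ((hX (i + 1)).sub (hX i)).smul_const _

theorem abs_sub_polygon_le {s' : ℕ → ℝ} {n : ℕ} (hn : 1 ≤ n) {B : ℝ} (hB0 : 0 ≤ B)
    (hB : ∀ k < n, |s' (k + 1) - s' k| ≤ B) (t : unitInterval) :
    |s' ⌊(n : ℝ) * t⌋₊ - polygon s' n t| ≤ B := by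
  have h0 : 0 ≤ (n : ℝ) * t := mul_nonneg n.cast_nonneg t.2.1
  have h1 : (n : ℝ) * t ≤ n := mul_le_of_le_one_right n.cast_nonneg t.2.2
  have hk : ⌊(n : ℝ) * t⌋₊ ≤ n := Nat.floor_le_of_le h1
  -- `⌊n t⌋ = n` occurs only at `t = 1`, the right end of the last cell
  rcases Nat.eq_or_lt_of_le hk with h | h
  · have h2 : (n : ℝ) * t = n := le_antisymm h1 (by
      have := Nat.floor_le h0
      rwa [h] at this)
    have e : ((n - 1 : ℕ) : ℝ) = n - 1 := by rw [Nat.cast_sub hn]; simp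
    rw [polygon_apply s' (k := n - 1) (by omega) (by rw [e]; linarith) (by rw [e]; linarith),
      h2, e, Nat.floor_natCast, Nat.sub_add_cancel hn]
    ring_nf
    simpa using hB0
  · have h2 := Nat.floor_le h0
    have h3 := Nat.lt_floor_add_one ((n : ℝ) * t)
    rw [polygon_apply s' h h2 h3.le]
    have h4 := hB _ h
    have h5 : 0 ≤ (n : ℝ) * t - ⌊(n : ℝ) * t⌋₊ := by linarith
    have h6 : (n : ℝ) * t - ⌊(n : ℝ) * t⌋₊ ≤ 1 := by linarith
    rw [sub_add_cancel_left, abs_neg, abs_mul, abs_of_nonneg h5]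
    nlinarith [abs_nonneg (s' (⌊(n : ℝ) * t⌋₊ + 1) - s' ⌊(n : ℝ) * t⌋₊)]

section SecondMoment

variable {Ω : Type*} [MeasurableSpace Ω] {P : Measure Ω}

theorem lintegral_sq_add_three_le {f g h : Ω → ℝ} (hf : AEMeasurable f P)
    (hg : AEMeasurable g P) :
    ∫⁻ ω, ENNReal.ofReal ((f ω + g ω + h ω) ^ 2) ∂P ≤
      3 * (∫⁻ ω, ENNReal.ofReal (f ω ^ 2) ∂P + ∫⁻ ω, ENNReal.ofReal (g ω ^ 2) ∂P +
        ∫⁻ ω, ENNReal.ofReal (h ω ^ 2) ∂P) := by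
  have hf2 : AEMeasurable (fun ω => ENNReal.ofReal (f ω ^ 2)) P := (hf.pow_const 2).ennreal_ofReal
  have hg2 : AEMeasurable (fun ω => ENNReal.ofReal (g ω ^ 2)) P := (hg.pow_const 2).ennreal_ofReal
  have hfg : AEMeasurable (fun ω => ENNReal.ofReal (f ω ^ 2) + ENNReal.ofReal (g ω ^ 2)) P :=
    hf2.add hg2
  rw [← lintegral_add_left' hf2, ← lintegral_add_left' hfg,
    ← lintegral_const_mul' _ _ (by simp)]
  refine lintegral_mono fun ω => ?_
  rw [← ENNReal.ofReal_add (sq_nonneg _) (sq_nonneg _),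
    ← ENNReal.ofReal_add (by positivity) (sq_nonneg _),
    show (3 : ENNReal) = ENNReal.ofReal 3 by simp, ← ENNReal.ofReal_mul (by norm_num)]
  refine ENNReal.ofReal_le_ofReal ?_
  nlinarith [sq_nonneg (f ω - g ω), sq_nonneg (f ω - h ω), sq_nonneg (g ω - h ω)]

/-- Second moment bounds for the increments of a sequence pass to its polygonal path. -/
theorem lintegral_polygon_le {X : ℕ → Ω → ℝ} (hX : ∀ k, AEMeasurable (X k) P) {n : ℕ}
    (hn : 1 ≤ n) {M q : ℝ} (hM : 0 ≤ M) (hq : 1 < q) (hq2 : q ≤ 2)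
    (H : ∀ j k : ℕ, j ≤ k → k ≤ n → ∫⁻ ω, ENNReal.ofReal ((X k ω - X j ω) ^ 2) ∂P ≤
      ENNReal.ofReal (M * (((k : ℝ) - j) / n) ^ q)) (s t : unitInterval) :
    ∫⁻ ω, ENNReal.ofReal ((polygon (fun k => X k ω) n t - polygon (fun k => X k ω) n s) ^ 2) ∂P ≤
      ENNReal.ofReal (9 * M * |(t : ℝ) - s| ^ q) := by
  wlog hst : s ≤ t generalizing s t
  · have := this t s (le_of_not_ge hst)
    rw [abs_sub_comm] at this
    refine le_trans (le_of_eq ?_) this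
    congr 1; ext ω; congr 1; ring
  have hn0 : (0 : ℝ) < n := by exact_mod_cast hn
  have hst' : (s : ℝ) ≤ t := hst
  rw [abs_of_nonneg (by linarith)]
  obtain ⟨hj1, hj2, hj3⟩ := exists_cell hn s
  obtain ⟨hk1, hk2, hk3⟩ := exists_cell hn t
  have hjk : min ⌊(n : ℝ) * s⌋₊ (n - 1) ≤ min ⌊(n : ℝ) * t⌋₊ (n - 1) :=
    min_le_min (Nat.floor_mono (by gcongr)) le_rfl
  set j := min ⌊(n : ℝ) * s⌋₊ (n - 1)
  set k := min ⌊(n : ℝ) * t⌋₊ (n - 1)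
  have hcell : ∀ (c : ℝ) (i : ℕ), 0 ≤ c → c ≤ 1 → c ≤ n * ((t : ℝ) - s) → i < n →
      ∫⁻ ω, ENNReal.ofReal ((c * (X (i + 1) ω - X i ω)) ^ 2) ∂P ≤
        ENNReal.ofReal (M * ((t : ℝ) - s) ^ q) := by
    intro c i hc0 hc1 hcn hi
    have h1 := H i (i + 1) (Nat.le_succ i) hi
    push_cast at h1
    rw [add_sub_cancel_left] at h1
    have h2 : ∀ ω, ENNReal.ofReal ((c * (X (i + 1) ω - X i ω)) ^ 2) =
        ENNReal.ofReal (c ^ 2) * ENNReal.ofReal ((X (i + 1) ω - X i ω) ^ 2) := fun ω => by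
      rw [mul_pow, ENNReal.ofReal_mul (sq_nonneg c)]
    simp_rw [h2]
    rw [lintegral_const_mul' _ _ ENNReal.ofReal_ne_top]
    refine (mul_le_mul_right h1 _).trans ?_
    rw [← ENNReal.ofReal_mul (sq_nonneg c)]
    refine ENNReal.ofReal_le_ofReal ?_
    -- this is where `q ≤ 2` enters: within a cell the polygon is linear, hence more regular than
    -- required
    have h3 : c ^ 2 ≤ c ^ q := by
      rw [← Real.rpow_natCast]
      rcases hc0.eq_or_lt with rfl | hc
      · simp [Real.zero_rpow (show q ≠ 0 by linarith)]
      · exact Real.rpow_le_rpow_of_exponent_ge hc hc1 (by exact_mod_cast hq2)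
    calc c ^ 2 * (M * (1 / (n : ℝ)) ^ q) ≤ c ^ q * (M * (1 / (n : ℝ)) ^ q) := by gcongr
      _ = M * (c / n) ^ q := by
          rw [div_eq_mul_one_div c, Real.mul_rpow hc0 (by positivity)]; ring
      _ ≤ M * ((t : ℝ) - s) ^ q := by
          gcongr
          rw [div_le_iff₀ hn0]; linarith
  have hpow : 0 ≤ ((t : ℝ) - s) ^ q := Real.rpow_nonneg (by linarith) _
  rcases Nat.eq_or_lt_of_le hjk with h | h
  -- both points lie in the same cell
  · have e : ∀ ω, polygon (fun k => X k ω) n t - polygon (fun k => X k ω) n s =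
        (n * ((t : ℝ) - s)) * (X (j + 1) ω - X j ω) := fun ω => by
      rw [polygon_apply _ hj1 hj2 hj3, polygon_apply _ hj1 (h ▸ hk2) (h ▸ hk3)]; ring
    simp_rw [e]
    rw [← h] at hk3
    refine (hcell _ j (by have : 0 ≤ (t : ℝ) - s := by linarith
                          positivity) (by linarith) le_rfl hj1).trans ?_
    refine ENNReal.ofReal_le_ofReal ?_
    nlinarith [mul_nonneg hM hpow]
  -- otherwise the increment splits at the end of the first and the beginning of the last cell
  · have hjk' : (j : ℝ) + 1 ≤ k := by exact_mod_cast h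
    have e : ∀ ω, polygon (fun k => X k ω) n t - polygon (fun k => X k ω) n s =
        (n * (t : ℝ) - k) * (X (k + 1) ω - X k ω) + (j + 1 - n * (s : ℝ)) * (X (j + 1) ω - X j ω) +
          (X k ω - X (j + 1) ω) := fun ω => by
      rw [polygon_apply _ hj1 hj2 hj3, polygon_apply _ hk1 hk2 hk3]; ring
    simp_rw [e]
    refine (lintegral_sq_add_three_le
      (f := fun ω => (n * (t : ℝ) - k) * (X (k + 1) ω - X k ω))
      (g := fun ω => (j + 1 - n * (s : ℝ)) * (X (j + 1) ω - X j ω))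
      (((hX _).sub (hX _)).const_mul _) (((hX _).sub (hX _)).const_mul _)).trans ?_
    have h1 := hcell (n * (t : ℝ) - k) k (by linarith) (by linarith) (by linarith) hk1
    have h2 := hcell (j + 1 - n * (s : ℝ)) j (by linarith) (by linarith) (by linarith) hj1
    have h3 : ∫⁻ ω, ENNReal.ofReal ((X k ω - X (j + 1) ω) ^ 2) ∂P ≤
        ENNReal.ofReal (M * ((t : ℝ) - s) ^ q) := by
      refine (H (j + 1) k h hk1.le).trans (ENNReal.ofReal_le_ofReal ?_)
      push_cast
      gcongr
      rw [div_le_iff₀ hn0]; linarith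
    calc _ ≤ 3 * (ENNReal.ofReal (M * ((t : ℝ) - s) ^ q) + ENNReal.ofReal (M * ((t : ℝ) - s) ^ q) +
          ENNReal.ofReal (M * ((t : ℝ) - s) ^ q)) := by gcongr
      _ = ENNReal.ofReal (9 * M * ((t : ℝ) - s) ^ q) := by
        have h0 := mul_nonneg hM hpow
        rw [← ENNReal.ofReal_add h0 h0, ← ENNReal.ofReal_add (by positivity) h0,
          show (3 : ENNReal) = ENNReal.ofReal 3 by simp, ← ENNReal.ofReal_mul (by norm_num)]
        congr 1; ring

end SecondMoment

/-! ### Continuous paths inside the Skorokhod space -/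

namespace CadlagPath

theorem ext_toFun {x y : CadlagPath} (h : ∀ t, x t = y t) : x = y := by
  cases x; cases y
  congr
  exact funext h

theorem edist_eq (x y : CadlagPath) :
    edist x y = ⨅ τ : unitInterval ≃o unitInterval, timeChangeCost x y τ := rfl

theorem edist_le_of_forall {x y : CadlagPath} {c : ENNReal} (h : ∀ t, edist (x t) (y t) ≤ c) :
    edist x y ≤ c := by
  refine iInf_le_of_le (OrderIso.refl _) (max_le (iSup_le fun t => ?_) (iSup_le fun t => ?_))
  · simp
  · exact h t

theorem exists_timeChange_of_edist_lt {x y : CadlagPath} {c : ENNReal} (h : edist x y < c) :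
    ∃ τ : unitInterval ≃o unitInterval, (∀ t, edist (τ t) t < c) ∧
      ∀ t, edist (x t) (y (τ t)) < c := by
  rw [edist_eq, iInf_lt_iff] at h
  obtain ⟨τ, hτ⟩ := h
  refine ⟨τ, fun t => ?_, fun t => ?_⟩
  · exact ((le_iSup (fun t => edist (τ t) t) t).trans (le_max_left _ _)).trans_lt hτ
  · exact ((le_iSup (fun t => edist (x t) (y (τ t))) t).trans (le_max_right _ _)).trans_lt hτ

/-- A continuous path as an element of the Skorokhod space. -/
def ofContinuous (w : C(unitInterval, ℝ)) : CadlagPath where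
  toFun := w
  right_continuous _ := w.continuous.continuousWithinAt
  left_limit t := ⟨w t, w.continuous.continuousWithinAt⟩

theorem ofContinuous_apply (w : C(unitInterval, ℝ)) (t : unitInterval) :
    ofContinuous w t = w t := rfl

/-- On the continuous paths the Skorokhod topology is the uniform one, and a Skorokhod limit of
continuous paths is continuous. -/
theorem isClosedEmbedding_ofContinuous : IsClosedEmbedding ofContinuous := by
  have hcont : Continuous ofContinuous := by
    refine LipschitzWith.continuous (K := 1) fun w w' => ?_
    rw [ENNReal.coe_one, one_mul]
    refine edist_le_of_forall fun t => ?_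
    rw [edist_dist, edist_dist]
    exact ENNReal.ofReal_le_ofReal (ContinuousMap.dist_apply_le_dist t)
  refine ⟨⟨isInducing_iff_nhds.2 fun w => le_antisymm ?_ ?_, ?_⟩, ?_⟩
  · exact (hcont.tendsto w).le_comap
  · rw [Metric.nhds_basis_ball.ge_iff]
    intro ε hε
    -- uniform continuity of `w` absorbs a small time change
    obtain ⟨δ, hδ, hu⟩ := Metric.uniformContinuous_iff.1
      (CompactSpace.uniformContinuous_of_continuous w.continuous) (ε / 2) (by positivity)
    refine mem_comap.2 ⟨Metric.eball (ofContinuous w) (ENNReal.ofReal (min δ (ε / 2))),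
      Metric.eball_mem_nhds _ (by simpa using ⟨hδ, hε⟩), fun w' hw' => ?_⟩
    obtain ⟨τ, h1, h2⟩ := exists_timeChange_of_edist_lt (Metric.mem_eball.1 hw')
    rw [Metric.mem_ball]
    refine (ContinuousMap.dist_lt_iff hε).2 fun t => ?_
    have h3 := h1 t
    have h4 := h2 t
    rw [edist_dist, ENNReal.ofReal_lt_ofReal_iff (by positivity)] at h3 h4
    have h5 := hu (h3.trans_le (min_le_left _ _))
    have h6 := h4.trans_le (min_le_right _ _)
    rw [ofContinuous_apply, ofContinuous_apply] at h6
    linarith [dist_triangle (w' t) (w (τ t)) (w t)]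
  · intro w w' h
    ext t
    exact congrArg (fun x : CadlagPath => x t) h
  · refine isClosed_of_closure_subset fun x hx => ?_
    have hxc : Continuous x.toFun := by
      rw [← continuousOn_univ]
      -- the limit is uniformly approximated by the time-changed paths `w ∘ τ`
      refine continuousOn_of_uniform_approx_of_continuousOn fun u hu => ?_
      obtain ⟨ε, hε, hεu⟩ := Metric.mem_uniformity_dist.1 hu
      obtain ⟨_, ⟨w, rfl⟩, hw⟩ := EMetric.mem_closure_iff.1 hx (ENNReal.ofReal ε) (by simpa using hε)
      obtain ⟨τ, _, h2⟩ := exists_timeChange_of_edist_lt hw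
      refine ⟨fun t => w (τ t), ?_, fun t _ => hεu ?_⟩
      · exact (w.continuous.comp τ.toHomeomorph.continuous).continuousOn
      · have := h2 t
        rwa [edist_dist, ENNReal.ofReal_lt_ofReal_iff hε] at this
    exact ⟨⟨x.toFun, hxc⟩, ext_toFun fun _ => rfl⟩

/-- Every time change fixes the end point `1`. -/
theorem continuous_eval_one : Continuous fun x : CadlagPath => x 1 := by
  refine LipschitzWith.continuous (K := 1) fun x y => ?_
  rw [ENNReal.coe_one, one_mul]
  refine le_of_forall_gt fun c hc => ?_
  obtain ⟨τ, _, h2⟩ := exists_timeChange_of_edist_lt hc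
  have := h2 1
  rwa [show (τ 1 : unitInterval) = 1 from map_top τ] at this

theorem edist_stepPath_le {s s' : ℕ → ℝ} {n : ℕ} {c : ENNReal}
    (h : ∀ k ≤ n, edist (s k) (s' k) ≤ c) : edist (stepPath s n) (stepPath s' n) ≤ c :=
  edist_le_of_forall fun t => h _ (Nat.floor_le_of_le
    (mul_le_of_le_one_right n.cast_nonneg t.2.2))

theorem edist_stepPath_polygon_le {s s' : ℕ → ℝ} {n : ℕ} (hn : 1 ≤ n) {A B : ℝ}
    (hB0 : 0 ≤ B) (hA : ∀ k ≤ n, |s k - s' k| ≤ A) (hB : ∀ k < n, |s' (k + 1) - s' k| ≤ B) :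
    edist (stepPath s n) (ofContinuous (polygon s' n)) ≤ ENNReal.ofReal (A + B) := by
  refine edist_le_of_forall fun t => ?_
  have hk : ⌊(n : ℝ) * t⌋₊ ≤ n := Nat.floor_le_of_le
    (mul_le_of_le_one_right n.cast_nonneg t.2.2)
  have hs : stepPath s n t = s ⌊(n : ℝ) * t⌋₊ := rfl
  rw [edist_dist, Real.dist_eq, ofContinuous_apply, hs]
  refine ENNReal.ofReal_le_ofReal ?_
  have hp := abs_sub_polygon_le hn hB0 hB t
  calc _ = |(s ⌊(n : ℝ) * t⌋₊ - s' ⌊(n : ℝ) * t⌋₊) + (s' ⌊(n : ℝ) * t⌋₊ - polygon s' n t)| := by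
        congr 1; ring
    _ ≤ _ := (abs_add_le _ _).trans (add_le_add (hA _ hk) hp)

theorem aemeasurable_stepPath {Ω : Type*} [MeasurableSpace Ω] {P : Measure Ω} {X : ℕ → Ω → ℝ}
    (hX : ∀ k, AEMeasurable (X k) P) (n : ℕ) :
    AEMeasurable (fun ω => stepPath (fun k => X k ω) n) P := by
  -- the step path is a continuous function of the `n + 1` values that it takes
  set G : (Fin (n + 1) → ℝ) → CadlagPath := fun y =>
    stepPath (fun k => if h : k < n + 1 then y ⟨k, h⟩ else 0) n with hG
  have hGc : Continuous G := by
    refine LipschitzWith.continuous (K := 1) fun y y' => ?_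
    rw [ENNReal.coe_one, one_mul]
    refine edist_stepPath_le fun k hk => ?_
    simp only [dif_pos (show k < n + 1 by omega)]
    exact edist_le_pi_edist y y' _
  have h1 : AEMeasurable (fun ω => fun i : Fin (n + 1) => X i ω) P :=
    aemeasurable_pi_lambda _ fun i => hX i
  refine (hGc.measurable.comp_aemeasurable h1).congr (Eventually.of_forall fun ω => ?_)
  refine ext_toFun fun t => ?_
  have hk : ⌊(n : ℝ) * t⌋₊ < n + 1 := Nat.lt_succ_of_le (Nat.floor_le_of_le
    (mul_le_of_le_one_right n.cast_nonneg t.2.2))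
  simp only [Function.comp, hG, stepPath, dif_pos hk]

/-- Random paths that are uniformly close in probability to random continuous paths inherit
their convergence in law. -/
theorem tendstoInDistribution_of_close {Ω : Type*} [MeasurableSpace Ω] {P : Measure Ω}
    [IsProbabilityMeasure P] {Y : ℕ → Ω → CadlagPath} (hY : ∀ n, AEMeasurable (Y n) P)
    {p : ℕ → Ω → C(unitInterval, ℝ)} (hp : ∀ n, AEMeasurable (p n) P) {D : ℕ → Ω → ℝ}
    (hD : ∀ᶠ n in atTop, ∀ᵐ ω ∂P,
      edist (Y n ω) (ofContinuous (p n ω)) ≤ ENNReal.ofReal (D n ω))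
    (hD0 : ∀ ε : ℝ, 0 < ε → Tendsto (fun n => P {ω | ε < D n ω}) atTop (𝓝 0))
    {ν : ProbabilityMeasure C(unitInterval, ℝ)}
    (hν : Tendsto (β := ProbabilityMeasure C(unitInterval, ℝ))
      (fun n => ⟨P.map (p n), Measure.isProbabilityMeasure_map (hp n)⟩) atTop (𝓝 ν))
    (μ : Measure CadlagPath) [IsProbabilityMeasure μ]
    (hμ : μ = (ν : Measure C(unitInterval, ℝ)).map ofContinuous) :
    TendstoInDistribution Y atTop (fun w : CadlagPath => w) (fun _ => P) μ := by
  have hι := isClosedEmbedding_ofContinuous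
  have hιm : Measurable ofContinuous := hι.continuous.measurable
  refine ⟨hY, aemeasurable_id, ?_⟩
  -- portmanteau theorem: for closed `F` the event `Y n ∈ F` forces the continuous path into the
  -- closed `δ`-neighbourhood of `F`, up to the event `δ < D n`
  refine tendsto_of_forall_isClosed_limsup_le' fun F hF => ?_
  simp only [ProbabilityMeasure.coe_mk, Measure.map_id']
  have hkey : ∀ δ : ℝ, 0 < δ →
      limsup (fun n => P.map (Y n) F) atTop ≤ μ (Metric.cthickening δ F) := by
    intro δ hδ
    have hcl : IsClosed (ofContinuous ⁻¹' Metric.cthickening δ F) :=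
      Metric.isClosed_cthickening.preimage hι.continuous
    have h1 := ProbabilityMeasure.limsup_measure_closed_le_of_tendsto hν hcl
    have h2 : (ν : Measure C(unitInterval, ℝ)) (ofContinuous ⁻¹' Metric.cthickening δ F) =
        μ (Metric.cthickening δ F) := by
      rw [hμ, Measure.map_apply hιm Metric.isClosed_cthickening.measurableSet]
    rw [h2] at h1
    have h3 : ∀ᶠ n in atTop, P.map (Y n) F ≤
        P.map (p n) (ofContinuous ⁻¹' Metric.cthickening δ F) + P {ω | δ < D n ω} := by
      filter_upwards [hD] with n hn
      rw [Measure.map_apply_of_aemeasurable (hY n) hF.measurableSet,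
        Measure.map_apply_of_aemeasurable (hp n) hcl.measurableSet]
      refine le_trans (measure_mono_ae ?_) (measure_union_le _ _)
      filter_upwards [hn] with ω hω hωF
      by_cases hc : δ < D n ω
      · exact Or.inr hc
      · left
        show ofContinuous (p n ω) ∈ Metric.cthickening δ F
        rw [Metric.mem_cthickening_iff]
        refine (Metric.infEDist_le_edist_of_mem (show Y n ω ∈ F from hωF)).trans ?_
        rw [edist_comm]
        exact hω.trans (ENNReal.ofReal_le_ofReal (not_lt.1 hc))
    refine (limsup_le_limsup h3).trans ?_
    exact (ENNReal.limsup_add_of_right_tendsto_zero (hD0 δ hδ) _).trans_le h1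
  have hlim : Tendsto (fun δ => μ (Metric.cthickening δ F)) (𝓝[>] 0) (𝓝 (μ F)) :=
    (tendsto_measure_cthickening_of_isClosed ⟨1, one_pos, measure_ne_top _ _⟩ hF).mono_left
      nhdsWithin_le_nhds
  exact ge_of_tendsto hlim (eventually_mem_nhdsWithin.mono fun δ hδ => hkey δ hδ)

end CadlagPath

/-! ### Fractional Brownian motion from its characteristic function -/

/-- The covariance function of the fractional Brownian motion with Hurst index `H`. -/
noncomputable def fbmCov (H : ℝ) (s t : unitInterval) : ℝ :=
  ((s : ℝ) ^ (2 * H) + (t : ℝ) ^ (2 * H) - |(t : ℝ) - s| ^ (2 * H)) / 2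

/-- The bilinear form on finitely supported functions on `[0,1]` whose matrix is `fbmCov H`. -/
noncomputable def fbmForm (H : ℝ) :
    (unitInterval →₀ ℝ) →ₗ[ℝ] (unitInterval →₀ ℝ) →ₗ[ℝ] ℝ :=
  Finsupp.linearCombination ℝ fun s => Finsupp.linearCombination ℝ (fbmCov H s)

theorem fbmForm_apply (H : ℝ) (u v : unitInterval →₀ ℝ) :
    fbmForm H u v = ∑ s ∈ u.support, ∑ t ∈ v.support, u s * v t * fbmCov H s t := by
  simp [fbmForm, Finsupp.linearCombination_apply, Finsupp.sum, Finset.mul_sum, mul_assoc]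

theorem fbmForm_single (H : ℝ) (s t : unitInterval) (c d : ℝ) :
    fbmForm H (Finsupp.single s c) (Finsupp.single t d) = c * d * fbmCov H s t := by
  simp [fbmForm, mul_assoc]

theorem fbmCov_comm (H : ℝ) (s t : unitInterval) : fbmCov H s t = fbmCov H t s := by
  rw [fbmCov, fbmCov, abs_sub_comm]; ring

theorem evalPairing_single (w : C(unitInterval, ℝ)) (t : unitInterval) (c : ℝ) :
    evalPairing w (Finsupp.single t c) = c * w t := by
  rw [evalPairing_apply, Finsupp.sum_single_index (by simp)]

section Law

variable {H : ℝ} {ν : Measure C(unitInterval, ℝ)} [IsProbabilityMeasure ν]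

/-- The modulus of a characteristic function is at most one; positivity of the form needs no
separate argument. -/
theorem fbmForm_self_nonneg (h : ∀ u, ∫ w, Complex.exp (evalPairing w u * Complex.I) ∂ν =
    Complex.exp (-(fbmForm H u u : ℝ) / 2)) (u : unitInterval →₀ ℝ) : 0 ≤ fbmForm H u u := by
  have h1 : ‖∫ w, Complex.exp (evalPairing w u * Complex.I) ∂ν‖ ≤ 1 := by
    refine (norm_integral_le_integral_norm _).trans ?_
    simp [Complex.norm_exp_ofReal_mul_I]
  rw [h u, Complex.norm_exp] at h1
  have h2 : (-((fbmForm H u u : ℝ) : ℂ) / 2).re = -(fbmForm H u u) / 2 := by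
    rw [show (-((fbmForm H u u : ℝ) : ℂ) / 2) = ((-(fbmForm H u u) / 2 : ℝ) : ℂ) by push_cast; rfl,
      Complex.ofReal_re]
  rw [h2, Real.exp_le_one_iff] at h1
  linarith

theorem map_evalPairing (h : ∀ u, ∫ w, Complex.exp (evalPairing w u * Complex.I) ∂ν =
    Complex.exp (-(fbmForm H u u : ℝ) / 2)) (u : unitInterval →₀ ℝ) :
    ν.map (fun w => evalPairing w u) = gaussianReal 0 (fbmForm H u u).toNNReal := by
  have hm : Measurable fun w : C(unitInterval, ℝ) => evalPairing w u :=
    (continuous_evalPairing_left u).measurable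
  have : IsProbabilityMeasure (ν.map fun w => evalPairing w u) :=
    Measure.isProbabilityMeasure_map hm.aemeasurable
  refine Measure.ext_of_charFun ?_
  ext θ
  rw [charFun_gaussianReal, charFun_apply_real, integral_map hm.aemeasurable (by fun_prop)]
  have e : ∀ w : C(unitInterval, ℝ), (θ : ℂ) * (evalPairing w u : ℝ) * Complex.I =
      (evalPairing w (θ • u) : ℝ) * Complex.I := fun w => by simp
  simp_rw [e]
  rw [h]
  congr 1
  simp only [map_smul, LinearMap.smul_apply, smul_eq_mul, Complex.ofReal_mul,
    Real.coe_toNNReal _ (fbmForm_self_nonneg h u), Complex.ofReal_zero, mul_zero,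
    zero_mul]
  ring

theorem memLp_evalPairing (h : ∀ u, ∫ w, Complex.exp (evalPairing w u * Complex.I) ∂ν =
    Complex.exp (-(fbmForm H u u : ℝ) / 2)) (u : unitInterval →₀ ℝ) :
    MemLp (fun w => evalPairing w u) 2 ν := by
  have h1 : MemLp id 2 (ν.map fun w => evalPairing w u) := by
    rw [map_evalPairing h]
    exact memLp_id_gaussianReal 2
  exact h1.comp_of_map (continuous_evalPairing_left u).measurable.aemeasurable

theorem integral_evalPairing (h : ∀ u, ∫ w, Complex.exp (evalPairing w u * Complex.I) ∂ν =
    Complex.exp (-(fbmForm H u u : ℝ) / 2)) (u : unitInterval →₀ ℝ) :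
    ∫ w, evalPairing w u ∂ν = 0 := by
  have h1 := integral_map (μ := ν) (continuous_evalPairing_left u).measurable.aemeasurable
    (f := fun x : ℝ => x) (by fun_prop)
  rw [map_evalPairing h, integral_id_gaussianReal] at h1
  exact h1.symm

theorem variance_evalPairing (h : ∀ u, ∫ w, Complex.exp (evalPairing w u * Complex.I) ∂ν =
    Complex.exp (-(fbmForm H u u : ℝ) / 2)) (u : unitInterval →₀ ℝ) :
    Var[fun w => evalPairing w u; ν] = fbmForm H u u := by
  have h1 := variance_id_map (μ := ν) (X := fun w => evalPairing w u)
    (continuous_evalPairing_left u).measurable.aemeasurable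
  rw [map_evalPairing h, variance_id_gaussianReal, Real.coe_toNNReal _ (fbmForm_self_nonneg h u)]
    at h1
  exact h1.symm

/-- Polarization of the variances. -/
theorem covariance_eval (h : ∀ u, ∫ w, Complex.exp (evalPairing w u * Complex.I) ∂ν =
    Complex.exp (-(fbmForm H u u : ℝ) / 2)) (s t : unitInterval) :
    cov[fun w : C(unitInterval, ℝ) => w s, fun w => w t; ν] = fbmCov H s t := by
  have e : ∀ r : unitInterval, (fun w : C(unitInterval, ℝ) => w r) =
      fun w => evalPairing w (Finsupp.single r 1) := fun r => by
    ext w; rw [evalPairing_single, one_mul]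
  rw [e s, e t]
  set a : unitInterval →₀ ℝ := Finsupp.single s 1
  set b : unitInterval →₀ ℝ := Finsupp.single t 1
  have h1 := variance_fun_add (memLp_evalPairing h a) (memLp_evalPairing h b)
  have e2 : (fun w : C(unitInterval, ℝ) => evalPairing w a + evalPairing w b) =
      fun w => evalPairing w (a + b) := by
    ext w; rw [map_add]
  rw [e2, variance_evalPairing h, variance_evalPairing h, variance_evalPairing h] at h1
  have h2 : fbmForm H (a + b) (a + b) =
      fbmForm H a a + 2 * fbmCov H s t + fbmForm H b b := by
    have h3 : fbmForm H a b = fbmCov H s t := by simp [a, b, fbmForm_single]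
    have h4 : fbmForm H b a = fbmCov H s t := by simp [a, b, fbmForm_single, fbmCov_comm H t s]
    simp only [map_add, LinearMap.add_apply, h3, h4]
    ring
  linarith

/-- Every linear functional of finitely many evaluations is an evaluation pairing, hence Gaussian.
-/
theorem hasGaussianLaw_eval (h : ∀ u, ∫ w, Complex.exp (evalPairing w u * Complex.I) ∂ν =
    Complex.exp (-(fbmForm H u u : ℝ) / 2)) (I : Finset unitInterval) :
    HasGaussianLaw (fun w : C(unitInterval, ℝ) => I.restrict fun t => w t) ν := by
  have hm : Measurable fun w : C(unitInterval, ℝ) => I.restrict fun t => w t :=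
    measurable_pi_lambda _ fun i => (continuous_eval_const (i : unitInterval)).measurable
  refine ⟨isGaussian_of_isGaussian_map fun Λ => ?_⟩
  rw [Measure.map_map Λ.continuous.measurable hm]
  have e : (Λ ∘ fun w : C(unitInterval, ℝ) => I.restrict fun t => w t) = fun w =>
      evalPairing w (∑ i : I, Finsupp.single (i : unitInterval) (Λ (Pi.single i 1))) := by
    ext w
    simp only [Function.comp, map_sum, evalPairing_single]
    conv_lhs => rw [← Finset.univ_sum_single (I.restrict fun t => w t)]
    rw [map_sum]
    refine Finset.sum_congr rfl fun i _ => ?_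
    have h1 : (Pi.single i (I.restrict (fun t => w t) i) : I → ℝ) =
        (w i) • Pi.single i (1 : ℝ) := by
      ext j; by_cases hj : j = i
      · subst hj; simp
      · simp [hj]
    rw [h1, map_smul, smul_eq_mul, mul_comm]
  rw [e, map_evalPairing h]
  infer_instance

/-- A law on `C[0,1]` with the finite-dimensional characteristic functions of the fractional
Brownian motion makes the evaluations on the Skorokhod space such a motion. -/
theorem isFractionalBrownianMotion_map_ofContinuous
    (h : ∀ u, ∫ w, Complex.exp (evalPairing w u * Complex.I) ∂ν =
      Complex.exp (-(fbmForm H u u : ℝ) / 2)) :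
    IsFractionalBrownianMotion H (fun t (w : CadlagPath) => w t)
      (ν.map CadlagPath.ofContinuous) := by
  have hι : MeasurableEmbedding CadlagPath.ofContinuous :=
    CadlagPath.isClosedEmbedding_ofContinuous.measurableEmbedding
  have hev : ∀ t, AEMeasurable (fun w : CadlagPath => w t) (ν.map CadlagPath.ofContinuous) :=
    fun t => hι.aemeasurable_map_iff.2 (continuous_eval_const t).measurable.aemeasurable
  refine ⟨⟨fun I => ⟨?_⟩⟩, fun t => ?_, fun s t => ?_, ?_⟩
  · have h1 : AEMeasurable (fun w : CadlagPath => I.restrict fun t => w t)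
        (ν.map CadlagPath.ofContinuous) := aemeasurable_pi_lambda _ fun i => hev i
    rw [AEMeasurable.map_map_of_aemeasurable h1 hι.measurable.aemeasurable]
    exact (hasGaussianLaw_eval h I).isGaussian_map
  · rw [hι.integral_map]
    have := integral_evalPairing h (Finsupp.single t 1)
    simp only [evalPairing_single, one_mul] at this
    exact this
  · rw [covariance_map (hev s).aestronglyMeasurable (hev t).aestronglyMeasurable
      hι.measurable.aemeasurable]
    exact covariance_eval h s t
  · refine hι.ae_map_iff.2 (Eventually.of_forall fun w => ?_)
    exact w.continuous

end Law

/-- Convergence of the step paths in the Skorokhod space yields convergence of the end points. -/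
theorem tendstoInDistribution_end_of_stepPath {Ω : Type*} [MeasurableSpace Ω] {P : Measure Ω}
    [IsProbabilityMeasure P] {H : ℝ} (hH : 0 < H) {ν : Measure C(unitInterval, ℝ)}
    [IsProbabilityMeasure ν] (h : ∀ u, ∫ w, Complex.exp (evalPairing w u * Complex.I) ∂ν =
      Complex.exp (-(fbmForm H u u : ℝ) / 2)) {X : ℕ → ℕ → Ω → ℝ}
    [IsProbabilityMeasure (ν.map CadlagPath.ofContinuous)]
    (hX : TendstoInDistribution (fun n ω => stepPath (fun m => X n m ω) n) atTop
      (fun w : CadlagPath => w) (fun _ => P) (ν.map CadlagPath.ofContinuous)) :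
    TendstoInDistribution (fun n ω => X n n ω) atTop (fun x : ℝ => x) (fun _ => P)
      (gaussianReal 0 1) := by
  have h1 := hX.continuous_comp CadlagPath.continuous_eval_one
  have e : ∀ n, (fun x : CadlagPath => x 1) ∘ (fun ω => stepPath (fun m => X n m ω) n) =
      fun ω => X n n ω := fun n => by
    ext ω
    simp [stepPath]
  have hlaw : (ν.map CadlagPath.ofContinuous).map
      ((fun x : CadlagPath => x 1) ∘ fun w : CadlagPath => w) = gaussianReal 0 1 := by
    rw [Measure.map_map (g := (fun x : CadlagPath => x 1) ∘ fun w : CadlagPath => w)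
      (CadlagPath.continuous_eval_one.measurable.comp measurable_id)
      CadlagPath.isClosedEmbedding_ofContinuous.continuous.measurable]
    have h2 := map_evalPairing h (Finsupp.single 1 1)
    have h3 : (fbmForm H (Finsupp.single 1 1) (Finsupp.single 1 1)).toNNReal = 1 := by
      rw [fbmForm_single, fbmCov]
      simp [Real.zero_rpow (mul_pos two_pos hH).ne']
    rw [h3] at h2
    rw [← h2]
    congr 1
    ext w
    simp [evalPairing_single, CadlagPath.ofContinuous]
  refine ⟨fun n => ?_, aemeasurable_id, ?_⟩
  · rw [← e n]; exact h1.forall_aemeasurable n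
  · have h2 := h1.tendsto
    simp_rw [e, hlaw] at h2
    simpa using h2

/-! ### Weighted sums of the window coefficients -/

/-- The suprema of the tails of a null sequence form a null sequence. -/
theorem exists_tendsto_majorant {f : ℕ → ℝ} (hf : Tendsto f atTop (𝓝 0)) :
    ∃ Θ : ℕ → ℝ, Tendsto Θ atTop (𝓝 0) ∧ (∀ n, 0 ≤ Θ n) ∧ ∀ n j, n ≤ j → f j ≤ Θ n := by
  have habs : Tendsto (fun j => |f j|) atTop (𝓝 0) := by simpa using hf.abs
  obtain ⟨M, hM⟩ := habs.bddAbove_range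
  have hbdd : ∀ n, BddAbove (range fun j => |f (n + j)|) := fun n =>
    ⟨M, by rintro _ ⟨j, rfl⟩; exact hM ⟨n + j, rfl⟩⟩
  have h0 : ∀ n, 0 ≤ ⨆ j, |f (n + j)| := fun n =>
    (abs_nonneg _).trans (le_ciSup (hbdd n) 0)
  refine ⟨fun n => ⨆ j, |f (n + j)|, ?_, h0, fun n j hj => ?_⟩
  · rw [Metric.tendsto_atTop]
    intro e he
    obtain ⟨N, hN⟩ := Metric.tendsto_atTop.1 habs (e / 2) (by positivity)
    refine ⟨N, fun n hn => ?_⟩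
    rw [Real.dist_eq, sub_zero, abs_of_nonneg (h0 n)]
    refine lt_of_le_of_lt (ciSup_le fun j => ?_) (half_lt_self he)
    have := hN (n + j) (by omega)
    rw [Real.dist_eq, sub_zero, abs_abs] at this
    exact this.le
  · obtain ⟨i, rfl⟩ := Nat.exists_eq_add_of_le hj
    exact (le_abs_self _).trans (le_ciSup (hbdd n) i)

theorem exists_tsum_le_of_decay {p : ℝ} (hp : 1 < p) :
    ∃ C, 0 < C ∧ ∀ n : ℕ, 1 ≤ n → ∀ (c : ℝ) (f : ℤ → ℝ), (∀ r, 0 ≤ f r) →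
      (∀ r : ℤ, f r ≤ c * (1 + |(r : ℝ)| / n) ^ (-p)) → Summable f ∧ ∑' r, f r ≤ C * c * n := by
  obtain ⟨C, hC, h⟩ := exists_tsum_decay_le hp
  refine ⟨C, hC, fun n hn c f h0 hf => ?_⟩
  obtain ⟨h1, h2⟩ := h n hn
  have hc : 0 ≤ c := by simpa using (h0 0).trans (hf 0)
  have hs : Summable f := Summable.of_nonneg_of_le h0 hf (h1.mul_left c)
  refine ⟨hs, (hs.tsum_le_tsum hf (h1.mul_left c)).trans ?_⟩
  rw [tsum_mul_left]
  nlinarith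

theorem natCast_add_natAbs {n : ℕ} (hn : 1 ≤ n) (r : ℤ) :
    ((n + r.natAbs : ℕ) : ℝ) = n * (1 + |(r : ℝ)| / n) := by
  have hn0 : (0 : ℝ) < n := by exact_mod_cast hn
  push_cast
  rw [Nat.cast_natAbs, Int.cast_abs]
  field_simp

/-- Regularity of the truncation: `η j` is the truncation level and `σ j ^ 2` the truncated second
moment at that level, so that `η j` is of the order of `√j σ j` and `σ` varies slowly. -/
structure TruncationRegular (δ C : ℝ) (η σ : ℕ → ℝ) : Prop where
  one_le : 1 ≤ C
  pos : ∀ j, 1 ≤ j → 0 < σ j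
  growth : ∀ n : ℕ, 1 ≤ n → ∀ r : ℤ, σ (n + r.natAbs) ≤ C * σ n * (1 + |(r : ℝ)| / n) ^ δ
  level_ge : ∀ j : ℕ, 1 ≤ j → Real.sqrt j * σ j ≤ η j
  level_le : ∀ j : ℕ, 1 ≤ j → η j ≤ C * (Real.sqrt j * σ j)

/-- The order of magnitude of `X_1 + ⋯ + X_n`, that is, the standard deviation of the sum built from
truncated innovations up to a constant. -/
noncomputable def sumScale (α : ℝ) (Λ σ : ℕ → ℝ) (n : ℕ) : ℝ :=
  Λ n * (n : ℝ) ^ (1 - α) * (Real.sqrt n * σ n)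

section Weighted

variable {a : ℕ → ℝ} {α δ K C₀ : ℝ} {Λ η σ : ℕ → ℝ}

theorem sumScale_pos (hΛ : PotterRegular δ K Λ) (hσ : TruncationRegular δ C₀ η σ) {n : ℕ}
    (hn : 1 ≤ n) : 0 < sumScale α Λ σ n := by
  have hn0 : (0 : ℝ) < n := by exact_mod_cast hn
  have := hΛ.pos n
  have := hσ.pos n hn
  unfold sumScale
  positivity

theorem absWindow_nonneg (a : ℕ → ℝ) (d : ℕ) (r : ℤ) : 0 ≤ absWindow a d r :=
  Finset.sum_nonneg fun _ _ => abs_nonneg _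

/-- The first moments `T` that the truncation removes, weighted by the window coefficients. Since
`η_j ≥ √j σ_j`, the hypothesis on `T` gains a decay of exponent `1 / 2` over that of the window
coefficients, which makes the sum finite. -/
theorem exists_tsum_absWindow_mul_tail_le (hΛ : PotterRegular δ K Λ)
    (hσ : TruncationRegular δ C₀ η σ)
    (haK : ∀ i : ℕ, |a i| ≤ K * ((i : ℝ) + 1) ^ (-α) * Λ (i + 1))
    (hα1 : α + δ < 1) (hp : 1 < 2 * α - 4 * δ) :
    ∃ C, 0 < C ∧ ∀ n : ℕ, 1 ≤ n → ∀ (θ : ℝ) (T : ℕ → ℝ), (∀ j, 0 ≤ T j) →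
      (∀ j, n ≤ j → η j * T j ≤ θ * σ j ^ 2) →
      Summable (fun r : ℤ => absWindow a n r * T (n + r.natAbs)) ∧
        ∑' r : ℤ, absWindow a n r * T (n + r.natAbs) ≤ C * θ * sumScale α Λ σ n := by
  have hδ := hΛ.exponent_pos
  obtain ⟨D, hD, hDle⟩ := exists_absWindow_le hΛ haK (by linarith) hα1
  obtain ⟨E, hE, hEle⟩ := exists_tsum_le_of_decay (p := α - δ + (1 / 2 - δ)) (by linarith)
  have hC0 : 0 < C₀ := by linarith [hσ.one_le]
  refine ⟨E * D * C₀, by positivity, fun n hn θ T hT0 hT => ?_⟩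
  have hn0 : (0 : ℝ) < n := by exact_mod_cast hn
  have hΛn := hΛ.pos n
  have hσn := hσ.pos n hn
  have hθ : 0 ≤ θ := by
    have h1 := hT n le_rfl
    have h2 : 0 ≤ η n := le_trans (by positivity) (hσ.level_ge n hn)
    by_contra hneg
    nlinarith [mul_nonneg h2 (hT0 n), pow_pos hσn 2]
  have hTle : ∀ r : ℤ, T (n + r.natAbs) ≤
      θ * C₀ * (σ n / Real.sqrt n) * (1 + |(r : ℝ)| / n) ^ (-(1 / 2 - δ)) := by
    intro r
    set ρ := 1 + |(r : ℝ)| / n with hρ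
    have hρ0 : 0 < ρ := by positivity
    have hj : 1 ≤ n + r.natAbs := by omega
    have h1 := hT (n + r.natAbs) (by omega)
    have h2 := hσ.level_ge _ hj
    have h3 := hσ.growth n hn r
    have hσj := hσ.pos _ hj
    rw [natCast_add_natAbs hn, ← hρ, Real.sqrt_mul hn0.le] at h2
    rw [← hρ] at h3
    have h4 : Real.sqrt n * Real.sqrt ρ * T (n + r.natAbs) ≤ θ * σ (n + r.natAbs) := by
      refine le_of_mul_le_mul_right ?_ hσj
      nlinarith [mul_le_mul_of_nonneg_right h2 (hT0 (n + r.natAbs))]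
    have h5 : T (n + r.natAbs) ≤ θ * (C₀ * σ n * ρ ^ δ) / (Real.sqrt n * Real.sqrt ρ) := by
      rw [le_div_iff₀ (by positivity), mul_comm]
      exact h4.trans (by gcongr)
    refine h5.trans (le_of_eq ?_)
    rw [neg_sub, Real.rpow_sub hρ0, ← Real.sqrt_eq_rpow]
    field_simp
  have hf : ∀ r : ℤ, absWindow a n r * T (n + r.natAbs) ≤
      D * (Λ n * (n : ℝ) ^ (1 - α)) * (θ * C₀ * (σ n / Real.sqrt n)) *
        (1 + |(r : ℝ)| / n) ^ (-(α - δ + (1 / 2 - δ))) := by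
    intro r
    have hρ0 : 0 < 1 + |(r : ℝ)| / n := by positivity
    refine (mul_le_mul (hDle n hn r) (hTle r) (hT0 _) (by positivity)).trans (le_of_eq ?_)
    rw [neg_add, Real.rpow_add hρ0]
    ring
  obtain ⟨h1, h2⟩ := hEle n hn _ _ (fun r => mul_nonneg (absWindow_nonneg a n r) (hT0 _)) hf
  refine ⟨h1, h2.trans (le_of_eq ?_)⟩
  have hs : (n : ℝ) = Real.sqrt n * Real.sqrt n := (Real.mul_self_sqrt hn0.le).symm
  have hs0 : 0 < Real.sqrt n := Real.sqrt_pos.2 hn0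
  unfold sumScale
  calc _ = E * D * C₀ * θ * (Λ n * (n : ℝ) ^ (1 - α)) * σ n * ((n : ℝ) / Real.sqrt n) := by ring
    _ = _ := by rw [Real.div_sqrt]; ring

/-- The variance of the increment over the window `(j, k]`. Its exponent `3 - 2α - 2δ` exceeds one,
as tightness requires. -/
theorem exists_tsum_sq_windowCoeff_le (hΛ : PotterRegular δ K Λ)
    (hσ : TruncationRegular δ C₀ η σ)
    (haK : ∀ i : ℕ, |a i| ≤ K * ((i : ℝ) + 1) ^ (-α) * Λ (i + 1))
    (hα1 : α + δ < 1) (hp : 1 < 2 * α - 4 * δ) :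
    ∃ C, 0 < C ∧ ∀ n : ℕ, 1 ≤ n → ∀ j k : ℕ, j ≤ k → k ≤ n →
      Summable (fun r : ℤ => windowCoeff a j k r ^ 2 * σ (n + r.natAbs) ^ 2) ∧
        ∑' r : ℤ, windowCoeff a j k r ^ 2 * σ (n + r.natAbs) ^ 2 ≤
          C * (((k : ℝ) - j) / n) ^ (3 - 2 * α - 2 * δ) * sumScale α Λ σ n ^ 2 := by
  have hδ := hΛ.exponent_pos
  obtain ⟨D, hD, hDle⟩ := exists_absWindow_le hΛ haK (by linarith) hα1
  obtain ⟨E, hE, hEle⟩ := exists_tsum_le_of_decay (p := 2 * α - 4 * δ) hp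
  have hC0 : 0 < C₀ := by linarith [hσ.one_le]
  have hK : 0 < K := by linarith [hΛ.one_le]
  refine ⟨E * (D ^ 2 * K ^ 2) * (C₀ * 2 ^ δ) ^ 2, by positivity, fun n hn j k hjk hkn => ?_⟩
  have hn0 : (0 : ℝ) < n := by exact_mod_cast hn
  have hΛn := hΛ.pos n
  have hσn := hσ.pos n hn
  rcases hjk.eq_or_lt with rfl | hlt
  · have e : ∀ r, windowCoeff a j j r = 0 := fun r => by simp [windowCoeff]
    simp only [e]
    rw [sub_self, zero_div, Real.zero_rpow (by linarith)]
    simp [summable_zero]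
  -- the window is compared at its own length `d`, centered at its left end
  obtain ⟨d, rfl⟩ := Nat.exists_eq_add_of_le hjk
  have hd : 1 ≤ d := by omega
  have hd0 : (0 : ℝ) < d := by exact_mod_cast hd
  have hdn : (d : ℝ) ≤ n := by exact_mod_cast (by omega : d ≤ n)
  have hjn : (j : ℝ) ≤ n := by exact_mod_cast (by omega : j ≤ n)
  have hΛd := hΛ.pos d
  have hΛdn := hΛ.le_mul' d n hd (by omega)
  have hshift : ∀ r : ℤ, windowCoeff a j (j + d) r = windowCoeff a 0 d (r - j) := fun r => by
    rw [windowCoeff_shift a hjk, Nat.add_sub_cancel_left]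
  have hgr : ∀ q : ℤ, σ (n + (q + j).natAbs) ≤
      C₀ * 2 ^ δ * σ n * (1 + |(q : ℝ)| / d) ^ δ := by
    intro q
    refine (hσ.growth n hn _).trans ?_
    have h1 : 1 + |((q + j : ℤ) : ℝ)| / n ≤ 2 * (1 + |(q : ℝ)| / d) := by
      have h2 : |((q + j : ℤ) : ℝ)| ≤ |(q : ℝ)| + j := by
        push_cast
        refine (abs_add_le _ _).trans ?_
        rw [abs_of_nonneg (Nat.cast_nonneg j : (0 : ℝ) ≤ j)]
      have h3 : |((q + j : ℤ) : ℝ)| / n ≤ |(q : ℝ)| / d + 1 := by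
        calc |((q + j : ℤ) : ℝ)| / n ≤ (|(q : ℝ)| + j) / n := by gcongr
          _ = |(q : ℝ)| / n + j / n := add_div _ _ _
          _ ≤ |(q : ℝ)| / d + 1 := by
            gcongr
            rw [div_le_one hn0]; exact hjn
      have : 0 ≤ |(q : ℝ)| / d := by positivity
      linarith
    calc C₀ * σ n * (1 + |((q + j : ℤ) : ℝ)| / n) ^ δ
        ≤ C₀ * σ n * (2 * (1 + |(q : ℝ)| / d)) ^ δ := by gcongr
      _ = _ := by rw [Real.mul_rpow zero_le_two (by positivity)]; ring
  have hf : ∀ q : ℤ, windowCoeff a 0 d q ^ 2 * σ (n + (q + j).natAbs) ^ 2 ≤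
      (D * (Λ d * (d : ℝ) ^ (1 - α)) * (C₀ * 2 ^ δ * σ n)) ^ 2 *
        (1 + |(q : ℝ)| / d) ^ (-(2 * α - 4 * δ)) := by
    intro q
    set ρ := 1 + |(q : ℝ)| / d with hρ
    have hρ0 : 0 < ρ := by positivity
    have h1 : |windowCoeff a 0 d q| ≤ D * (Λ d * (d : ℝ) ^ (1 - α)) * ρ ^ (-(α - δ)) :=
      (abs_windowCoeff_le_absWindow a le_rfl q).trans (hDle d hd q)
    have hσj := hσ.pos (n + (q + j).natAbs) (by omega)
    rw [← sq_abs, ← mul_pow]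
    calc (|windowCoeff a 0 d q| * σ (n + (q + j).natAbs)) ^ 2
        ≤ (D * (Λ d * (d : ℝ) ^ (1 - α)) * ρ ^ (-(α - δ)) * (C₀ * 2 ^ δ * σ n * ρ ^ δ)) ^ 2 := by
          gcongr
          exact hgr q
      _ = (D * (Λ d * (d : ℝ) ^ (1 - α)) * (C₀ * 2 ^ δ * σ n)) ^ 2 *
          (ρ ^ (-(α - δ)) * ρ ^ δ) ^ 2 := by ring
      _ = _ := by
          rw [← Real.rpow_add hρ0, ← Real.rpow_natCast (ρ ^ _), ← Real.rpow_mul hρ0.le]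
          congr 2
          push_cast; ring
  obtain ⟨h1, h2⟩ := hEle d hd _ _ (fun q => by positivity) hf
  have hcomp : (fun r : ℤ => windowCoeff a j (j + d) r ^ 2 * σ (n + r.natAbs) ^ 2) =
      (fun q : ℤ => windowCoeff a 0 d q ^ 2 * σ (n + (q + j).natAbs) ^ 2) ∘
        (Equiv.subRight (j : ℤ)) := by
    ext r
    simp [hshift]
  rw [hcomp]
  refine ⟨(Equiv.summable_iff _).2 h1, ?_⟩
  have htsum := (Equiv.subRight (j : ℤ)).tsum_eq
    (fun q : ℤ => windowCoeff a 0 d q ^ 2 * σ (n + (q + j).natAbs) ^ 2)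
  refine htsum.trans_le (h2.trans ?_)
  push_cast
  rw [add_sub_cancel_left]
  have hs : Real.sqrt n ^ 2 = n := Real.sq_sqrt hn0.le
  calc E * (D * (Λ d * (d : ℝ) ^ (1 - α)) * (C₀ * 2 ^ δ * σ n)) ^ 2 * d
      ≤ E * (D * (K * ((n : ℝ) / d) ^ δ * Λ n * (d : ℝ) ^ (1 - α)) * (C₀ * 2 ^ δ * σ n)) ^ 2 * d := by
        gcongr
    _ = E * (D ^ 2 * K ^ 2) * (C₀ * 2 ^ δ) ^ 2 * Λ n ^ 2 * σ n ^ 2 *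
        ((((n : ℝ) / d) ^ δ * (d : ℝ) ^ (1 - α)) ^ 2 * d) := by ring
    _ = E * (D ^ 2 * K ^ 2) * (C₀ * 2 ^ δ) ^ 2 * Λ n ^ 2 * σ n ^ 2 *
        (((d : ℝ) / n) ^ (3 - 2 * α - 2 * δ) * ((n : ℝ) ^ (1 - α)) ^ 2 * n) := by
        congr 1
        -- everything is expressed through the relative window length `d / n`
        have ed : (d : ℝ) = (d : ℝ) / n * n := by field_simp
        have ex : 0 < (d : ℝ) / n := by positivity
        have e1 : (n : ℝ) / d = ((d : ℝ) / n)⁻¹ := by rw [inv_div]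
        have e2 : (d : ℝ) ^ (1 - α) = ((d : ℝ) / n) ^ (1 - α) * (n : ℝ) ^ (1 - α) := by
          rw [← Real.mul_rpow ex.le hn0.le, ← ed]
        set x := (d : ℝ) / n with hx
        rw [e1, e2, Real.inv_rpow ex.le, ← Real.rpow_neg ex.le,
          show (3 - 2 * α - 2 * δ) = (-δ) + (-δ) + (1 - α) + (1 - α) + 1 by ring,
          Real.rpow_add ex, Real.rpow_add ex, Real.rpow_add ex, Real.rpow_add ex, Real.rpow_one]
        conv_lhs => rw [ed]
        ring
    _ = _ := by
        unfold sumScale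
        rw [mul_pow, mul_pow, mul_pow (Real.sqrt n), hs]; ring

/-- A Lyapunov sum: without the small factor that the truncated third moments provide, the third
moments are of the order of the cube of the scale. -/
theorem exists_tsum_absWindow_cube_le (hΛ : PotterRegular δ K Λ)
    (hσ : TruncationRegular δ C₀ η σ)
    (haK : ∀ i : ℕ, |a i| ≤ K * ((i : ℝ) + 1) ^ (-α) * Λ (i + 1))
    (hα1 : α + δ < 1) (hp : 1 < 2 * α - 4 * δ) :
    ∃ C, 0 < C ∧ ∀ n : ℕ, 1 ≤ n →
      Summable (fun r : ℤ => absWindow a n r ^ 3 * (η (n + r.natAbs) * σ (n + r.natAbs) ^ 2)) ∧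
        ∑' r : ℤ, absWindow a n r ^ 3 * (η (n + r.natAbs) * σ (n + r.natAbs) ^ 2) ≤
          C * sumScale α Λ σ n ^ 3 := by
  have hδ := hΛ.exponent_pos
  obtain ⟨D, hD, hDle⟩ := exists_absWindow_le hΛ haK (by linarith) hα1
  obtain ⟨E, hE, hEle⟩ := exists_tsum_le_of_decay (p := 3 * (α - δ) - 1 / 2 - 3 * δ) (by linarith)
  have hC0 : 0 < C₀ := by linarith [hσ.one_le]
  refine ⟨E * D ^ 3 * C₀ ^ 4, by positivity, fun n hn => ?_⟩
  have hn0 : (0 : ℝ) < n := by exact_mod_cast hn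
  have hΛn := hΛ.pos n
  have hσn := hσ.pos n hn
  have hη0 : ∀ r : ℤ, 0 ≤ η (n + r.natAbs) := fun r => by
    have hσj := hσ.pos (n + r.natAbs) (by omega)
    exact le_trans (by positivity) (hσ.level_ge (n + r.natAbs) (by omega))
  have hf : ∀ r : ℤ, absWindow a n r ^ 3 * (η (n + r.natAbs) * σ (n + r.natAbs) ^ 2) ≤
      (D * (Λ n * (n : ℝ) ^ (1 - α))) ^ 3 * (C₀ ^ 4 * Real.sqrt n * σ n ^ 3) *
        (1 + |(r : ℝ)| / n) ^ (-(3 * (α - δ) - 1 / 2 - 3 * δ)) := by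
    intro r
    have hw := hDle n hn r
    have h3 := hσ.growth n hn r
    have h2 := hσ.level_le (n + r.natAbs) (by omega)
    have hσj := hσ.pos (n + r.natAbs) (by omega)
    rw [natCast_add_natAbs hn, Real.sqrt_mul hn0.le] at h2
    set ρ := 1 + |(r : ℝ)| / n with hρ
    have hρ0 : 0 < ρ := by positivity
    have hw0 := absWindow_nonneg a n r
    have h4 : η (n + r.natAbs) * σ (n + r.natAbs) ^ 2 ≤
        C₀ * (Real.sqrt n * Real.sqrt ρ * (C₀ * σ n * ρ ^ δ)) * (C₀ * σ n * ρ ^ δ) ^ 2 := by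
      refine mul_le_mul (h2.trans (by gcongr)) (by gcongr) (by positivity) (by positivity)
    calc _ ≤ (D * (Λ n * (n : ℝ) ^ (1 - α)) * ρ ^ (-(α - δ))) ^ 3 *
          (C₀ * (Real.sqrt n * Real.sqrt ρ * (C₀ * σ n * ρ ^ δ)) * (C₀ * σ n * ρ ^ δ) ^ 2) :=
          mul_le_mul (by gcongr) h4 (mul_nonneg (hη0 r) (by positivity)) (by positivity)
      _ = (D * (Λ n * (n : ℝ) ^ (1 - α))) ^ 3 * (C₀ ^ 4 * Real.sqrt n * σ n ^ 3) *
          ((ρ ^ (-(α - δ))) ^ 3 * ρ ^ (1 / 2 : ℝ) * (ρ ^ δ) ^ 3) := by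
          rw [Real.sqrt_eq_rpow ρ]; ring
      _ = _ := by
          rw [← Real.rpow_natCast (ρ ^ (-(α - δ))), ← Real.rpow_natCast (ρ ^ δ),
            ← Real.rpow_mul hρ0.le, ← Real.rpow_mul hρ0.le, ← Real.rpow_add hρ0,
            ← Real.rpow_add hρ0]
          congr 2
          push_cast; ring
  obtain ⟨h1, h2⟩ := hEle n hn _ _ (fun r => by
    have := absWindow_nonneg a n r
    have := hη0 r
    positivity) hf
  refine ⟨h1, h2.trans (le_of_eq ?_)⟩
  have hs : Real.sqrt n ^ 2 = n := Real.sq_sqrt hn0.le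
  unfold sumScale
  calc _ = E * D ^ 3 * C₀ ^ 4 * (Λ n * (n : ℝ) ^ (1 - α)) ^ 3 * σ n ^ 3 * (Real.sqrt n * n) := by
        ring
    _ = E * D ^ 3 * C₀ ^ 4 * (Λ n * (n : ℝ) ^ (1 - α)) ^ 3 * σ n ^ 3 * Real.sqrt n ^ 3 := by
        rw [pow_succ (Real.sqrt n), hs, mul_comm (n : ℝ)]
    _ = _ := by ring

/-- The squared variances of the terms are negligible against the squared total variance. -/
theorem exists_tsum_absWindow_fourth_le (hΛ : PotterRegular δ K Λ)
    (hσ : TruncationRegular δ C₀ η σ)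
    (haK : ∀ i : ℕ, |a i| ≤ K * ((i : ℝ) + 1) ^ (-α) * Λ (i + 1))
    (hα1 : α + δ < 1) (hp : 1 < 2 * α - 4 * δ) :
    ∃ C, 0 < C ∧ ∀ n : ℕ, 1 ≤ n →
      Summable (fun r : ℤ => absWindow a n r ^ 4 * σ (n + r.natAbs) ^ 4) ∧
        ∑' r : ℤ, absWindow a n r ^ 4 * σ (n + r.natAbs) ^ 4 ≤
          C / n * sumScale α Λ σ n ^ 4 := by
  have hδ := hΛ.exponent_pos
  obtain ⟨D, hD, hDle⟩ := exists_absWindow_le hΛ haK (by linarith) hα1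
  obtain ⟨E, hE, hEle⟩ := exists_tsum_le_of_decay (p := 4 * (α - 2 * δ)) (by linarith)
  have hC0 : 0 < C₀ := by linarith [hσ.one_le]
  refine ⟨E * (D * C₀) ^ 4, by positivity, fun n hn => ?_⟩
  have hn0 : (0 : ℝ) < n := by exact_mod_cast hn
  have hΛn := hΛ.pos n
  have hσn := hσ.pos n hn
  have hf : ∀ r : ℤ, absWindow a n r ^ 4 * σ (n + r.natAbs) ^ 4 ≤
      (D * (Λ n * (n : ℝ) ^ (1 - α)) * (C₀ * σ n)) ^ 4 *
        (1 + |(r : ℝ)| / n) ^ (-(4 * (α - 2 * δ))) := by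
    intro r
    have hw := hDle n hn r
    have h3 := hσ.growth n hn r
    have hσj := hσ.pos (n + r.natAbs) (by omega)
    have hw0 := absWindow_nonneg a n r
    set ρ := 1 + |(r : ℝ)| / n with hρ
    have hρ0 : 0 < ρ := by positivity
    calc _ ≤ (D * (Λ n * (n : ℝ) ^ (1 - α)) * ρ ^ (-(α - δ))) ^ 4 * (C₀ * σ n * ρ ^ δ) ^ 4 := by
          gcongr
      _ = (D * (Λ n * (n : ℝ) ^ (1 - α)) * (C₀ * σ n)) ^ 4 * (ρ ^ (-(α - δ)) * ρ ^ δ) ^ 4 := by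
          ring
      _ = _ := by
          rw [← Real.rpow_add hρ0, ← Real.rpow_natCast (ρ ^ _), ← Real.rpow_mul hρ0.le]
          congr 2
          push_cast; ring
  obtain ⟨h1, h2⟩ := hEle n hn _ _ (fun r => by
    have := absWindow_nonneg a n r
    positivity) hf
  refine ⟨h1, h2.trans (le_of_eq ?_)⟩
  have hs : Real.sqrt n ^ 4 = (n : ℝ) ^ 2 := by
    rw [show (4 : ℕ) = 2 * 2 by norm_num, pow_mul, Real.sq_sqrt hn0.le]
  unfold sumScale
  rw [mul_pow (Λ n * _), mul_pow (Real.sqrt n), hs]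
  field_simp

end Weighted

/-! ### Truncation and centering of an innovation -/

section Truncation

variable {ν : Measure ℝ}

/-- The value `y`, replaced by zero outside `[-x, x]`, minus the mean of the truncation under `ν`. -/
noncomputable def centeredCut (ν : Measure ℝ) (x y : ℝ) : ℝ :=
  {z : ℝ | |z| ≤ x}.indicator (fun z => z) y - ∫ z in {z : ℝ | |z| ≤ x}, z ∂ν

theorem measurable_cut (x : ℝ) : Measurable ({z : ℝ | |z| ≤ x}.indicator fun z => z) :=
  measurable_id.indicator (measurableSet_abs_le x)

theorem measurable_centeredCut (ν : Measure ℝ) (x : ℝ) : Measurable (centeredCut ν x) :=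
  (measurable_cut x).sub_const _

theorem abs_cut_le {x : ℝ} (hx : 0 ≤ x) (y : ℝ) :
    |{z : ℝ | |z| ≤ x}.indicator (fun z => z) y| ≤ x := by
  by_cases h : |y| ≤ x
  · rw [indicator_of_mem (show y ∈ {z : ℝ | |z| ≤ x} from h)]; exact h
  · rw [indicator_of_notMem (show y ∉ {z : ℝ | |z| ≤ x} from h)]; simpa using hx

theorem integral_cut (x : ℝ) : ∫ y, {z : ℝ | |z| ≤ x}.indicator (fun z => z) y ∂ν =
    ∫ z in {z : ℝ | |z| ≤ x}, z ∂ν :=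
  integral_indicator (measurableSet_abs_le x)

/-- The mean of the truncation is minus the mean of the removed part, for a centered law. -/
theorem abs_mean_cut_le_tail (hint : Integrable (fun y : ℝ => y) ν) (h0 : ∫ y, y ∂ν = 0) (x : ℝ) :
    |∫ z in {z : ℝ | |z| ≤ x}, z ∂ν| ≤ lawTailMoment ν x := by
  have h1 := integral_add_compl (measurableSet_abs_le x) hint
  have hc : {z : ℝ | |z| ≤ x}ᶜ = {z : ℝ | x < |z|} := by ext; simp
  rw [h0, hc] at h1
  rw [eq_neg_of_add_eq_zero_left h1, abs_neg]
  exact abs_integral_le_integral_abs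

variable [IsProbabilityMeasure ν]

theorem integrable_of_abs_le {f : ℝ → ℝ} (hf : Measurable f) {M : ℝ} (hM : ∀ y, |f y| ≤ M) :
    Integrable f ν :=
  Integrable.of_bound hf.aestronglyMeasurable M (Eventually.of_forall hM)

theorem abs_mean_cut_le {x : ℝ} (hx : 0 ≤ x) : |∫ z in {z : ℝ | |z| ≤ x}, z ∂ν| ≤ x := by
  rw [← integral_cut, ← Real.norm_eq_abs]
  refine (norm_integral_le_of_norm_le_const (C := x) (Eventually.of_forall (abs_cut_le hx))).trans ?_
  simp

theorem abs_centeredCut_le {x : ℝ} (hx : 0 ≤ x) (y : ℝ) : |centeredCut ν x y| ≤ 2 * x := by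
  refine (abs_sub _ _).trans ?_
  linarith [abs_cut_le hx y, abs_mean_cut_le (ν := ν) hx]

theorem integral_centeredCut {x : ℝ} (hx : 0 ≤ x) : ∫ y, centeredCut ν x y ∂ν = 0 := by
  unfold centeredCut
  rw [integral_sub (integrable_of_abs_le (measurable_cut x) (abs_cut_le hx))
    (integrable_const _), integral_cut]
  simp

theorem integral_sq_centeredCut {x : ℝ} (hx : 0 ≤ x) : ∫ y, centeredCut ν x y ^ 2 ∂ν =
    lawTruncSecondMoment ν x - (∫ z in {z : ℝ | |z| ≤ x}, z ∂ν) ^ 2 := by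
  set m := ∫ z in {z : ℝ | |z| ≤ x}, z ∂ν with hm
  have e : ∀ y, centeredCut ν x y ^ 2 = {z : ℝ | |z| ≤ x}.indicator (fun z => z ^ 2) y -
      2 * m * {z : ℝ | |z| ≤ x}.indicator (fun z => z) y + m ^ 2 := by
    intro y
    rw [centeredCut, ← hm]
    by_cases h : y ∈ {z : ℝ | |z| ≤ x}
    · rw [indicator_of_mem h, indicator_of_mem h]; ring
    · rw [indicator_of_notMem h, indicator_of_notMem h]; ring
  have h1 : Integrable ({z : ℝ | |z| ≤ x}.indicator fun z => z ^ 2) ν :=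
    (integrable_indicator_iff (measurableSet_abs_le x)).2 (integrableOn_sq_abs_le x)
  have h2 : Integrable (fun y => 2 * m * {z : ℝ | |z| ≤ x}.indicator (fun z => z) y) ν :=
    (integrable_of_abs_le (measurable_cut x) (abs_cut_le hx)).const_mul _
  have h12 : Integrable (fun y => {z : ℝ | |z| ≤ x}.indicator (fun z => z ^ 2) y -
      2 * m * {z : ℝ | |z| ≤ x}.indicator (fun z => z) y) ν := h1.sub h2
  simp_rw [e]
  rw [integral_add h12 (integrable_const _), integral_sub h1 h2,
    integral_indicator (measurableSet_abs_le x), integral_const_mul, integral_cut, ← hm,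
    lawTruncSecondMoment]
  simp
  ring

theorem integral_abs_cube_centeredCut_le (hint : Integrable (fun y : ℝ => y) ν)
    (h0 : ∫ y, y ∂ν = 0) {x : ℝ} (hx : 0 ≤ x) : ∫ y, |centeredCut ν x y| ^ 3 ∂ν ≤
      4 * (lawTruncThirdMoment ν x + x * (x * lawTailMoment ν x)) := by
  set m := ∫ z in {z : ℝ | |z| ≤ x}, z ∂ν with hm
  have h1 : Integrable ({z : ℝ | |z| ≤ x}.indicator fun z => |z| ^ 3) ν :=
    (integrable_indicator_iff (measurableSet_abs_le x)).2 (integrableOn_pow_abs_le 3 x)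
  have hle : ∀ y, |centeredCut ν x y| ^ 3 ≤
      4 * ({z : ℝ | |z| ≤ x}.indicator (fun z => |z| ^ 3) y + |m| ^ 3) := by
    intro y
    -- convexity of the cube
    have h3 : ∀ p q : ℝ, 0 ≤ p → 0 ≤ q → (p + q) ^ 3 ≤ 4 * (p ^ 3 + q ^ 3) := fun p q hp hq => by
      nlinarith [mul_nonneg (add_nonneg hp hq) (sq_nonneg (p - q))]
    have h4 : {z : ℝ | |z| ≤ x}.indicator (fun z => |z| ^ 3) y =
        |{z : ℝ | |z| ≤ x}.indicator (fun z => z) y| ^ 3 := by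
      by_cases h : y ∈ {z : ℝ | |z| ≤ x}
      · rw [indicator_of_mem h, indicator_of_mem h]
      · rw [indicator_of_notMem h, indicator_of_notMem h]; simp
    rw [h4]
    refine le_trans ?_ (h3 _ _ (abs_nonneg _) (abs_nonneg _))
    gcongr
    exact abs_sub _ _
  have h5 : Integrable (fun y => 4 * ({z : ℝ | |z| ≤ x}.indicator (fun z => |z| ^ 3) y + |m| ^ 3))
      ν := (h1.add (integrable_const _)).const_mul _
  refine (integral_mono_of_nonneg (Eventually.of_forall fun y => by positivity) h5
    (Eventually.of_forall hle)).trans ?_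
  rw [integral_const_mul, integral_add h1 (integrable_const _),
    integral_indicator (measurableSet_abs_le x)]
  have hm1 := abs_mean_cut_le (ν := ν) hx
  have hm2 := abs_mean_cut_le_tail hint h0 x
  rw [← hm] at hm1 hm2
  have h6 : |m| ^ 3 ≤ x * (x * lawTailMoment ν x) := by
    calc |m| ^ 3 = |m| * (|m| * |m|) := by ring
      _ ≤ x * (x * lawTailMoment ν x) := by gcongr
  simp only [integral_const, probReal_univ, one_smul]
  have h7 : lawTruncThirdMoment ν x = ∫ y in {z : ℝ | |z| ≤ x}, |y| ^ 3 ∂ν := rfl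
  linarith

theorem integral_abs_sub_centeredCut_le (hint : Integrable (fun y : ℝ => y) ν)
    (h0 : ∫ y, y ∂ν = 0) (x : ℝ) :
    ∫ y, |y - centeredCut ν x y| ∂ν ≤ 2 * lawTailMoment ν x := by
  set m := ∫ z in {z : ℝ | |z| ≤ x}, z ∂ν with hm
  have h1 : Integrable ({z : ℝ | x < |z|}.indicator fun z => |z|) ν :=
    hint.abs.indicator (measurableSet_lt_abs x)
  have hle : ∀ y, |y - centeredCut ν x y| ≤ {z : ℝ | x < |z|}.indicator (fun z => |z|) y + |m| := by
    intro y
    rw [centeredCut, ← hm]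
    by_cases h : |y| ≤ x
    · rw [indicator_of_mem (show y ∈ {z : ℝ | |z| ≤ x} from h),
        indicator_of_notMem (show y ∉ {z : ℝ | x < |z|} from not_lt.2 h)]
      simp
    · rw [indicator_of_notMem (show y ∉ {z : ℝ | |z| ≤ x} from h),
        indicator_of_mem (show y ∈ {z : ℝ | x < |z|} from not_le.1 h)]
      simpa using abs_add_le y m
  refine (integral_mono_of_nonneg (Eventually.of_forall fun y => abs_nonneg _)
    (h1.add (integrable_const _)) (Eventually.of_forall hle)).trans ?_
  rw [integral_add' h1 (integrable_const _), integral_indicator (measurableSet_lt_abs x)]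
  have hm2 := abs_mean_cut_le_tail hint h0 x
  rw [← hm] at hm2
  simp only [integral_const, probReal_univ, one_smul]
  have h7 : lawTailMoment ν x = ∫ y in {z : ℝ | x < |z|}, |y| ∂ν := rfl
  linarith

end Truncation

/-! ### Sums of independent centered variables -/

theorem norm_exp_mul_I_sub_le (x : ℝ) :
    ‖Complex.exp (x * Complex.I) - (1 + x * Complex.I - (x : ℂ) ^ 2 / 2)‖ ≤ 4 * |x| ^ 3 := by
  rcases le_total |x| 1 with h | h
  · have hn : ‖(x : ℂ) * Complex.I‖ = |x| := by simp
    have h1 := Complex.exp_bound (x := (x : ℂ) * Complex.I) (by rw [hn]; exact h)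
      (n := 3) (by norm_num)
    rw [hn] at h1
    have e : ∑ m ∈ Finset.range 3, ((x : ℂ) * Complex.I) ^ m / (m.factorial : ℂ) =
        1 + x * Complex.I - (x : ℂ) ^ 2 / 2 := by
      simp [Finset.sum_range_succ, Nat.factorial, mul_pow]
      ring
    rw [e] at h1
    refine h1.trans ?_
    have h2 : ((Nat.succ 3 : ℕ) : ℝ) * (((3 : ℕ).factorial : ℝ) * ((3 : ℕ) : ℝ))⁻¹ ≤ 4 := by
      norm_num [Nat.factorial]
    nlinarith [pow_nonneg (abs_nonneg x) 3]
  -- for `1 ≤ |x|` each term is at most `|x| ^ 3`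
  · have h1 : ‖Complex.exp (x * Complex.I) - (1 + x * Complex.I - (x : ℂ) ^ 2 / 2)‖ ≤
        1 + (1 + |x| + |x| ^ 2 / 2) := by
      refine (norm_sub_le _ _).trans (add_le_add (Complex.norm_exp_ofReal_mul_I x).le ?_)
      refine (norm_sub_le _ _).trans (add_le_add ((norm_add_le _ _).trans ?_) ?_)
      · simp
      · simp
    refine h1.trans ?_
    have h2 : |x| ≤ |x| ^ 3 := le_self_pow₀ h (by norm_num)
    have h3 : |x| ^ 2 ≤ |x| ^ 3 := pow_le_pow_right₀ h (by norm_num)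
    have h4 : 1 ≤ |x| ^ 3 := one_le_pow₀ h
    linarith

theorem abs_exp_neg_sub_le {y : ℝ} (hy : 0 ≤ y) : |Real.exp (-y) - (1 - y)| ≤ y ^ 2 := by
  rcases le_total y 1 with h | h
  · have := Real.abs_exp_sub_one_sub_id_le (x := -y) (by rw [abs_neg, abs_of_nonneg hy]; exact h)
    rw [neg_sq] at this
    convert this using 2
    ring
  · have h1 := Real.exp_pos (-y)
    have h2 : Real.exp (-y) ≤ 1 := Real.exp_le_one_iff.2 (by linarith)
    rw [abs_of_nonneg (by linarith)]
    nlinarith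

/-- Telescoping of a difference of products of numbers in the unit disc. -/
theorem norm_prod_sub_prod_le {ι : Type*} (s : Finset ι) {f g : ι → ℂ} (hf : ∀ i ∈ s, ‖f i‖ ≤ 1)
    (hg : ∀ i ∈ s, ‖g i‖ ≤ 1) :
    ‖∏ i ∈ s, f i - ∏ i ∈ s, g i‖ ≤ ∑ i ∈ s, ‖f i - g i‖ := by
  classical
  induction s using Finset.induction_on with
  | empty => simp
  | insert i s hi ih =>
    rw [Finset.prod_insert hi, Finset.prod_insert hi, Finset.sum_insert hi]
    have h1 : ‖∏ j ∈ s, f j‖ ≤ 1 := by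
      rw [norm_prod]
      exact Finset.prod_le_one (fun _ _ => norm_nonneg _)
        fun j hj => hf j (Finset.mem_insert_of_mem hj)
    have h2 := ih (fun j hj => hf j (Finset.mem_insert_of_mem hj))
      (fun j hj => hg j (Finset.mem_insert_of_mem hj))
    have h3 := hg i (Finset.mem_insert_self i s)
    calc _ = ‖(f i - g i) * ∏ j ∈ s, f j + g i * (∏ j ∈ s, f j - ∏ j ∈ s, g j)‖ := by
          congr 1; ring
      _ ≤ ‖f i - g i‖ * 1 + 1 * ‖∏ j ∈ s, f j - ∏ j ∈ s, g j‖ := by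
          refine (norm_add_le _ _).trans ?_
          rw [norm_mul, norm_mul]
          gcongr
      _ ≤ _ := by linarith

section Independent

variable {Ω : Type*} [MeasurableSpace Ω] {P : Measure Ω} [IsProbabilityMeasure P]

theorem integrable_of_bounded {f : Ω → ℝ} (hf : AEMeasurable f P) {M : ℝ} (hM : ∀ ω, |f ω| ≤ M) :
    Integrable f P :=
  Integrable.of_bound hf.aestronglyMeasurable M (Eventually.of_forall hM)

theorem memLp_of_bounded {f : Ω → ℝ} (hf : AEMeasurable f P) {M : ℝ} (hM : ∀ ω, |f ω| ≤ M) :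
    MemLp f 2 P :=
  MemLp.of_bound hf.aestronglyMeasurable M (Eventually.of_forall hM)

/-- The second order expansion of the characteristic function of a centered variable, compared with
the Gaussian one. -/
theorem norm_integral_exp_sub_le {f : Ω → ℝ} (hf : AEMeasurable f P) {M : ℝ}
    (hM : ∀ ω, |f ω| ≤ M) (h0 : ∫ ω, f ω ∂P = 0) :
    ‖∫ ω, Complex.exp (f ω * Complex.I) ∂P - Complex.exp (-((∫ ω, f ω ^ 2 ∂P : ℝ) : ℂ) / 2)‖ ≤
      4 * ∫ ω, |f ω| ^ 3 ∂P + (∫ ω, f ω ^ 2 ∂P) ^ 2 := by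
  set v := ∫ ω, f ω ^ 2 ∂P with hv
  have hv0 : 0 ≤ v := integral_nonneg fun ω => sq_nonneg _
  have hi1 := integrable_of_bounded hf hM
  have hi2 : Integrable (fun ω => f ω ^ 2) P :=
    integrable_of_bounded (hf.pow_const 2) (M := M ^ 2) fun ω => by
      rw [abs_pow]; exact pow_le_pow_left₀ (abs_nonneg _) (hM ω) 2
  have hi3 : Integrable (fun ω => |f ω| ^ 3) P :=
    integrable_of_bounded (hf.abs.pow_const 3) (M := M ^ 3) fun ω => by
      rw [abs_pow, abs_abs]; exact pow_le_pow_left₀ (abs_nonneg _) (hM ω) 3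
  have hie : Integrable (fun ω => Complex.exp (f ω * Complex.I)) P := by
    refine Integrable.of_bound (C := 1) ?_ (Eventually.of_forall fun ω => ?_)
    · exact (by fun_prop : AEMeasurable (fun ω => Complex.exp (f ω * Complex.I)) P).aestronglyMeasurable
    · exact (Complex.norm_exp_ofReal_mul_I _).le
  have hiq : Integrable (fun ω => 1 + (f ω : ℂ) * Complex.I - (f ω : ℂ) ^ 2 / 2) P := by
    refine ((integrable_const _).add (hi1.ofReal.mul_const _)).sub ?_
    have := hi2.ofReal (𝕜 := ℂ)
    simpa using this.div_const 2
  have hq : ∫ ω, (1 + (f ω : ℂ) * Complex.I - (f ω : ℂ) ^ 2 / 2) ∂P = 1 - (v : ℂ) / 2 := by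
    have h2' : Integrable (fun ω => (f ω : ℂ) ^ 2 / 2) P := by
      have := hi2.ofReal (𝕜 := ℂ)
      simpa using this.div_const 2
    have h1' : Integrable (fun ω => (f ω : ℂ) * Complex.I) P := hi1.ofReal.mul_const _
    have e2 : ∫ ω, (f ω : ℂ) ^ 2 ∂P = (v : ℂ) := by
      simp_rw [hv, ← Complex.ofReal_pow]
      exact integral_ofReal
    have h3' : Integrable (fun ω => 1 + (f ω : ℂ) * Complex.I) P := (integrable_const _).add h1'
    rw [integral_sub h3' h2', integral_add (integrable_const _) h1',
      integral_mul_const, show ∫ ω, (f ω : ℂ) ∂P = ((∫ ω, f ω ∂P : ℝ) : ℂ) from integral_ofReal,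
      h0, integral_div, e2]
    simp
  have h1 : ‖∫ ω, Complex.exp (f ω * Complex.I) ∂P - (1 - (v : ℂ) / 2)‖ ≤ 4 * ∫ ω, |f ω| ^ 3 ∂P := by
    rw [← hq, ← integral_sub hie hiq, ← integral_const_mul]
    refine norm_integral_le_of_norm_le (hi3.const_mul 4) (Eventually.of_forall fun ω => ?_)
    exact norm_exp_mul_I_sub_le (f ω)
  have h2 : ‖(1 - (v : ℂ) / 2) - Complex.exp (-(v : ℂ) / 2)‖ ≤ v ^ 2 := by
    have e : (1 - (v : ℂ) / 2) - Complex.exp (-(v : ℂ) / 2) =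
        ((-(Real.exp (-(v / 2)) - (1 - v / 2)) : ℝ) : ℂ) := by
      push_cast
      rw [neg_div]; ring
    rw [e, Complex.norm_real, Real.norm_eq_abs, abs_neg]
    refine (abs_exp_neg_sub_le (by linarith)).trans ?_
    nlinarith [sq_nonneg v]
  calc _ = ‖(∫ ω, Complex.exp (f ω * Complex.I) ∂P - (1 - (v : ℂ) / 2)) +
        ((1 - (v : ℂ) / 2) - Complex.exp (-(v : ℂ) / 2))‖ := by congr 1; ring
    _ ≤ _ := (norm_add_le _ _).trans (add_le_add h1 h2)

variable {ι : Type*} {X : ι → Ω → ℝ}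

theorem integral_sq_sum (hind : iIndepFun X P) (hX : ∀ i, AEMeasurable (X i) P)
    (hb : ∀ i, ∃ M, ∀ ω, |X i ω| ≤ M) (h0 : ∀ i, ∫ ω, X i ω ∂P = 0) (s : Finset ι) :
    ∫ ω, (∑ i ∈ s, X i ω) ^ 2 ∂P = ∑ i ∈ s, ∫ ω, X i ω ^ 2 ∂P := by
  have hL : ∀ i, MemLp (X i) 2 P := fun i => memLp_of_bounded (hX i) (hb i).choose_spec
  have h1 := IndepFun.variance_sum (s := s) (fun i _ => hL i)
    fun i _ j _ hij => hind.indepFun hij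
  have h2 : ∫ ω, (∑ i ∈ s, X i) ω ∂P = 0 := by
    simp only [Finset.sum_apply]
    rw [integral_finsetSum _ fun i _ => (hL i).integrable (by norm_num)]
    exact Finset.sum_eq_zero fun i _ => h0 i
  rw [variance_of_integral_eq_zero (Finset.aemeasurable_sum _ fun i _ => hX i) h2] at h1
  simp only [Finset.sum_apply] at h1
  rw [h1]
  exact Finset.sum_congr rfl fun i _ => variance_of_integral_eq_zero (hX i) (h0 i)

/-- Lindeberg's comparison: the characteristic function of a sum of independent centered variables
against the Gaussian one with the same variance. -/
theorem norm_charFun_sum_sub_le (hind : iIndepFun X P) (hX : ∀ i, AEMeasurable (X i) P)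
    (hb : ∀ i, ∃ M, ∀ ω, |X i ω| ≤ M) (h0 : ∀ i, ∫ ω, X i ω ∂P = 0) (s : Finset ι) :
    ‖∫ ω, Complex.exp ((∑ i ∈ s, X i ω : ℝ) * Complex.I) ∂P -
      Complex.exp (-((∑ i ∈ s, ∫ ω, X i ω ^ 2 ∂P : ℝ) : ℂ) / 2)‖ ≤
      ∑ i ∈ s, (4 * ∫ ω, |X i ω| ^ 3 ∂P + (∫ ω, X i ω ^ 2 ∂P) ^ 2) := by
  have hchar : ∀ {f : Ω → ℝ}, AEMeasurable f P →
      charFun (P.map f) 1 = ∫ ω, Complex.exp (f ω * Complex.I) ∂P := by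
    intro f hf
    rw [charFun_apply_real, integral_map hf (by fun_prop)]
    simp
  have h1 := congrFun (iIndepFun.charFun_map_fun_finsetSum_eq_prod (fun i _ => hX i)
    (hind.restrict s)) 1
  rw [hchar (Finset.aemeasurable_fun_sum _ fun i _ => hX i), Finset.prod_apply] at h1
  simp_rw [hchar (hX _)] at h1
  have h2 : Complex.exp (-((∑ i ∈ s, ∫ ω, X i ω ^ 2 ∂P : ℝ) : ℂ) / 2) =
      ∏ i ∈ s, Complex.exp (-((∫ ω, X i ω ^ 2 ∂P : ℝ) : ℂ) / 2) := by
    rw [← Complex.exp_sum, Complex.ofReal_sum, ← Finset.sum_neg_distrib, Finset.sum_div]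
  rw [h1, h2]
  refine (norm_prod_sub_prod_le s (fun i _ => ?_) fun i _ => ?_).trans
    (Finset.sum_le_sum fun i _ => ?_)
  · refine (norm_integral_le_of_norm_le_const (C := 1) (Eventually.of_forall fun ω =>
      (Complex.norm_exp_ofReal_mul_I _).le)).trans ?_
    simp
  · have : 0 ≤ ∫ ω, X i ω ^ 2 ∂P := integral_nonneg fun ω => sq_nonneg _
    rw [show -((∫ ω, X i ω ^ 2 ∂P : ℝ) : ℂ) / 2 = ((-(∫ ω, X i ω ^ 2 ∂P) / 2 : ℝ) : ℂ) by
      push_cast; ring, ← Complex.ofReal_exp, Complex.norm_real, Real.norm_eq_abs,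
      abs_of_pos (Real.exp_pos _), Real.exp_le_one_iff]
    linarith
  · exact norm_integral_exp_sub_le (hX i) (hb i).choose_spec (h0 i)

end Independent

/-! ### Random series of independent centered variables -/

section Series

variable {Ω : Type*} [MeasurableSpace Ω] {P : Measure Ω}

/-- A series whose terms have summable first absolute moments converges absolutely almost surely. -/
theorem ae_summable_of_summable_integral {ι : Type*} [Countable ι] {Z : ι → Ω → ℝ}
    (hZ : ∀ i, AEMeasurable (Z i) P) {b : ι → ℝ} (hbs : Summable b)
    (hle : ∀ i, ∫⁻ ω, ENNReal.ofReal |Z i ω| ∂P ≤ ENNReal.ofReal (b i)) (hb0 : ∀ i, 0 ≤ b i) :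
    (∀ᵐ ω ∂P, Summable fun i => |Z i ω|) ∧
      ∫⁻ ω, ∑' i, ENNReal.ofReal |Z i ω| ∂P ≤ ENNReal.ofReal (∑' i, b i) := by
  have hm : ∀ i, AEMeasurable (fun ω => ENNReal.ofReal |Z i ω|) P := fun i =>
    (hZ i).abs.ennreal_ofReal
  have h1 : ∫⁻ ω, ∑' i, ENNReal.ofReal |Z i ω| ∂P ≤ ENNReal.ofReal (∑' i, b i) := by
    rw [lintegral_tsum hm, ENNReal.ofReal_tsum_of_nonneg hb0 hbs]
    exact ENNReal.tsum_le_tsum hle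
  refine ⟨?_, h1⟩
  have h2 := ae_lt_top' (AEMeasurable.tsum hm) (h1.trans_lt ENNReal.ofReal_lt_top).ne
  filter_upwards [h2] with ω hω
  have := ENNReal.summable_toReal hω.ne
  simpa [ENNReal.toReal_ofReal] using this

variable [IsProbabilityMeasure P]

/-- The partial sums form a martingale that is bounded in `L²`, hence in `L¹`. -/
theorem ae_exists_tendsto_sum_of_stronglyMeasurable {X : ℕ → Ω → ℝ} (hind : iIndepFun X P)
    (hX : ∀ i, StronglyMeasurable (X i)) (hL : ∀ i, MemLp (X i) 2 P)
    (h0 : ∀ i, ∫ ω, X i ω ∂P = 0) {C : ℝ}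
    (hC : ∀ N, ∫ ω, (∑ i ∈ Finset.range N, X i ω) ^ 2 ∂P ≤ C) :
    ∀ᵐ ω ∂P, ∃ c, Tendsto (fun N => ∑ i ∈ Finset.range N, X i ω) atTop (𝓝 c) := by
  set 𝒢 := Filtration.natural X hX with h𝒢
  set f : ℕ → Ω → ℝ := fun N ω => ∑ i ∈ Finset.range (N + 1), X i ω with hf
  have hL2 : ∀ N, MemLp (f N) 2 P := fun N => memLp_finsetSum _ fun i _ => hL i
  have hint : ∀ N, Integrable (f N) P := fun N => (hL2 N).integrable (by norm_num)
  have hadp : ∀ N, StronglyMeasurable[𝒢 N] (f N) := fun N =>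
    Finset.stronglyMeasurable_fun_sum _ fun i hi =>
      (Filtration.stronglyAdapted_natural hX i).mono
        (𝒢.mono (Nat.lt_succ_iff.1 (Finset.mem_range.1 hi)))
  have hmart : Martingale f 𝒢 P := by
    refine martingale_nat hadp hint fun N => ?_
    have e : f (N + 1) = f N + X (N + 1) := by
      ext ω
      simp only [hf, Pi.add_apply]
      rw [Finset.sum_range_succ _ (N + 1)]
    have h1 := condExp_add (hint N) ((hL (N + 1)).integrable (by norm_num)) (𝒢 N)
    have h2 := iIndepFun.condExp_natural_ae_eq_of_lt hX hind (Nat.lt_succ_self N)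
    rw [e]
    filter_upwards [h1, h2] with ω hω1 hω2
    rw [hω1, Pi.add_apply, condExp_of_stronglyMeasurable (𝒢.le N) (hadp N) (hint N)]
    erw [hω2]
    rw [h0, add_zero]
  have hbdd : ∀ N, eLpNorm (f N) 1 P ≤ ((1 + C).toNNReal : ENNReal) := by
    intro N
    rw [eLpNorm_one_eq_lintegral_enorm, ← ofReal_integral_norm_eq_lintegral_enorm (hint N)]
    refine ENNReal.ofReal_le_ofReal ?_
    have h1 : Integrable (fun ω => 1 + f N ω ^ 2) P :=
      (integrable_const _).add (hL2 N).integrable_sq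
    calc ∫ ω, ‖f N ω‖ ∂P ≤ ∫ ω, (1 + f N ω ^ 2) ∂P := by
          refine integral_mono (hint N).norm h1 fun ω => ?_
          simp only [Real.norm_eq_abs]
          nlinarith [sq_abs (f N ω), sq_nonneg (|f N ω| - 1)]
      _ ≤ 1 + C := by
          rw [integral_add (integrable_const _) (hL2 N).integrable_sq]
          have := hC (N + 1)
          simp only [integral_const, probReal_univ, one_smul]
          linarith
  filter_upwards [hmart.submartingale.exists_ae_tendsto_of_bdd hbdd] with ω hω
  obtain ⟨c, hc⟩ := hω
  exact ⟨c, (tendsto_add_atTop_iff_nat 1).1 hc⟩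

/-- A series of independent centered variables with summable variances converges almost surely:
its partial sums form an `L²`-bounded martingale. -/
theorem ae_exists_tendsto_sum {X : ℕ → Ω → ℝ} (hind : iIndepFun X P)
    (hX : ∀ i, AEMeasurable (X i) P) (hb : ∀ i, ∃ M, ∀ ω, |X i ω| ≤ M)
    (h0 : ∀ i, ∫ ω, X i ω ∂P = 0) (hs : Summable fun i => ∫ ω, X i ω ^ 2 ∂P) :
    ∀ᵐ ω ∂P, ∃ c, Tendsto (fun N => ∑ i ∈ Finset.range N, X i ω) atTop (𝓝 c) := by
  set X' : ℕ → Ω → ℝ := fun i => (hX i).mk (X i) with hX'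
  have hae : ∀ i, X i =ᵐ[P] X' i := fun i => (hX i).ae_eq_mk
  have hall : ∀ᵐ ω ∂P, ∀ i, X i ω = X' i ω := ae_all_iff.2 hae
  have h1 := ae_exists_tendsto_sum_of_stronglyMeasurable (hind.congr hae)
    (fun i => (hX i).measurable_mk.stronglyMeasurable)
    (fun i => (memLp_congr_ae (hae i)).1 (memLp_of_bounded (hX i) (hb i).choose_spec))
    (fun i => by rw [← integral_congr_ae (hae i)]; exact h0 i)
    (C := ∑' i, ∫ ω, X i ω ^ 2 ∂P) (fun N => by
      have e : ∫ ω, (∑ i ∈ Finset.range N, X' i ω) ^ 2 ∂P =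
          ∫ ω, (∑ i ∈ Finset.range N, X i ω) ^ 2 ∂P := by
        refine integral_congr_ae ?_
        filter_upwards [hall] with ω hω
        simp only [hω]
      rw [e, integral_sq_sum hind hX hb h0]
      exact hs.sum_le_tsum _ fun i _ => integral_nonneg fun ω => sq_nonneg _)
  filter_upwards [h1, hall] with ω hω hω'
  simpa only [hω'] using hω

/-- The symmetric interval of integers `[-R, R]`. -/
noncomputable def symInterval (R : ℕ) : Finset ℤ := Finset.Icc (-(R : ℤ)) R

theorem tendsto_symInterval : Tendsto symInterval atTop atTop := by
  refine tendsto_atTop_finset_of_monotone (fun R S h => ?_) fun r => ⟨r.natAbs, ?_⟩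
  · refine Finset.Icc_subset_Icc ?_ ?_
    · exact neg_le_neg (by exact_mod_cast h)
    · exact_mod_cast h
  · simp only [symInterval, Finset.mem_Icc]; omega

variable {X : ℤ → Ω → ℝ} {U : Ω → ℝ}

/-- Fatou's lemma for the second moment of a random series. -/
theorem lintegral_sq_le_of_tendsto (hind : iIndepFun X P) (hX : ∀ i, AEMeasurable (X i) P)
    (hb : ∀ i, ∃ M, ∀ ω, |X i ω| ≤ M) (h0 : ∀ i, ∫ ω, X i ω ∂P = 0)
    (hs : Summable fun i => ∫ ω, X i ω ^ 2 ∂P)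
    (hU : ∀ᵐ ω ∂P, Tendsto (fun R => ∑ r ∈ symInterval R, X r ω) atTop (𝓝 (U ω))) :
    ∫⁻ ω, ENNReal.ofReal (U ω ^ 2) ∂P ≤ ENNReal.ofReal (∑' r, ∫ ω, X r ω ^ 2 ∂P) := by
  have hm : ∀ R, AEMeasurable (fun ω => ∑ r ∈ symInterval R, X r ω) P := fun R =>
    Finset.aemeasurable_fun_sum _ fun i _ => hX i
  have hle : ∀ R, ∫⁻ ω, ENNReal.ofReal ((∑ r ∈ symInterval R, X r ω) ^ 2) ∂P ≤
      ENNReal.ofReal (∑' r, ∫ ω, X r ω ^ 2 ∂P) := by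
    intro R
    have hL : MemLp (fun ω => ∑ r ∈ symInterval R, X r ω) 2 P :=
      memLp_finsetSum _ fun i _ => memLp_of_bounded (hX i) (hb i).choose_spec
    rw [← ofReal_integral_eq_lintegral_ofReal hL.integrable_sq
      (Eventually.of_forall fun ω => sq_nonneg _), integral_sq_sum hind hX hb h0]
    exact ENNReal.ofReal_le_ofReal
      (hs.sum_le_tsum _ fun i _ => integral_nonneg fun ω => sq_nonneg _)
  calc ∫⁻ ω, ENNReal.ofReal (U ω ^ 2) ∂P
      = ∫⁻ ω, liminf (fun R => ENNReal.ofReal ((∑ r ∈ symInterval R, X r ω) ^ 2)) atTop ∂P := by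
        refine lintegral_congr_ae ?_
        filter_upwards [hU] with ω hω
        exact (ENNReal.tendsto_ofReal (hω.pow 2)).liminf_eq.symm
    _ ≤ liminf (fun R => ∫⁻ ω, ENNReal.ofReal ((∑ r ∈ symInterval R, X r ω) ^ 2) ∂P) atTop :=
        lintegral_liminf_le' fun R => ((hm R).pow_const 2).ennreal_ofReal
    _ ≤ liminf (fun _ : ℕ => ENNReal.ofReal (∑' r, ∫ ω, X r ω ^ 2 ∂P)) atTop :=
        liminf_le_liminf (Eventually.of_forall hle)
    _ = _ := by simp

/-- The distance of the characteristic function of a random series from the Gaussian one is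
controlled by the third moments and the squared variances of its terms. -/
theorem norm_charFun_series_sub_le (hind : iIndepFun X P) (hX : ∀ i, AEMeasurable (X i) P)
    (hb : ∀ i, ∃ M, ∀ ω, |X i ω| ≤ M) (h0 : ∀ i, ∫ ω, X i ω ∂P = 0)
    (hs : Summable fun i => ∫ ω, X i ω ^ 2 ∂P)
    (hU : ∀ᵐ ω ∂P, Tendsto (fun R => ∑ r ∈ symInterval R, X r ω) atTop (𝓝 (U ω)))
    {b : ℤ → ℝ} (hbs : Summable b)
    (hle : ∀ r, 4 * ∫ ω, |X r ω| ^ 3 ∂P + (∫ ω, X r ω ^ 2 ∂P) ^ 2 ≤ b r) :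
    ‖∫ ω, Complex.exp (U ω * Complex.I) ∂P -
      Complex.exp (-((∑' r, ∫ ω, X r ω ^ 2 ∂P : ℝ) : ℂ) / 2)‖ ≤ ∑' r, b r := by
  have hm : ∀ R, AEMeasurable (fun ω => ∑ r ∈ symInterval R, X r ω) P := fun R =>
    Finset.aemeasurable_fun_sum _ fun i _ => hX i
  have h1 : Tendsto (fun R => ∫ ω, Complex.exp ((∑ r ∈ symInterval R, X r ω : ℝ) * Complex.I) ∂P)
      atTop (𝓝 (∫ ω, Complex.exp (U ω * Complex.I) ∂P)) := by
    refine tendsto_integral_of_dominated_convergence (fun _ => 1) (fun R => ?_)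
      (integrable_const _) (fun R => Eventually.of_forall fun ω => ?_) ?_
    · have := hm R
      exact (by fun_prop : AEMeasurable (fun ω =>
        Complex.exp ((∑ r ∈ symInterval R, X r ω : ℝ) * Complex.I)) P).aestronglyMeasurable
    · exact (Complex.norm_exp_ofReal_mul_I _).le
    · filter_upwards [hU] with ω hω
      have hc : Continuous fun x : ℝ => Complex.exp (x * Complex.I) := by fun_prop
      exact (hc.tendsto _).comp hω
  have h2 : Tendsto (fun R => Complex.exp
      (-((∑ r ∈ symInterval R, ∫ ω, X r ω ^ 2 ∂P : ℝ) : ℂ) / 2)) atTop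
      (𝓝 (Complex.exp (-((∑' r, ∫ ω, X r ω ^ 2 ∂P : ℝ) : ℂ) / 2))) := by
    have hc : Continuous fun x : ℝ => Complex.exp (-(x : ℂ) / 2) := by fun_prop
    exact (hc.tendsto _).comp (hs.hasSum.comp tendsto_symInterval)
  refine le_of_tendsto (h1.sub h2).norm (Eventually.of_forall fun R => ?_)
  refine (norm_charFun_sum_sub_le hind hX hb h0 _).trans ?_
  refine (Finset.sum_le_sum fun r _ => hle r).trans (hbs.sum_le_tsum _ fun r _ => ?_)
  refine le_trans ?_ (hle r)
  have : 0 ≤ ∫ ω, |X r ω| ^ 3 ∂P := integral_nonneg fun ω => by positivity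
  positivity

end Series

/-! ### The linear process and its truncation -/

/-- The standing assumptions in quantitative form: independent innovations with the centered law
`ν`, regular coefficients with slowly varying part `Λ`, and truncation levels `η j` with truncated
standard deviation `σ j`; `Θ` measures how small the tails beyond the truncation levels are. -/
structure LinearModel {Ω : Type*} [MeasurableSpace Ω] (P : Measure Ω) (ε : ℤ → Ω → ℝ)
    (ν : Measure ℝ) (a : ℕ → ℝ) (α δ K C₀ : ℝ) (Λ η σ Θ : ℕ → ℝ) : Prop where
  indep : iIndepFun ε P
  aemeasurable : ∀ k, AEMeasurable (ε k) P
  law : ∀ k, P.map (ε k) = ν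
  integrable : Integrable (fun y : ℝ => y) ν
  centered : ∫ y, y ∂ν = 0
  coeff_regular : PotterRegular δ K Λ
  coeff_le : ∀ i : ℕ, |a i| ≤ K * ((i : ℝ) + 1) ^ (-α) * Λ (i + 1)
  trunc_regular : TruncationRegular δ C₀ η σ
  exponent_lt : α + δ < 1
  lt_exponent : 1 < 2 * α - 4 * δ
  sq_eq : ∀ j, 1 ≤ j → lawTruncSecondMoment ν (η j) = σ j ^ 2
  small : Tendsto Θ atTop (𝓝 0)
  tail_le : ∀ n j, 1 ≤ n → n ≤ j → η j * lawTailMoment ν (η j) ≤ Θ n * σ j ^ 2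
  third_le : ∀ n j, 1 ≤ n → n ≤ j → lawTruncThirdMoment ν (η j) ≤ Θ n * (η j * σ j ^ 2)

/-- The truncated and centered innovation used at the time horizon `n`; the truncation level grows
with the distance of the index to the origin. -/
noncomputable def truncInnov {Ω : Type*} (ε : ℤ → Ω → ℝ) (ν : Measure ℝ) (η : ℕ → ℝ) (n : ℕ)
    (r : ℤ) (ω : Ω) : ℝ := centeredCut ν (η (n + r.natAbs)) (ε r ω)

/-- The variance of the truncated innovation. -/
noncomputable def truncVar (ν : Measure ℝ) (η : ℕ → ℝ) (n : ℕ) (r : ℤ) : ℝ :=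
  ∫ y, centeredCut ν (η (n + r.natAbs)) y ^ 2 ∂ν

/-- The partial sum `S_m` built from the truncated innovations of horizon `n`, obtained by
subtracting the contribution of the remainders, which is an absolutely convergent series. -/
noncomputable def truncSum {Ω : Type*} (a : ℕ → ℝ) (ε : ℤ → Ω → ℝ) (ν : Measure ℝ) (η : ℕ → ℝ)
    (n m : ℕ) (ω : Ω) : ℝ :=
  linearSum a ε m ω - ∑' r : ℤ, windowCoeff a 0 m r * (ε r ω - truncInnov ε ν η n r ω)

/-- A majorant of the contribution of the remainders to all partial sums up to time `n`. -/
noncomputable def truncError {Ω : Type*} (a : ℕ → ℝ) (ε : ℤ → Ω → ℝ) (ν : Measure ℝ) (η : ℕ → ℝ)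
    (n : ℕ) (ω : Ω) : ENNReal :=
  ∑' r : ℤ, ENNReal.ofReal |absWindow a n r * (ε r ω - truncInnov ε ν η n r ω)|

theorem summable_window_remainder {Ω : Type*} {ε : ℤ → Ω → ℝ} {ν : Measure ℝ} {a : ℕ → ℝ}
    {η : ℕ → ℝ} {n m : ℕ} (hm : m ≤ n) {ω : Ω}
    (hω : Summable fun r : ℤ => |absWindow a n r * (ε r ω - truncInnov ε ν η n r ω)|) :
    Summable fun r : ℤ => |windowCoeff a 0 m r * (ε r ω - truncInnov ε ν η n r ω)| := by
  refine Summable.of_nonneg_of_le (fun _ => abs_nonneg _) (fun r => ?_) hω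
  rw [abs_mul, abs_mul, abs_of_nonneg (absWindow_nonneg a n r)]
  exact mul_le_mul_of_nonneg_right (abs_windowCoeff_le_absWindow a hm r) (abs_nonneg _)

theorem abs_tsum_le_tsum_abs {f : ℤ → ℝ} (hf : Summable fun r => |f r|) :
    |∑' r, f r| ≤ ∑' r, |f r| := by
  simpa only [Real.norm_eq_abs] using norm_tsum_le_tsum_norm (f := f) hf

theorem abs_linearSum_sub_truncSum_le {Ω : Type*} {ε : ℤ → Ω → ℝ} {ν : Measure ℝ} {a : ℕ → ℝ}
    {η : ℕ → ℝ} {n m : ℕ} (hm : m ≤ n) {ω : Ω}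
    (hω : Summable fun r : ℤ => |absWindow a n r * (ε r ω - truncInnov ε ν η n r ω)|) :
    ENNReal.ofReal |linearSum a ε m ω - truncSum a ε ν η n m ω| ≤ truncError a ε ν η n ω := by
  have h3 := summable_window_remainder hm hω
  have h4 : |∑' r : ℤ, windowCoeff a 0 m r * (ε r ω - truncInnov ε ν η n r ω)| ≤
      ∑' r : ℤ, |windowCoeff a 0 m r * (ε r ω - truncInnov ε ν η n r ω)| :=
    abs_tsum_le_tsum_abs h3
  have h5 : ∀ r : ℤ, |windowCoeff a 0 m r * (ε r ω - truncInnov ε ν η n r ω)| ≤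
      |absWindow a n r * (ε r ω - truncInnov ε ν η n r ω)| := fun r => by
    rw [abs_mul, abs_mul (absWindow a n r), abs_of_nonneg (absWindow_nonneg a n r)]
    exact mul_le_mul_of_nonneg_right (abs_windowCoeff_le_absWindow a hm r) (abs_nonneg _)
  unfold truncSum truncError
  rw [sub_sub_cancel, ← ENNReal.ofReal_tsum_of_nonneg (fun _ => abs_nonneg _) hω]
  exact ENNReal.ofReal_le_ofReal (h4.trans (h3.tsum_le_tsum h5 hω))

theorem coeffExt_natCast (a : ℕ → ℝ) (i : ℕ) : coeffExt a (i : ℤ) = a i := by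
  simp [coeffExt]

theorem windowCoeff_one (a : ℕ → ℝ) (i : ℕ) : windowCoeff a 0 1 (1 - (i : ℤ)) = a i := by
  simp [windowCoeff, coeffExt]

/-- A partial sum of the series of `X_k`, reindexed by the innovations; for `r > k` the coefficient
is zero. -/
theorem sum_symInterval_coeffExt {a : ℕ → ℝ} (f : ℤ → ℝ) {k R : ℕ} (hk : k ≤ R) :
    ∑ i ∈ Finset.range (k + R + 1), a i * f (k - (i : ℤ)) =
      ∑ r ∈ symInterval R, coeffExt a (k - r) * f r := by
  have h1 : ∑ r ∈ Finset.Icc (-(R : ℤ)) k, coeffExt a (k - r) * f r =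
      ∑ r ∈ symInterval R, coeffExt a (k - r) * f r := by
    refine Finset.sum_subset (Finset.Icc_subset_Icc le_rfl (by exact_mod_cast hk)) fun r hr hr' => ?_
    simp only [symInterval, Finset.mem_Icc] at hr hr'
    rw [coeffExt, if_neg (by omega), zero_mul]
  rw [← h1]
  refine Finset.sum_bij' (fun i _ => (k : ℤ) - i) (fun r _ => ((k : ℤ) - r).toNat) ?_ ?_ ?_ ?_ ?_
  · intro i hi; simp only [Finset.mem_range, Finset.mem_Icc] at *; omega
  · intro i hi; simp only [Finset.mem_range, Finset.mem_Icc] at *; omega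
  · intro i hi; simp
  · intro r hr; simp only [Finset.mem_Icc] at hr; omega
  · intro i hi
    rw [show (k : ℤ) - (k - i) = (i : ℤ) by ring, coeffExt_natCast]

namespace LinearModel

variable {Ω : Type*} [MeasurableSpace Ω] {P : Measure Ω} {ε : ℤ → Ω → ℝ}
  {ν : Measure ℝ} {a : ℕ → ℝ} {α δ K C₀ : ℝ} {Λ η σ Θ : ℕ → ℝ}

/-- The shifted innovations satisfy the same assumptions, by stationarity. -/
theorem shift (M : LinearModel P ε ν a α δ K C₀ Λ η σ Θ) (k : ℤ) :
    LinearModel P (fun r => ε (r + k)) ν a α δ K C₀ Λ η σ Θ :=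
  { M with
    indep := M.indep.precomp (g := fun r => r + k) (add_left_injective k)
    aemeasurable := fun r => M.aemeasurable (r + k)
    law := fun r => M.law (r + k) }

theorem level_nonneg (M : LinearModel P ε ν a α δ K C₀ Λ η σ Θ) {j : ℕ} (hj : 1 ≤ j) : 0 ≤ η j := by
  have := M.trunc_regular.pos j hj
  exact le_trans (by positivity) (M.trunc_regular.level_ge j hj)

theorem delta_pos (M : LinearModel P ε ν a α δ K C₀ Λ η σ Θ) : 0 < δ :=
  M.coeff_regular.exponent_pos

theorem small_nonneg (M : LinearModel P ε ν a α δ K C₀ Λ η σ Θ) {n : ℕ} (hn : 1 ≤ n) :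
    0 ≤ Θ n := by
  have h1 := M.tail_le n n hn le_rfl
  have h2 := mul_nonneg (M.level_nonneg hn) (lawTailMoment_nonneg (ν := ν) (η n))
  have h3 := M.trunc_regular.pos n hn
  by_contra hneg
  nlinarith [pow_pos h3 2]

theorem integral_comp (M : LinearModel P ε ν a α δ K C₀ Λ η σ Θ) (r : ℤ) {f : ℝ → ℝ}
    (hf : Measurable f) : ∫ ω, f (ε r ω) ∂P = ∫ y, f y ∂ν := by
  rw [← M.law r, integral_map (M.aemeasurable r) hf.aestronglyMeasurable]

theorem aemeasurable_truncInnov (M : LinearModel P ε ν a α δ K C₀ Λ η σ Θ) (n : ℕ) (r : ℤ) :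
    AEMeasurable (truncInnov ε ν η n r) P :=
  (measurable_centeredCut ν _).comp_aemeasurable (M.aemeasurable r)

theorem truncVar_nonneg (n : ℕ) (r : ℤ) : 0 ≤ truncVar ν η n r :=
  integral_nonneg fun _ => sq_nonneg _

/-- Weighted truncated innovations. -/
theorem indep_mul (M : LinearModel P ε ν a α δ K C₀ Λ η σ Θ) (n : ℕ) (w : ℤ → ℝ) :
    iIndepFun (fun r ω => w r * truncInnov ε ν η n r ω) P :=
  M.indep.comp (fun r y => w r * centeredCut ν (η (n + r.natAbs)) y)
    fun _ => (measurable_centeredCut ν _).const_mul _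

theorem integral_mul_sq (M : LinearModel P ε ν a α δ K C₀ Λ η σ Θ) (n : ℕ) (w : ℤ → ℝ) (r : ℤ) :
    ∫ ω, (w r * truncInnov ε ν η n r ω) ^ 2 ∂P = w r ^ 2 * truncVar ν η n r := by
  simp_rw [mul_pow]
  rw [integral_const_mul]
  congr 1
  exact M.integral_comp r ((measurable_centeredCut ν (η (n + r.natAbs))).pow_const 2)

variable [IsProbabilityMeasure P]

theorem isProbabilityMeasure_law (M : LinearModel P ε ν a α δ K C₀ Λ η σ Θ) :
    IsProbabilityMeasure ν := by
  rw [← M.law 0]; exact Measure.isProbabilityMeasure_map (M.aemeasurable 0)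

theorem exists_bound_mul (M : LinearModel P ε ν a α δ K C₀ Λ η σ Θ) {n : ℕ} (hn : 1 ≤ n)
    (w : ℤ → ℝ) (r : ℤ) : ∃ B, ∀ ω, |w r * truncInnov ε ν η n r ω| ≤ B := by
  have := M.isProbabilityMeasure_law
  refine ⟨|w r| * (2 * η (n + r.natAbs)), fun ω => ?_⟩
  rw [abs_mul]
  exact mul_le_mul_of_nonneg_left (abs_centeredCut_le (M.level_nonneg (by omega)) _) (abs_nonneg _)

theorem integral_mul_eq_zero (M : LinearModel P ε ν a α δ K C₀ Λ η σ Θ) {n : ℕ} (hn : 1 ≤ n)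
    (w : ℤ → ℝ) (r : ℤ) : ∫ ω, w r * truncInnov ε ν η n r ω ∂P = 0 := by
  have := M.isProbabilityMeasure_law
  rw [integral_const_mul]
  have h1 := M.integral_comp r (measurable_centeredCut ν (η (n + r.natAbs)))
  rw [integral_centeredCut (M.level_nonneg (by omega))] at h1
  rw [show ∫ ω, truncInnov ε ν η n r ω ∂P = 0 from h1, mul_zero]

theorem truncVar_le (M : LinearModel P ε ν a α δ K C₀ Λ η σ Θ) {n : ℕ} (hn : 1 ≤ n) (r : ℤ) :
    truncVar ν η n r ≤ σ (n + r.natAbs) ^ 2 := by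
  have := M.isProbabilityMeasure_law
  rw [truncVar, integral_sq_centeredCut (M.level_nonneg (by omega)), M.sq_eq _ (by omega)]
  linarith [sq_nonneg (∫ z in {z : ℝ | |z| ≤ η (n + r.natAbs)}, z ∂ν)]

/-- Centering lowers the truncated second moment by the square of a mean that the tail moment
bounds. -/
theorem le_truncVar (M : LinearModel P ε ν a α δ K C₀ Λ η σ Θ) {n : ℕ} (hn : 1 ≤ n) (r : ℤ) :
    (1 - Θ n ^ 2) * σ (n + r.natAbs) ^ 2 ≤ truncVar ν η n r := by
  have := M.isProbabilityMeasure_law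
  have hj : 1 ≤ n + r.natAbs := by omega
  have h1 := M.tail_le n (n + r.natAbs) hn (by omega)
  have h2 := abs_mean_cut_le_tail M.integrable M.centered (η (n + r.natAbs))
  have h3 := M.trunc_regular.level_ge _ hj
  have h4 := M.trunc_regular.pos _ hj
  have hj1 : (1 : ℝ) ≤ ((n + r.natAbs : ℕ) : ℝ) := by exact_mod_cast hj
  have h5 : σ (n + r.natAbs) ≤ η (n + r.natAbs) := by
    have : 1 ≤ Real.sqrt ((n + r.natAbs : ℕ) : ℝ) := by simpa using hj1
    nlinarith
  have h0 := lawTailMoment_nonneg (ν := ν) (η (n + r.natAbs))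
  -- uses `σ_j ≤ η_j`
  have h6 : lawTailMoment ν (η (n + r.natAbs)) ≤ Θ n * σ (n + r.natAbs) := by
    refine le_of_mul_le_mul_right ?_ h4
    nlinarith
  rw [truncVar, integral_sq_centeredCut (M.level_nonneg hj), M.sq_eq _ hj]
  have h7 : (∫ z in {z : ℝ | |z| ≤ η (n + r.natAbs)}, z ∂ν) ^ 2 ≤ (Θ n * σ (n + r.natAbs)) ^ 2 := by
    rw [← sq_abs]
    exact pow_le_pow_left₀ (abs_nonneg _) (h2.trans h6) 2
  rw [mul_pow] at h7
  linarith

theorem integral_mul_cube_le (M : LinearModel P ε ν a α δ K C₀ Λ η σ Θ) {n : ℕ} (hn : 1 ≤ n)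
    (w : ℤ → ℝ) (r : ℤ) : ∫ ω, |w r * truncInnov ε ν η n r ω| ^ 3 ∂P ≤
      |w r| ^ 3 * (8 * Θ n * (η (n + r.natAbs) * σ (n + r.natAbs) ^ 2)) := by
  have := M.isProbabilityMeasure_law
  simp_rw [abs_mul, mul_pow]
  rw [integral_const_mul]
  have h1 := M.integral_comp r
    (f := fun y => |centeredCut ν (η (n + r.natAbs)) y| ^ 3) (by
      have := measurable_centeredCut ν (η (n + r.natAbs))
      fun_prop)
  have h2 := integral_abs_cube_centeredCut_le M.integrable M.centered
    (M.level_nonneg (j := n + r.natAbs) (by omega))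
  have h3 := M.third_le n (n + r.natAbs) hn (by omega)
  have h4 := mul_le_mul_of_nonneg_left (M.tail_le n (n + r.natAbs) hn (by omega))
    (M.level_nonneg (j := n + r.natAbs) (by omega))
  refine mul_le_mul_of_nonneg_left ?_ (by positivity)
  calc ∫ ω, |truncInnov ε ν η n r ω| ^ 3 ∂P = ∫ y, |centeredCut ν (η (n + r.natAbs)) y| ^ 3 ∂ν := h1
    _ ≤ _ := h2
    _ ≤ _ := by linarith

theorem lintegral_remainder_le (M : LinearModel P ε ν a α δ K C₀ Λ η σ Θ) (n : ℕ) (r : ℤ)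
    {w : ℝ} (hw : 0 ≤ w) :
    ∫⁻ ω, ENNReal.ofReal |w * (ε r ω - truncInnov ε ν η n r ω)| ∂P ≤
      ENNReal.ofReal (w * (2 * lawTailMoment ν (η (n + r.natAbs)))) := by
  have := M.isProbabilityMeasure_law
  have hm : Measurable fun y => |y - centeredCut ν (η (n + r.natAbs)) y| := by
    have := measurable_centeredCut ν (η (n + r.natAbs))
    fun_prop
  have h1 : ∫⁻ ω, ENNReal.ofReal |ε r ω - truncInnov ε ν η n r ω| ∂P =
      ∫⁻ y, ENNReal.ofReal |y - centeredCut ν (η (n + r.natAbs)) y| ∂ν := by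
    have e := lintegral_map' hm.ennreal_ofReal.aemeasurable (M.aemeasurable r)
    rw [M.law r] at e
    exact e.symm
  have h2 : Integrable (fun y => y - centeredCut ν (η (n + r.natAbs)) y) ν := by
    refine M.integrable.sub ?_
    refine Integrable.sub ?_ (integrable_const _)
    exact M.integrable.indicator (measurableSet_abs_le _)
  rw [← ofReal_integral_eq_lintegral_ofReal h2.abs (Eventually.of_forall fun _ => abs_nonneg _)]
    at h1
  simp_rw [abs_mul, abs_of_nonneg hw, ENNReal.ofReal_mul hw]
  rw [lintegral_const_mul' _ _ ENNReal.ofReal_ne_top, h1]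
  gcongr
  exact integral_abs_sub_centeredCut_le M.integrable M.centered _

/-- The truncation error is absolutely summable, and its first moment is negligible against the
scale of the partial sums. -/
theorem exists_truncError_le (M : LinearModel P ε ν a α δ K C₀ Λ η σ Θ) :
    ∃ C, 0 < C ∧ ∀ n, 1 ≤ n →
      (∀ᵐ ω ∂P, Summable fun r : ℤ => |absWindow a n r * (ε r ω - truncInnov ε ν η n r ω)|) ∧
      ∫⁻ ω, truncError a ε ν η n ω ∂P ≤ ENNReal.ofReal (C * Θ n * sumScale α Λ σ n) := by
  obtain ⟨C, hC, h⟩ := exists_tsum_absWindow_mul_tail_le M.coeff_regular M.trunc_regular M.coeff_le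
    M.exponent_lt M.lt_exponent
  refine ⟨2 * C, by positivity, fun n hn => ?_⟩
  obtain ⟨h1, h2⟩ := h n hn (Θ n) (fun j => lawTailMoment ν (η j))
    (fun j => lawTailMoment_nonneg _) (fun j hj => M.tail_le n j hn hj)
  have h3 := ae_summable_of_summable_integral (P := P)
    (Z := fun r ω => absWindow a n r * (ε r ω - truncInnov ε ν η n r ω))
    (fun r => ((M.aemeasurable r).sub (M.aemeasurable_truncInnov n r)).const_mul _)
    (h1.mul_left 2) (fun r => by
      refine (M.lintegral_remainder_le n r (absWindow_nonneg a n r)).trans (le_of_eq ?_)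
      congr 1; ring)
    (fun r => by
      have := absWindow_nonneg a n r
      have := lawTailMoment_nonneg (ν := ν) (η (n + r.natAbs))
      positivity)
  refine ⟨h3.1, h3.2.trans (ENNReal.ofReal_le_ofReal ?_)⟩
  rw [tsum_mul_left]
  linarith

theorem exists_summable_sq (M : LinearModel P ε ν a α δ K C₀ Λ η σ Θ) :
    ∃ C, 0 < C ∧ ∀ n : ℕ, 1 ≤ n → ∀ j k : ℕ, j ≤ k → k ≤ n →
      Summable (fun r : ℤ => windowCoeff a j k r ^ 2 * truncVar ν η n r) ∧
        ∑' r : ℤ, windowCoeff a j k r ^ 2 * truncVar ν η n r ≤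
          C * (((k : ℝ) - j) / n) ^ (3 - 2 * α - 2 * δ) * sumScale α Λ σ n ^ 2 := by
  obtain ⟨C, hC, h⟩ := exists_tsum_sq_windowCoeff_le M.coeff_regular M.trunc_regular M.coeff_le
    M.exponent_lt M.lt_exponent
  refine ⟨C, hC, fun n hn j k hjk hk => ?_⟩
  obtain ⟨h1, h2⟩ := h n hn j k hjk hk
  have hle : ∀ r : ℤ, windowCoeff a j k r ^ 2 * truncVar ν η n r ≤
      windowCoeff a j k r ^ 2 * σ (n + r.natAbs) ^ 2 := fun r =>
    mul_le_mul_of_nonneg_left (M.truncVar_le hn r) (sq_nonneg _)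
  have h3 := Summable.of_nonneg_of_le
    (fun r => mul_nonneg (sq_nonneg _) (truncVar_nonneg n r)) hle h1
  exact ⟨h3, (h3.tsum_le_tsum hle h1).trans h2⟩

/-- The series of `X_1` splits into a series of independent, centered, bounded variables with
summable variances and an absolutely convergent series of remainders. -/
theorem ae_exists_tendsto_linearPartial_one (M : LinearModel P ε ν a α δ K C₀ Λ η σ Θ) :
    ∀ᵐ ω ∂P, ∃ c, Tendsto (linearPartial a ε 1 ω) atTop (𝓝 c) := by
  have hinj : Function.Injective fun i : ℕ => 1 - (i : ℤ) := fun i j h => by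
    have : (i : ℤ) = j := by simpa using h
    exact_mod_cast this
  obtain ⟨C, hC, hsq⟩ := M.exists_summable_sq
  obtain ⟨C', hC', herr⟩ := M.exists_truncError_le
  have h1 := (M.indep_mul 1 (fun r => windowCoeff a 0 1 r)).precomp hinj
  have h2 := ae_exists_tendsto_sum h1
    (fun i => (M.aemeasurable_truncInnov 1 _).const_mul _)
    (fun i => M.exists_bound_mul le_rfl _ _) (fun i => M.integral_mul_eq_zero le_rfl _ _) (by
      simp_rw [M.integral_mul_sq 1 (fun r => windowCoeff a 0 1 r)]
      exact ((hsq 1 le_rfl 0 1 zero_le_one le_rfl).1).comp_injective hinj)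
  filter_upwards [h2, (herr 1 le_rfl).1] with ω ⟨c, hc⟩ hω
  have h3 := ((summable_window_remainder le_rfl hω).of_abs.comp_injective hinj).hasSum.tendsto_sum_nat
  refine ⟨_, (hc.add h3).congr fun N => ?_⟩
  rw [← Finset.sum_add_distrib]
  refine Finset.sum_congr rfl fun i _ => ?_
  simp only [Function.comp, windowCoeff_one]
  ring

/-- The series that define the linear process converge almost surely. -/
theorem ae_tendsto_linearPartial (M : LinearModel P ε ν a α δ K C₀ Λ η σ Θ) (k : ℤ) :
    ∀ᵐ ω ∂P, Tendsto (linearPartial a ε k ω) atTop (𝓝 (linearProcess a ε k ω)) := by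
  filter_upwards [(M.shift (k - 1)).ae_exists_tendsto_linearPartial_one] with ω ⟨c, hc⟩
  have e : linearPartial a (fun r => ε (r + (k - 1))) 1 ω = linearPartial a ε k ω := by
    ext N
    refine Finset.sum_congr rfl fun i _ => ?_
    simp only
    congr 2
    ring
  rw [e] at hc
  exact tendsto_nhds_limUnder ⟨c, hc⟩

/-- The partial sums as series in the innovations, summed symmetrically. -/
theorem ae_tendsto_linearSum (M : LinearModel P ε ν a α δ K C₀ Λ η σ Θ) :
    ∀ᵐ ω ∂P, ∀ m : ℕ, Tendsto (fun R => ∑ r ∈ symInterval R, windowCoeff a 0 m r * ε r ω) atTop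
      (𝓝 (linearSum a ε m ω)) := by
  filter_upwards [ae_all_iff.2 M.ae_tendsto_linearPartial] with ω hω m
  have h1 : Tendsto (fun R : ℕ => ∑ k ∈ Finset.Icc 1 m, linearPartial a ε (k : ℤ) ω (k + R + 1))
      atTop (𝓝 (linearSum a ε m ω)) :=
    tendsto_finsetSum _ fun k _ => (hω k).comp
      (tendsto_atTop_mono (fun R => (by omega : R ≤ k + R + 1)) tendsto_id)
  refine h1.congr' ?_
  filter_upwards [eventually_ge_atTop m] with R hR
  have h2 : ∀ k ∈ Finset.Icc 1 m, linearPartial a ε (k : ℤ) ω (k + R + 1) =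
      ∑ r ∈ symInterval R, coeffExt a (k - r) * ε r ω := fun k hk =>
    sum_symInterval_coeffExt (fun r => ε r ω) ((Finset.mem_Icc.1 hk).2.trans hR)
  rw [Finset.sum_congr rfl h2, Finset.sum_comm]
  refine Finset.sum_congr rfl fun r _ => ?_
  rw [windowCoeff, Finset.sum_mul]
  rfl

theorem ae_tendsto_truncSum (M : LinearModel P ε ν a α δ K C₀ Λ η σ Θ) {n : ℕ} (hn : 1 ≤ n) :
    ∀ᵐ ω ∂P, ∀ m ≤ n, Tendsto
      (fun R => ∑ r ∈ symInterval R, windowCoeff a 0 m r * truncInnov ε ν η n r ω) atTop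
      (𝓝 (truncSum a ε ν η n m ω)) := by
  obtain ⟨C, hC, herr⟩ := M.exists_truncError_le
  filter_upwards [M.ae_tendsto_linearSum, (herr n hn).1] with ω h1 h2 m hm
  have h3 := (summable_window_remainder hm h2).of_abs.hasSum.comp tendsto_symInterval
  refine ((h1 m).sub h3).congr fun R => ?_
  simp only [Function.comp]
  rw [← Finset.sum_sub_distrib]
  exact Finset.sum_congr rfl fun r _ => by ring

theorem ae_abs_linearSum_sub_truncSum_le (M : LinearModel P ε ν a α δ K C₀ Λ η σ Θ) {n : ℕ}
    (hn : 1 ≤ n) : ∀ᵐ ω ∂P, ∀ m, m ≤ n →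
      ENNReal.ofReal |linearSum a ε m ω - truncSum a ε ν η n m ω| ≤ truncError a ε ν η n ω := by
  obtain ⟨C, hC, herr⟩ := M.exists_truncError_le
  exact (herr n hn).1.mono fun ω hω m hm => abs_linearSum_sub_truncSum_le hm hω

theorem aemeasurable_linearSum (M : LinearModel P ε ν a α δ K C₀ Λ η σ Θ) (m : ℕ) :
    AEMeasurable (linearSum a ε m) P :=
  aemeasurable_of_tendsto_metrizable_ae atTop
    (fun _ => Finset.aemeasurable_fun_sum _ fun r _ => (M.aemeasurable r).const_mul _)
    (M.ae_tendsto_linearSum.mono fun _ h => h m)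

theorem aemeasurable_truncSum (M : LinearModel P ε ν a α δ K C₀ Λ η σ Θ) {n m : ℕ} (hn : 1 ≤ n)
    (hm : m ≤ n) : AEMeasurable (truncSum a ε ν η n m) P :=
  aemeasurable_of_tendsto_metrizable_ae atTop
    (fun _ => Finset.aemeasurable_fun_sum _ fun r _ =>
      (M.aemeasurable_truncInnov n r).const_mul _)
    ((M.ae_tendsto_truncSum hn).mono fun _ h => h m hm)

/-- The moment bound behind tightness; the truncation makes second moments available. -/
theorem exists_lintegral_truncSum_sub_sq_le (M : LinearModel P ε ν a α δ K C₀ Λ η σ Θ) :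
    ∃ C, 0 < C ∧ ∀ n : ℕ, 1 ≤ n → ∀ j k : ℕ, j ≤ k → k ≤ n →
      ∫⁻ ω, ENNReal.ofReal ((truncSum a ε ν η n k ω - truncSum a ε ν η n j ω) ^ 2) ∂P ≤
        ENNReal.ofReal
          (C * (((k : ℝ) - j) / n) ^ (3 - 2 * α - 2 * δ) * sumScale α Λ σ n ^ 2) := by
  obtain ⟨C, hC, hsq⟩ := M.exists_summable_sq
  refine ⟨C, hC, fun n hn j k hjk hk => ?_⟩
  obtain ⟨h1, h2⟩ := hsq n hn j k hjk hk
  have e := M.integral_mul_sq n (fun r => windowCoeff a j k r)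
  have h3 := lintegral_sq_le_of_tendsto (M.indep_mul n (fun r => windowCoeff a j k r))
    (fun r => (M.aemeasurable_truncInnov n r).const_mul _) (M.exists_bound_mul hn _)
    (M.integral_mul_eq_zero hn _) (by simp_rw [e]; exact h1)
    (U := fun ω => truncSum a ε ν η n k ω - truncSum a ε ν η n j ω) (by
      filter_upwards [M.ae_tendsto_truncSum hn] with ω hω
      refine ((hω k hk).sub (hω j (hjk.trans hk))).congr fun R => ?_
      rw [← Finset.sum_sub_distrib]
      refine Finset.sum_congr rfl fun r _ => ?_
      rw [← sub_mul, windowCoeff_sub a hjk])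
  simp_rw [e] at h3
  exact h3.trans (ENNReal.ofReal_le_ofReal h2)

end LinearModel

/-! ### Finite-dimensional distributions of the truncated process -/

theorem PotterRegular.mono_exponent {δ δ' K : ℝ} {Λ : ℕ → ℝ} (hΛ : PotterRegular δ K Λ)
    (h : δ ≤ δ') : PotterRegular δ' K Λ := by
  have hK := hΛ.one_le
  have hpow : ∀ m n : ℕ, 1 ≤ m → m ≤ n → ((n : ℝ) / m) ^ δ ≤ ((n : ℝ) / m) ^ δ' := by
    intro m n hm hmn
    have hm0 : (0 : ℝ) < m := by exact_mod_cast hm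
    refine Real.rpow_le_rpow_of_exponent_le ?_ h
    rw [one_le_div hm0]
    exact_mod_cast hmn
  refine ⟨hΛ.exponent_pos.trans_le h, hK, hΛ.pos, fun m n hm hmn => ?_, fun m n hm hmn => ?_⟩
  · refine (hΛ.le_mul m n hm hmn).trans ?_
    have := hΛ.pos m
    have := hpow m n hm hmn
    gcongr
  · refine (hΛ.le_mul' m n hm hmn).trans ?_
    have := hΛ.pos n
    have := hpow m n hm hmn
    gcongr

theorem sumScale_sq (α : ℝ) (Λ σ : ℕ → ℝ) {n : ℕ} (hn : 1 ≤ n) :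
    sumScale α Λ σ n ^ 2 = σ n ^ 2 * (n : ℝ) ^ (3 - 2 * α) * Λ n ^ 2 := by
  have hn0 : (0 : ℝ) < n := by exact_mod_cast hn
  have e : (n : ℝ) ^ (3 - 2 * α) = ((n : ℝ) ^ (1 - α)) ^ 2 * n := by
    rw [← Real.rpow_natCast, ← Real.rpow_mul hn0.le, ← Real.rpow_add_one hn0.ne']
    congr 1
    push_cast; ring
  rw [e, sumScale, mul_pow, mul_pow, mul_pow, Real.sq_sqrt hn0.le]
  ring

theorem natFloor_mul_le (n : ℕ) (t : unitInterval) : ⌊(n : ℝ) * t⌋₊ ≤ n :=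
  Nat.floor_le_of_le (mul_le_of_le_one_right n.cast_nonneg t.2.2)

namespace LinearModel

variable {Ω : Type*} [MeasurableSpace Ω] {P : Measure Ω} {ε : ℤ → Ω → ℝ}
  {ν : Measure ℝ} {a : ℕ → ℝ} {α δ K C₀ : ℝ} {Λ η σ Θ : ℕ → ℝ} [IsProbabilityMeasure P]
  {h : ℝ → ℝ}

/-- The variance of an increment of the truncated process, on the scale `sumScale`; a by-product of
the limit is that `cAlpha` is the norm of a nonzero square integrable kernel. -/
theorem tendsto_tsum_sq (M : LinearModel P ε ν a α δ K C₀ Λ η σ Θ) (hh : SlowlyVarying h)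
    (ha : ∀ n : ℕ, 1 ≤ n → a n = (n : ℝ) ^ (-α) * h n) (hΛh : ∀ᶠ n : ℕ in atTop, h n = Λ n)
    (hα1 : α + 2 * δ < 1) (hp : 1 < 2 * α - 6 * δ)
    (hσ1 : ∀ x : ℝ, Tendsto (fun n : ℕ => σ (n + ⌊(n : ℝ) * x⌋.natAbs) ^ 2 / σ n ^ 2) atTop (𝓝 1))
    {s t : ℝ} (hs : 0 ≤ s) (hst : s ≤ t) (ht : t ≤ 1) :
    Tendsto (fun n : ℕ => (∑' r : ℤ, windowCoeff a ⌊(n : ℝ) * s⌋₊ ⌊(n : ℝ) * t⌋₊ r ^ 2 *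
      truncVar ν η n r) / sumScale α Λ σ n ^ 2) atTop (𝓝 ((t - s) ^ (3 - 2 * α) * cAlpha α)) ∧
    0 < cAlpha α := by
  have hδ := M.delta_pos
  have hV : ∀ n : ℕ, 1 ≤ n → ∀ r : ℤ,
      truncVar ν η n r ≤ C₀ ^ 2 * (1 + |(r : ℝ)| / n) ^ (2 * δ) * σ n ^ 2 := by
    intro n hn r
    have hσn := M.trunc_regular.pos n hn
    have hσj := M.trunc_regular.pos (n + r.natAbs) (by omega)
    refine (M.truncVar_le hn r).trans ((pow_le_pow_left₀ hσj.le
      (M.trunc_regular.growth n hn r) 2).trans (le_of_eq ?_))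
    rw [mul_comm 2 δ, Real.rpow_mul (by positivity), Real.rpow_ofNat]
    ring
  have hVlim : ∀ x : ℝ, Tendsto (fun n : ℕ => truncVar ν η n ⌊(n : ℝ) * x⌋ / σ n ^ 2) atTop
      (𝓝 1) := by
    intro x
    have h1 : Tendsto (fun n : ℕ => (1 - Θ n ^ 2) *
        (σ (n + ⌊(n : ℝ) * x⌋.natAbs) ^ 2 / σ n ^ 2)) atTop (𝓝 ((1 - 0 ^ 2) * 1)) :=
      (tendsto_const_nhds.sub (M.small.pow 2)).mul (hσ1 x)
    rw [show ((1 : ℝ) - 0 ^ 2) * 1 = 1 by norm_num] at h1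
    refine tendsto_of_tendsto_of_tendsto_of_le_of_le' h1 (hσ1 x) ?_ ?_
    · filter_upwards [eventually_ge_atTop 1] with n hn
      have hσn := M.trunc_regular.pos n hn
      rw [← mul_div_assoc]
      gcongr
      exact M.le_truncVar hn _
    · filter_upwards [eventually_ge_atTop 1] with n hn
      have hσn := M.trunc_regular.pos n hn
      gcongr
      exact M.truncVar_le hn _
  -- the truncated variances grow with exponent `2δ`, so the coefficients are used with this
  -- exponent
  have key : ∀ {s t : ℝ}, 0 ≤ s → s ≤ t → t ≤ 1 → _ := fun {s t} hs hst ht =>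
    tendsto_sum_sq_windowCoeff hh ha hΛh
      (M.coeff_regular.mono_exponent (δ' := 2 * δ) (by linarith)) M.coeff_le hα1 (by linarith)
      hs hst ht (v := fun n => σ n ^ 2) (fun n hn => pow_pos (M.trunc_regular.pos n hn) 2)
      (V := fun n r => truncVar ν η n r) (fun n r => truncVar_nonneg n r) hV hVlim
  have hα : α < 1 := by linarith
  refine ⟨?_, cAlpha_pos hα (key le_rfl zero_le_one le_rfl).2.2⟩
  have h1 := (key hs hst ht).2.1
  rw [integral_sq_fbmKernel hα hst] at h1
  refine h1.congr' ?_
  filter_upwards [eventually_ge_atTop 1] with n hn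
  rw [sumScale_sq α Λ σ hn]

theorem summable_mul (M : LinearModel P ε ν a α δ K C₀ Λ η σ Θ) {n : ℕ} (hn : 1 ≤ n) {j k : ℕ}
    (hj : j ≤ n) (hk : k ≤ n) :
    Summable fun r : ℤ => windowCoeff a 0 j r * windowCoeff a 0 k r * truncVar ν η n r := by
  obtain ⟨C, hC, hsq⟩ := M.exists_summable_sq
  have h1 := (hsq n hn 0 j (Nat.zero_le _) hj).1
  have h2 := (hsq n hn 0 k (Nat.zero_le _) hk).1
  refine Summable.of_norm_bounded (h1.add h2) fun r => ?_
  rw [Real.norm_eq_abs, abs_mul, abs_of_nonneg (truncVar_nonneg n r), ← add_mul]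
  refine mul_le_mul_of_nonneg_right ?_ (truncVar_nonneg n r)
  rw [abs_mul]
  nlinarith [sq_nonneg (|windowCoeff a 0 j r| - |windowCoeff a 0 k r|),
    sq_abs (windowCoeff a 0 j r), sq_abs (windowCoeff a 0 k r)]

/-- Polarization: covariances of the truncated process through the variances of its increments. -/
theorem tsum_mul_windowCoeff_eq (M : LinearModel P ε ν a α δ K C₀ Λ η σ Θ) {n : ℕ} (hn : 1 ≤ n)
    {j k : ℕ} (hjk : j ≤ k) (hk : k ≤ n) :
    ∑' r : ℤ, windowCoeff a 0 j r * windowCoeff a 0 k r * truncVar ν η n r =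
      (∑' r : ℤ, windowCoeff a 0 j r ^ 2 * truncVar ν η n r +
        ∑' r : ℤ, windowCoeff a 0 k r ^ 2 * truncVar ν η n r -
        ∑' r : ℤ, windowCoeff a j k r ^ 2 * truncVar ν η n r) / 2 := by
  obtain ⟨C, hC, hsq⟩ := M.exists_summable_sq
  have h1 := (hsq n hn 0 j (Nat.zero_le _) (hjk.trans hk)).1
  have h2 := (hsq n hn 0 k (Nat.zero_le _) hk).1
  have h3 := (hsq n hn j k hjk hk).1
  rw [← h1.tsum_add h2, ← (h1.add h2).tsum_sub h3, ← tsum_div_const]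
  refine tsum_congr fun r => ?_
  rw [← windowCoeff_sub a hjk]
  ring

theorem tendsto_tsum_mul (M : LinearModel P ε ν a α δ K C₀ Λ η σ Θ) (hh : SlowlyVarying h)
    (ha : ∀ n : ℕ, 1 ≤ n → a n = (n : ℝ) ^ (-α) * h n) (hΛh : ∀ᶠ n : ℕ in atTop, h n = Λ n)
    (hα1 : α + 2 * δ < 1) (hp : 1 < 2 * α - 6 * δ)
    (hσ1 : ∀ x : ℝ, Tendsto (fun n : ℕ => σ (n + ⌊(n : ℝ) * x⌋.natAbs) ^ 2 / σ n ^ 2) atTop (𝓝 1))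
    (s t : unitInterval) :
    Tendsto (fun n : ℕ => (∑' r : ℤ, windowCoeff a 0 ⌊(n : ℝ) * s⌋₊ r *
      windowCoeff a 0 ⌊(n : ℝ) * t⌋₊ r * truncVar ν η n r) / sumScale α Λ σ n ^ 2) atTop
      (𝓝 (cAlpha α * fbmCov (3 / 2 - α) s t)) := by
  wlog hst : s ≤ t generalizing s t
  · rw [fbmCov_comm]
    refine (this t s (le_of_not_ge hst)).congr fun n => ?_
    congr 1
    exact tsum_congr fun r => by ring
  have hst' : (s : ℝ) ≤ t := hst
  have key := fun {s t : ℝ} (hs : 0 ≤ s) (hst : s ≤ t) (ht : t ≤ 1) =>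
    (M.tendsto_tsum_sq hh ha hΛh hα1 hp hσ1 hs hst ht).1
  have h1 := key le_rfl s.2.1 s.2.2
  have h2 := key le_rfl t.2.1 t.2.2
  have h3 := key s.2.1 hst' t.2.2
  have h4 := ((h1.add h2).sub h3).div_const 2
  have e : ((s - 0 : ℝ) ^ (3 - 2 * α) * cAlpha α + (t - 0 : ℝ) ^ (3 - 2 * α) * cAlpha α -
      ((t : ℝ) - s) ^ (3 - 2 * α) * cAlpha α) / 2 = cAlpha α * fbmCov (3 / 2 - α) s t := by
    rw [fbmCov, abs_of_nonneg (by linarith), show 2 * (3 / 2 - α) = 3 - 2 * α by ring]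
    simp only [sub_zero]
    ring
  rw [e] at h4
  refine h4.congr' ?_
  filter_upwards [eventually_ge_atTop 1] with n hn
  have hmono : ⌊(n : ℝ) * s⌋₊ ≤ ⌊(n : ℝ) * t⌋₊ := Nat.floor_mono (by gcongr)
  rw [M.tsum_mul_windowCoeff_eq hn hmono (natFloor_mul_le n t)]
  simp only [mul_zero, Nat.floor_zero]
  ring

/-- The weight of the `r`-th innovation in a linear combination of values of the rescaled
process. -/
noncomputable def combWeight (a : ℕ → ℝ) (u : unitInterval →₀ ℝ) (n : ℕ) (b : ℝ) (r : ℤ) : ℝ :=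
  (∑ t ∈ u.support, u t * windowCoeff a 0 ⌊(n : ℝ) * t⌋₊ r) / b

theorem abs_combWeight_le (a : ℕ → ℝ) (u : unitInterval →₀ ℝ) (n : ℕ) {b : ℝ} (hb : 0 < b) (r : ℤ) :
    |combWeight a u n b r| ≤ (∑ t ∈ u.support, |u t|) * absWindow a n r / b := by
  rw [combWeight, abs_div, abs_of_pos hb, Finset.sum_mul]
  gcongr
  refine (Finset.abs_sum_le_sum_abs _ _).trans (Finset.sum_le_sum fun t _ => ?_)
  rw [abs_mul]
  gcongr
  exact abs_windowCoeff_le_absWindow a (natFloor_mul_le n t) r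

theorem combWeight_sq_mul (a : ℕ → ℝ) (u : unitInterval →₀ ℝ) (n : ℕ) (b V : ℝ) (r : ℤ) :
    combWeight a u n b r ^ 2 * V = ∑ s ∈ u.support, ∑ t ∈ u.support, u s * u t / b ^ 2 *
      (windowCoeff a 0 ⌊(n : ℝ) * s⌋₊ r * windowCoeff a 0 ⌊(n : ℝ) * t⌋₊ r * V) := by
  rw [combWeight, div_pow, sq (∑ t ∈ u.support, _), Finset.sum_mul_sum, Finset.sum_div,
    Finset.sum_mul]
  refine Finset.sum_congr rfl fun s _ => ?_
  rw [Finset.sum_div, Finset.sum_mul]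
  exact Finset.sum_congr rfl fun t _ => by ring

theorem summable_combWeight (M : LinearModel P ε ν a α δ K C₀ Λ η σ Θ) {n : ℕ} (hn : 1 ≤ n)
    (u : unitInterval →₀ ℝ) (b : ℝ) :
    Summable fun r => combWeight a u n b r ^ 2 * truncVar ν η n r := by
  simp_rw [combWeight_sq_mul]
  exact summable_sum fun s _ => summable_sum fun t _ =>
    (M.summable_mul hn (natFloor_mul_le n s) (natFloor_mul_le n t)).mul_left _

theorem tendsto_tsum_combWeight (M : LinearModel P ε ν a α δ K C₀ Λ η σ Θ) (hh : SlowlyVarying h)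
    (ha : ∀ n : ℕ, 1 ≤ n → a n = (n : ℝ) ^ (-α) * h n) (hΛh : ∀ᶠ n : ℕ in atTop, h n = Λ n)
    (hα1 : α + 2 * δ < 1) (hp : 1 < 2 * α - 6 * δ)
    (hσ1 : ∀ x : ℝ, Tendsto (fun n : ℕ => σ (n + ⌊(n : ℝ) * x⌋.natAbs) ^ 2 / σ n ^ 2) atTop (𝓝 1))
    {b : ℕ → ℝ} (hb : ∀ᶠ n in atTop, b n ^ 2 = cAlpha α * sumScale α Λ σ n ^ 2)
    (u : unitInterval →₀ ℝ) :
    Tendsto (fun n : ℕ => ∑' r, combWeight a u n (b n) r ^ 2 * truncVar ν η n r) atTop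
      (𝓝 (fbmForm (3 / 2 - α) u u)) := by
  have hc := (M.tendsto_tsum_sq hh ha hΛh hα1 hp hσ1 le_rfl zero_le_one le_rfl).2
  rw [fbmForm_apply]
  have h1 : Tendsto (fun n : ℕ => ∑ s ∈ u.support, ∑ t ∈ u.support, u s * u t / cAlpha α *
      ((∑' r : ℤ, windowCoeff a 0 ⌊(n : ℝ) * s⌋₊ r *
      windowCoeff a 0 ⌊(n : ℝ) * t⌋₊ r * truncVar ν η n r) / sumScale α Λ σ n ^ 2)) atTop
      (𝓝 (∑ s ∈ u.support, ∑ t ∈ u.support, u s * u t / cAlpha α *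
        (cAlpha α * fbmCov (3 / 2 - α) s t))) :=
    tendsto_finsetSum _ fun s _ => tendsto_finsetSum _ fun t _ =>
      (M.tendsto_tsum_mul hh ha hΛh hα1 hp hσ1 s t).const_mul _
  have e : ∑ s ∈ u.support, ∑ t ∈ u.support, u s * u t / cAlpha α *
        (cAlpha α * fbmCov (3 / 2 - α) s t) =
      ∑ s ∈ u.support, ∑ t ∈ u.support, u s * u t * fbmCov (3 / 2 - α) s t := by
    refine Finset.sum_congr rfl fun s _ => Finset.sum_congr rfl fun t _ => ?_
    field_simp
  rw [e] at h1
  refine h1.congr' ?_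
  filter_upwards [eventually_ge_atTop 1, hb] with n hn hbn
  have hs : ∀ s t : unitInterval, Summable fun r : ℤ => u s * u t / b n ^ 2 *
      (windowCoeff a 0 ⌊(n : ℝ) * s⌋₊ r * windowCoeff a 0 ⌊(n : ℝ) * t⌋₊ r * truncVar ν η n r) :=
    fun s t => (M.summable_mul hn (natFloor_mul_le n s) (natFloor_mul_le n t)).mul_left _
  simp_rw [combWeight_sq_mul]
  rw [Summable.tsum_finsetSum fun s _ => summable_sum fun t _ => hs s t]
  refine Finset.sum_congr rfl fun s _ => ?_
  rw [Summable.tsum_finsetSum fun t _ => hs s t]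
  refine Finset.sum_congr rfl fun t _ => ?_
  rw [tsum_mul_left, hbn]
  field_simp

/-- The finite-dimensional characteristic functions of the rescaled truncated process converge to
those of the fractional Brownian motion. -/
theorem tendsto_charFun_truncSum (M : LinearModel P ε ν a α δ K C₀ Λ η σ Θ)
    (hh : SlowlyVarying h)
    (ha : ∀ n : ℕ, 1 ≤ n → a n = (n : ℝ) ^ (-α) * h n) (hΛh : ∀ᶠ n : ℕ in atTop, h n = Λ n)
    (hα1 : α + 2 * δ < 1) (hp : 1 < 2 * α - 6 * δ)
    (hσ1 : ∀ x : ℝ, Tendsto (fun n : ℕ => σ (n + ⌊(n : ℝ) * x⌋.natAbs) ^ 2 / σ n ^ 2) atTop (𝓝 1))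
    {b : ℕ → ℝ} (hb : ∀ᶠ n in atTop, b n = Real.sqrt (cAlpha α) * sumScale α Λ σ n)
    (u : unitInterval →₀ ℝ) :
    Tendsto (fun n : ℕ => ∫ ω, Complex.exp ((∑ t ∈ u.support,
      u t * (truncSum a ε ν η n ⌊(n : ℝ) * t⌋₊ ω / b n) : ℝ) * Complex.I) ∂P) atTop
      (𝓝 (Complex.exp (-(fbmForm (3 / 2 - α) u u : ℝ) / 2))) := by
  have hc := (M.tendsto_tsum_sq hh ha hΛh hα1 hp hσ1 le_rfl zero_le_one le_rfl).2
  set κ := Real.sqrt (cAlpha α) with hκ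
  have hκ0 : 0 < κ := Real.sqrt_pos.2 hc
  have hκ2 : κ ^ 2 = cAlpha α := Real.sq_sqrt hc.le
  obtain ⟨C₃, hC₃, h₃⟩ := exists_tsum_absWindow_cube_le M.coeff_regular M.trunc_regular M.coeff_le
    M.exponent_lt M.lt_exponent
  obtain ⟨C₄, hC₄, h₄⟩ := exists_tsum_absWindow_fourth_le M.coeff_regular M.trunc_regular M.coeff_le
    M.exponent_lt M.lt_exponent
  have h1 : Tendsto (fun n : ℕ => Complex.exp
      (-((∑' r, combWeight a u n (b n) r ^ 2 * truncVar ν η n r : ℝ) : ℂ) / 2)) atTop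
      (𝓝 (Complex.exp (-(fbmForm (3 / 2 - α) u u : ℝ) / 2))) := by
    have hcont : Continuous fun x : ℝ => Complex.exp (-(x : ℂ) / 2) := by fun_prop
    refine (hcont.tendsto _).comp (M.tendsto_tsum_combWeight hh ha hΛh hα1 hp hσ1 ?_ u)
    filter_upwards [hb] with n hn
    rw [hn, mul_pow, hκ2]
  set A := ∑ t ∈ u.support, |u t| with hA
  have hA0 : 0 ≤ A := Finset.sum_nonneg fun t _ => abs_nonneg _
  have herr : Tendsto (fun n : ℕ => 32 * (A / κ) ^ 3 * C₃ * Θ n + (A / κ) ^ 4 * (C₄ / n)) atTop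
      (𝓝 0) := by
    have := (M.small.const_mul (32 * (A / κ) ^ 3 * C₃)).add
      ((tendsto_const_div_atTop_nhds_zero_nat C₄).const_mul ((A / κ) ^ 4))
    simpa using this
  refine (tendsto_iff_of_dist (squeeze_zero' (Eventually.of_forall fun _ => dist_nonneg) ?_
    herr)).1 h1
  filter_upwards [eventually_ge_atTop 1, hb] with n hn hbn
  have hS := sumScale_pos (α := α) M.coeff_regular M.trunc_regular hn
  have hb0 : 0 < b n := by rw [hbn]; positivity
  have hΘ := M.small_nonneg hn
  have hw : ∀ r, |combWeight a u n (b n) r| ≤ A / κ / sumScale α Λ σ n * absWindow a n r := by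
    intro r
    refine (abs_combWeight_le a u n hb0 r).trans (le_of_eq ?_)
    rw [hbn, ← hA]
    field_simp
  obtain ⟨h3s, h3⟩ := h₃ n hn
  obtain ⟨h4s, h4⟩ := h₄ n hn
  have e := M.integral_mul_sq n (combWeight a u n (b n))
  have hbound := norm_charFun_series_sub_le (M.indep_mul n (combWeight a u n (b n)))
    (fun r => (M.aemeasurable_truncInnov n r).const_mul _) (M.exists_bound_mul hn _)
    (M.integral_mul_eq_zero hn _) (by simp_rw [e]; exact M.summable_combWeight hn u (b n))
    (U := fun ω => ∑ t ∈ u.support, u t * (truncSum a ε ν η n ⌊(n : ℝ) * t⌋₊ ω / b n)) (by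
      filter_upwards [M.ae_tendsto_truncSum hn] with ω hω
      have h5 : Tendsto (fun R => ∑ t ∈ u.support, u t * ((∑ r ∈ symInterval R,
          windowCoeff a 0 ⌊(n : ℝ) * t⌋₊ r * truncInnov ε ν η n r ω) / b n)) atTop
          (𝓝 (∑ t ∈ u.support, u t * (truncSum a ε ν η n ⌊(n : ℝ) * t⌋₊ ω / b n))) :=
        tendsto_finsetSum _ fun t _ => ((hω _ (natFloor_mul_le n t)).div_const _).const_mul _
      refine h5.congr fun R => ?_
      simp_rw [Finset.sum_div, Finset.mul_sum]
      rw [Finset.sum_comm]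
      refine Finset.sum_congr rfl fun r _ => ?_
      rw [combWeight, Finset.sum_div, Finset.sum_mul]
      exact Finset.sum_congr rfl fun t _ => by ring)
    -- the third moments contribute through `Θ n`, the squared variances through the factor `1 / n`
    (b := fun r => 32 * Θ n * (A / κ / sumScale α Λ σ n) ^ 3 *
        (absWindow a n r ^ 3 * (η (n + r.natAbs) * σ (n + r.natAbs) ^ 2)) +
      (A / κ / sumScale α Λ σ n) ^ 4 * (absWindow a n r ^ 4 * σ (n + r.natAbs) ^ 4))
    ((h3s.mul_left _).add (h4s.mul_left _)) (fun r => by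
      rw [e]
      have hj : 1 ≤ n + r.natAbs := by omega
      have h5 := M.integral_mul_cube_le hn (combWeight a u n (b n)) r
      have h6 := pow_le_pow_left₀ (abs_nonneg _) (hw r) 3
      have h7 := pow_le_pow_left₀ (abs_nonneg _) (hw r) 2
      have h8 := M.truncVar_le hn r
      have h9 := truncVar_nonneg (ν := ν) (η := η) n r
      have hη := M.level_nonneg hj
      have h10 : 4 * ∫ ω, |combWeight a u n (b n) r * truncInnov ε ν η n r ω| ^ 3 ∂P ≤
          4 * ((A / κ / sumScale α Λ σ n * absWindow a n r) ^ 3 *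
            (8 * Θ n * (η (n + r.natAbs) * σ (n + r.natAbs) ^ 2))) := by
        refine mul_le_mul_of_nonneg_left (h5.trans ?_) (by norm_num)
        gcongr
      have h11 : (combWeight a u n (b n) r ^ 2 * truncVar ν η n r) ^ 2 ≤
          ((A / κ / sumScale α Λ σ n * absWindow a n r) ^ 2 * σ (n + r.natAbs) ^ 2) ^ 2 := by
        rw [sq_abs] at h7
        gcongr
      refine (add_le_add h10 h11).trans (le_of_eq ?_)
      ring)
  simp_rw [e] at hbound
  rw [dist_comm, dist_eq_norm]
  refine hbound.trans ?_
  rw [(h3s.mul_left _).tsum_add (h4s.mul_left _), tsum_mul_left, tsum_mul_left]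
  have h5 : 32 * Θ n * (A / κ / sumScale α Λ σ n) ^ 3 * (C₃ * sumScale α Λ σ n ^ 3) =
      32 * (A / κ) ^ 3 * C₃ * Θ n := by field_simp
  have h6 : (A / κ / sumScale α Λ σ n) ^ 4 * (C₄ / n * sumScale α Λ σ n ^ 4) =
      (A / κ) ^ 4 * (C₄ / n) := by field_simp
  rw [← h5, ← h6]
  gcongr

end LinearModel

/-! ### From increments and characteristic functions to functional convergence -/

/-- The sum of the squared steps of a path; its root bounds the largest step. -/
def stepEnergy {Ω : Type*} (X : ℕ → ℕ → Ω → ℝ) (n : ℕ) (ω : Ω) : ℝ :=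
  ∑ k ∈ Finset.range n, (X n (k + 1) ω - X n k ω) ^ 2

theorem stepEnergy_nonneg {Ω : Type*} {X : ℕ → ℕ → Ω → ℝ} (n : ℕ) (ω : Ω) : 0 ≤ stepEnergy X n ω :=
  Finset.sum_nonneg fun _ _ => sq_nonneg _

theorem abs_step_le {Ω : Type*} {X : ℕ → ℕ → Ω → ℝ} (n : ℕ) (ω : Ω) {k : ℕ} (hk : k < n) :
    |X n (k + 1) ω - X n k ω| ≤ Real.sqrt (stepEnergy X n ω) :=
  Real.abs_le_sqrt (Finset.single_le_sum (f := fun k => (X n (k + 1) ω - X n k ω) ^ 2)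
    (fun _ _ => sq_nonneg _) (Finset.mem_range.2 hk))

theorem norm_exp_mul_I_sub_exp_mul_I_le (x y : ℝ) :
    ‖Complex.exp (x * Complex.I) - Complex.exp (y * Complex.I)‖ ≤ |x - y| := by
  have e : Complex.exp (x * Complex.I) - Complex.exp (y * Complex.I) =
      Complex.exp (y * Complex.I) * (Complex.exp (Complex.I * ((x - y : ℝ) : ℂ)) - 1) := by
    rw [mul_sub, ← Complex.exp_add, mul_one]
    congr 2
    push_cast; ring
  rw [e, norm_mul, Complex.norm_exp_ofReal_mul_I, one_mul]
  exact Real.norm_exp_I_mul_ofReal_sub_one_le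

section Functional

variable {Ω : Type*} [MeasurableSpace Ω] {P : Measure Ω}
  {X : ℕ → ℕ → Ω → ℝ} {M q : ℝ}

/-- There are `n` steps, each with second moment of order `n ^ (-q)`. -/
theorem lintegral_stepEnergy_le (hX : ∀ n k, AEMeasurable (X n k) P) {n : ℕ}
    (hn : 1 ≤ n)
    (H : ∀ j k : ℕ, j ≤ k → k ≤ n → ∫⁻ ω, ENNReal.ofReal ((X n k ω - X n j ω) ^ 2) ∂P ≤
      ENNReal.ofReal (M * (((k : ℝ) - j) / n) ^ q)) :
    ∫⁻ ω, ENNReal.ofReal (stepEnergy X n ω) ∂P ≤ ENNReal.ofReal (M * (n : ℝ) ^ (1 - q)) := by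
  have hn0 : (0 : ℝ) < n := by exact_mod_cast hn
  simp_rw [stepEnergy, ENNReal.ofReal_sum_of_nonneg fun k _ => sq_nonneg (X n (k + 1) _ - X n k _)]
  have hm : ∀ k ∈ Finset.range n, AEMeasurable
      (fun ω => ENNReal.ofReal ((X n (k + 1) ω - X n k ω) ^ 2)) P := fun k _ =>
    (((hX n (k + 1)).sub (hX n k)).pow_const 2).ennreal_ofReal
  rw [lintegral_finsetSum' _ hm]
  calc _ ≤ ∑ _k ∈ Finset.range n, ENNReal.ofReal (M * (1 / (n : ℝ)) ^ q) := by
        refine Finset.sum_le_sum fun k hk => ?_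
        have := H k (k + 1) (Nat.le_succ k) (Finset.mem_range.1 hk)
        push_cast at this
        rwa [add_sub_cancel_left] at this
    _ = _ := by
        rw [Finset.sum_const, Finset.card_range, nsmul_eq_mul, ← ENNReal.ofReal_natCast,
          ← ENNReal.ofReal_mul hn0.le]
        congr 1
        rw [one_div, Real.inv_rpow hn0.le, Real.rpow_sub hn0, Real.rpow_one]
        field_simp

theorem tendsto_measure_sqrt_stepEnergy (hX : ∀ n k, AEMeasurable (X n k) P) (hq : 1 < q)
    (H : ∀ᶠ n : ℕ in atTop, ∀ j k : ℕ, j ≤ k → k ≤ n →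
      ∫⁻ ω, ENNReal.ofReal ((X n k ω - X n j ω) ^ 2) ∂P ≤
        ENNReal.ofReal (M * (((k : ℝ) - j) / n) ^ q)) {e : ℝ} (he : 0 < e) :
    Tendsto (fun n => P {ω | e < Real.sqrt (stepEnergy X n ω)}) atTop (𝓝 0) := by
  have h1 : Tendsto (fun n : ℕ => ENNReal.ofReal (M * (n : ℝ) ^ (1 - q)) / ENNReal.ofReal (e ^ 2))
      atTop (𝓝 0) := by
    have h2 : Tendsto (fun n : ℕ => M * (n : ℝ) ^ (1 - q)) atTop (𝓝 0) := by
      have := ((tendsto_rpow_neg_atTop (y := q - 1) (by linarith)).comp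
        tendsto_natCast_atTop_atTop).const_mul M
      simpa using this
    have h3 := ENNReal.Tendsto.div_const (ENNReal.tendsto_ofReal h2) (b := ENNReal.ofReal (e ^ 2))
      (Or.inr (by simpa using he.ne'))
    simpa using h3
  refine tendsto_of_tendsto_of_tendsto_of_le_of_le' tendsto_const_nhds h1
    (Eventually.of_forall fun _ => zero_le) ?_
  filter_upwards [H, eventually_ge_atTop 1] with n hn hn1
  have hm : AEMeasurable (fun ω => ENNReal.ofReal (stepEnergy X n ω)) P :=
    (Finset.aemeasurable_fun_sum _ fun k _ =>
      ((hX n (k + 1)).sub (hX n k)).pow_const 2).ennreal_ofReal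
  calc P {ω | e < Real.sqrt (stepEnergy X n ω)}
      ≤ P {ω | ENNReal.ofReal (e ^ 2) ≤ ENNReal.ofReal (stepEnergy X n ω)} :=
        measure_mono fun ω hω => ENNReal.ofReal_le_ofReal (Real.lt_sqrt he.le |>.1 hω).le
    _ ≤ (∫⁻ ω, ENNReal.ofReal (stepEnergy X n ω) ∂P) / ENNReal.ofReal (e ^ 2) :=
        meas_ge_le_lintegral_div hm (by simpa using he.ne') ENNReal.ofReal_ne_top
    _ ≤ _ := by
        gcongr
        exact lintegral_stepEnergy_le hX hn1 hn

variable [IsProbabilityMeasure P]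

/-- The finite-dimensional characteristic functions of the polygonal paths have the same limit as
those of the step paths. -/
theorem tendsto_charFun_polygon (hX : ∀ n k, AEMeasurable (X n k) P) (hM : 0 ≤ M) (hq : 1 < q)
    (H : ∀ᶠ n : ℕ in atTop, ∀ j k : ℕ, j ≤ k → k ≤ n →
      ∫⁻ ω, ENNReal.ofReal ((X n k ω - X n j ω) ^ 2) ∂P ≤
        ENNReal.ofReal (M * (((k : ℝ) - j) / n) ^ q)) {u : unitInterval →₀ ℝ} {c : ℂ}
    (hφ : Tendsto (fun n : ℕ => ∫ ω, Complex.exp ((∑ t ∈ u.support,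
      u t * X n ⌊(n : ℝ) * t⌋₊ ω : ℝ) * Complex.I) ∂P) atTop (𝓝 c)) :
    Tendsto (fun n : ℕ => ∫ ω, Complex.exp
      (evalPairing (polygon (fun k => X n k ω) n) u * Complex.I) ∂P) atTop (𝓝 c) := by
  set A := ∑ t ∈ u.support, |u t| with hA
  have hA0 : 0 ≤ A := Finset.sum_nonneg fun t _ => abs_nonneg _
  have hlim : Tendsto (fun n : ℕ => A * ((1 + M) * (n : ℝ) ^ (-((q - 1) / 2)))) atTop (𝓝 0) := by
    have := (((tendsto_rpow_neg_atTop (y := (q - 1) / 2) (by linarith)).comp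
      tendsto_natCast_atTop_atTop).const_mul (1 + M)).const_mul A
    simpa using this
  refine (tendsto_iff_of_dist (squeeze_zero' (Eventually.of_forall fun _ => dist_nonneg) ?_
    hlim)).1 hφ
  filter_upwards [H, eventually_ge_atTop 1] with n hn hn1
  have hn0 : (0 : ℝ) < n := by exact_mod_cast hn1
  -- `e ^ 2` is the order of the mean step energy, and `√E ≤ e + E / e` for every value `E` of it
  set e := (n : ℝ) ^ (-((q - 1) / 2)) with he
  have he0 : 0 < e := Real.rpow_pos_of_pos hn0 _
  have he2 : (n : ℝ) ^ (1 - q) = e ^ 2 := by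
    rw [he, ← Real.rpow_natCast, ← Real.rpow_mul hn0.le]
    congr 1
    push_cast; ring
  have hen := lintegral_stepEnergy_le hX hn1 hn
  have hpm : AEMeasurable (fun ω => evalPairing (polygon (fun k => X n k ω) n) u) P :=
    (continuous_evalPairing_left u).measurable.comp_aemeasurable
      (aemeasurable_polygon (fun k => hX n k) n)
  have hsm : AEMeasurable (fun ω => ∑ t ∈ u.support, u t * X n ⌊(n : ℝ) * t⌋₊ ω) P :=
    Finset.aemeasurable_fun_sum _ fun t _ => (hX n _).const_mul _
  have hint : ∀ {f : Ω → ℝ}, AEMeasurable f P →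
      Integrable (fun ω => Complex.exp (f ω * Complex.I)) P := fun hf =>
    Integrable.of_bound (C := 1)
      (by fun_prop : AEMeasurable (fun ω => Complex.exp (_ * Complex.I)) P).aestronglyMeasurable
      (Eventually.of_forall fun ω => (Complex.norm_exp_ofReal_mul_I _).le)
  have hpt : ∀ ω, ‖Complex.exp ((∑ t ∈ u.support, u t * X n ⌊(n : ℝ) * t⌋₊ ω : ℝ) * Complex.I) -
      Complex.exp (evalPairing (polygon (fun k => X n k ω) n) u * Complex.I)‖ ≤
      A * (e + stepEnergy X n ω / e) := by
    intro ω
    refine (norm_exp_mul_I_sub_exp_mul_I_le _ _).trans ?_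
    rw [evalPairing_apply, Finsupp.sum, ← Finset.sum_sub_distrib, hA, Finset.sum_mul]
    refine (Finset.abs_sum_le_sum_abs _ _).trans (Finset.sum_le_sum fun t _ => ?_)
    rw [← mul_sub, abs_mul]
    refine mul_le_mul_of_nonneg_left ?_ (abs_nonneg _)
    refine (abs_sub_polygon_le (s' := fun k => X n k ω) hn1 (Real.sqrt_nonneg _)
      (fun k hk => abs_step_le n ω hk) t).trans ?_
    have h1 := Real.sq_sqrt (stepEnergy_nonneg (X := X) n ω)
    rw [← sub_nonneg]
    have h2 : e + stepEnergy X n ω / e - Real.sqrt (stepEnergy X n ω) =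
        (e ^ 2 + stepEnergy X n ω - e * Real.sqrt (stepEnergy X n ω)) / e := by
      field_simp
    rw [h2]
    refine div_nonneg ?_ he0.le
    nlinarith [sq_nonneg (e - Real.sqrt (stepEnergy X n ω)),
      mul_nonneg he0.le (Real.sqrt_nonneg (stepEnergy X n ω))]
  rw [dist_eq_norm, ← integral_sub (hint hsm) (hint hpm)]
  have hfin : ENNReal.ofReal ‖∫ ω, (Complex.exp ((∑ t ∈ u.support,
      u t * X n ⌊(n : ℝ) * t⌋₊ ω : ℝ) * Complex.I) -
      Complex.exp (evalPairing (polygon (fun k => X n k ω) n) u * Complex.I)) ∂P‖ ≤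
      ENNReal.ofReal (A * ((1 + M) * e)) := by
    rw [ofReal_norm]
    refine (enorm_integral_le_lintegral_enorm _).trans ?_
    calc _ ≤ ∫⁻ ω, (ENNReal.ofReal (A * e) + ENNReal.ofReal (A / e) *
          ENNReal.ofReal (stepEnergy X n ω)) ∂P := by
          refine lintegral_mono fun ω => ?_
          rw [← ofReal_norm, ← ENNReal.ofReal_mul (by positivity),
            ← ENNReal.ofReal_add (by positivity)
              (mul_nonneg (by positivity) (stepEnergy_nonneg n ω))]
          refine ENNReal.ofReal_le_ofReal ((hpt ω).trans (le_of_eq ?_))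
          ring
      _ ≤ ENNReal.ofReal (A * e) + ENNReal.ofReal (A / e) * ENNReal.ofReal (M * e ^ 2) := by
          rw [lintegral_add_left measurable_const, lintegral_const, measure_univ, mul_one,
            lintegral_const_mul' _ _ ENNReal.ofReal_ne_top, ← he2]
          gcongr
      _ = _ := by
          rw [← ENNReal.ofReal_mul (by positivity), ← ENNReal.ofReal_add (by positivity)
            (by positivity)]
          congr 1
          field_simp
  exact (ENNReal.ofReal_le_ofReal_iff (by positivity)).1 hfin

/-- Increments of the second order with exponent greater than one and convergence of the
finite-dimensional characteristic functions give convergence in law of the polygonal paths. -/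
theorem exists_tendsto_polygon (hX : ∀ n k, AEMeasurable (X n k) P) (hX0 : ∀ n ω, X n 0 ω = 0)
    (hM : 0 ≤ M) (hq : 1 < q) (hq2 : q ≤ 2)
    (H : ∀ᶠ n : ℕ in atTop, ∀ j k : ℕ, j ≤ k → k ≤ n →
      ∫⁻ ω, ENNReal.ofReal ((X n k ω - X n j ω) ^ 2) ∂P ≤
        ENNReal.ofReal (M * (((k : ℝ) - j) / n) ^ q)) {φ : (unitInterval →₀ ℝ) → ℂ}
    (hφ : ∀ u : unitInterval →₀ ℝ, Tendsto (fun n : ℕ => ∫ ω, Complex.exp ((∑ t ∈ u.support,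
      u t * X n ⌊(n : ℝ) * t⌋₊ ω : ℝ) * Complex.I) ∂P) atTop (𝓝 (φ u))) :
    ∃ ν : ProbabilityMeasure C(unitInterval, ℝ),
      Tendsto (β := ProbabilityMeasure C(unitInterval, ℝ))
        (fun n => ⟨P.map (fun ω => polygon (fun k => X n k ω) n),
          Measure.isProbabilityMeasure_map (aemeasurable_polygon (fun k => hX n k) n)⟩) atTop (𝓝 ν) ∧
      ∀ u, ∫ w, Complex.exp (evalPairing w u * Complex.I) ∂(ν : Measure _) = φ u := by
  -- tightness is claimed for the laws from index `N` on, where the moment bounds hold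
  obtain ⟨N, hN⟩ := eventually_atTop.1 (H.and (eventually_ge_atTop 1))
  have hp : ∀ n, AEMeasurable (fun ω => polygon (fun k => X n k ω) n) P := fun n =>
    aemeasurable_polygon (fun k => hX n k) n
  set μ : ℕ → ProbabilityMeasure C(unitInterval, ℝ) := fun n =>
    ⟨P.map (fun ω => polygon (fun k => X n k ω) n), Measure.isProbabilityMeasure_map (hp n)⟩ with hμ
  have htight : IsTightMeasureSet {((μ (n + N) : ProbabilityMeasure C(unitInterval, ℝ)) :
      Measure C(unitInterval, ℝ)) | n} := by
    refine isTightMeasureSet_of_second_moment (C := 9 * M) (q := q) (by positivity) hq ?_ ?_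
    · rintro _ ⟨n, rfl⟩
      have hn1 := (hN (n + N) (Nat.le_add_left _ _)).2
      refine (ae_map_iff (hp _) (measurableSet_eq_fun
        (continuous_eval_const (0 : unitInterval)).measurable measurable_const)).2
        (Eventually.of_forall fun ω => ?_)
      rw [polygon_zero _ hn1, hX0]
    · rintro _ ⟨n, rfl⟩ x y
      obtain ⟨hn, hn1⟩ := hN (n + N) (Nat.le_add_left _ _)
      have hm : Measurable fun w : C(unitInterval, ℝ) => ENNReal.ofReal ((w y - w x) ^ 2) :=
        (((continuous_eval_const y).sub (continuous_eval_const x)).pow 2).measurable.ennreal_ofReal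
      show ∫⁻ w, _ ∂(P.map _) ≤ _
      rw [lintegral_map' hm.aemeasurable (hp _)]
      exact lintegral_polygon_le (fun k => hX (n + N) k) hn1 hM hq hq2 hn x y
  have hchar : ∀ u, Tendsto (fun n => ∫ w, Complex.exp (evalPairing w u * Complex.I)
      ∂(μ (n + N) : Measure _)) atTop (𝓝 (φ u)) := by
    intro u
    have h1 := (tendsto_add_atTop_iff_nat N).2 (tendsto_charFun_polygon hX hM hq H (hφ u))
    refine h1.congr fun n => ?_
    have hm : Continuous fun w : C(unitInterval, ℝ) =>
        Complex.exp (evalPairing w u * Complex.I) := by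
      have := continuous_evalPairing_left u
      fun_prop
    exact (integral_map (hp (n + N)) hm.aestronglyMeasurable).symm
  obtain ⟨ν, h1, h2⟩ := exists_tendsto_of_tight_of_charFun htight hchar
  exact ⟨ν, (tendsto_add_atTop_iff_nat N).1 h1, h2⟩

end Functional

/-! ### The linear model of a slowly varying truncated variance -/

section Model

variable {ν : Measure ℝ} [IsFiniteMeasure ν]

/-- The truncation levels `η_j` and the truncated standard deviations `√l(η_j)` satisfy the growth
bounds required of a linear model. -/
theorem exists_truncationRegular (hl : SlowlyVarying (lawTruncSecondMoment ν)) {δ : ℝ}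
    (hδ : 0 < δ) :
    ∃ C, TruncationRegular δ C (truncLevel (lawTruncSecondMoment ν))
      (fun j => Real.sqrt (lawTruncSecondMoment ν (truncLevel (lawTruncSecondMoment ν) j))) := by
  set l := lawTruncSecondMoment ν with hl'
  have hm : Monotone l := lawTruncSecondMoment_mono
  have hr : ∀ x, ContinuousWithinAt l (Ici x) x := lawTruncSecondMoment_rightCont
  obtain ⟨C₁, hC₁, h₁⟩ := exists_sq_le_mul_truncMoment hl hm
  obtain ⟨C₂, hC₂, h₂⟩ := exists_truncMoment_growth hl hm hr (δ := 2 * δ) (by positivity)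
  have hmax : ∀ {x y : ℝ}, 0 ≤ y → x ≤ max 1 (max (Real.sqrt C₁) (Real.sqrt C₂)) →
      x * y ≤ max 1 (max (Real.sqrt C₁) (Real.sqrt C₂)) * y := fun hy h =>
    mul_le_mul_of_nonneg_right h hy
  refine ⟨max 1 (max (Real.sqrt C₁) (Real.sqrt C₂)), le_max_left _ _, fun j hj =>
    Real.sqrt_pos.2 (truncMoment_truncLevel_pos hl hm hj), fun n hn r => ?_, fun j hj => ?_,
    fun j hj => ?_⟩
  · have hρ : 0 < 1 + |(r : ℝ)| / n := by positivity
    have hn0 : (n : ℝ) ≠ 0 := by positivity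
    have h := h₂ n (n + r.natAbs) hn (Nat.le_add_right _ _)
    rw [natCast_add_natAbs hn, mul_div_cancel_left₀ _ hn0] at h
    refine (Real.sqrt_le_sqrt h).trans ?_
    rw [Real.sqrt_mul' _ (lawTruncSecondMoment_nonneg _), Real.sqrt_mul hC₂.le,
      mul_comm 2 δ, Real.rpow_mul hρ.le, Real.rpow_two,
      Real.sqrt_sq (Real.rpow_nonneg hρ.le _), mul_assoc, mul_comm (_ ^ δ), mul_assoc]
    exact hmax (by positivity) ((le_max_right _ _).trans (le_max_right _ _))
  · rw [← Real.sqrt_mul (Nat.cast_nonneg j)]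
    exact Real.sqrt_le_iff.2 ⟨(truncLevel_pos hl hm hj).le, mul_truncMoment_le_sq hl hm hr hj⟩
  · have h := Real.le_sqrt_of_sq_le (h₁ j hj)
    rw [Real.sqrt_mul hC₁.le, Real.sqrt_mul (Nat.cast_nonneg j)] at h
    exact h.trans (hmax (by positivity) ((le_max_left _ _).trans (le_max_right _ _)))

/-- Uniformly over the levels beyond the `n`-th, the tail moment and the truncated third moment are
negligible against the truncated second moment. -/
theorem exists_uniform_moment_bound (hl : SlowlyVarying (lawTruncSecondMoment ν))
    (hint : Integrable (fun y => y) ν) :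
    ∃ Θ : ℕ → ℝ, Tendsto Θ atTop (𝓝 0) ∧ ∀ n j : ℕ, 1 ≤ n → n ≤ j →
      truncLevel (lawTruncSecondMoment ν) j *
          lawTailMoment ν (truncLevel (lawTruncSecondMoment ν) j) ≤
        Θ n * lawTruncSecondMoment ν (truncLevel (lawTruncSecondMoment ν) j) ∧
      lawTruncThirdMoment ν (truncLevel (lawTruncSecondMoment ν) j) ≤
        Θ n * (truncLevel (lawTruncSecondMoment ν) j *
          lawTruncSecondMoment ν (truncLevel (lawTruncSecondMoment ν) j)) := by
  set l := lawTruncSecondMoment ν with hl'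
  have hm : Monotone l := lawTruncSecondMoment_mono
  have hr : ∀ x, ContinuousWithinAt l (Ici x) x := lawTruncSecondMoment_rightCont
  set η := truncLevel l with hη
  have hηt : Tendsto η atTop atTop := tendsto_truncLevel hl hm hr
  have hη0 : ∀ {j : ℕ}, 1 ≤ j → 0 < η j := fun hj => truncLevel_pos hl hm hj
  have hl0 : ∀ {j : ℕ}, 1 ≤ j → 0 < l (η j) := fun hj => truncMoment_truncLevel_pos hl hm hj
  have hnonneg : ∀ {j : ℕ}, 1 ≤ j → 0 ≤ η j * lawTailMoment ν (η j) / l (η j) ∧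
      0 ≤ lawTruncThirdMoment ν (η j) / (η j * l (η j)) := fun hj =>
    ⟨div_nonneg (mul_nonneg (hη0 hj).le (lawTailMoment_nonneg _)) (hl0 hj).le,
      div_nonneg (lawTruncThirdMoment_nonneg _) (mul_pos (hη0 hj) (hl0 hj)).le⟩
  have hf : Tendsto (fun j => η j * lawTailMoment ν (η j) / l (η j) +
      lawTruncThirdMoment ν (η j) / (η j * l (η j))) atTop (𝓝 0) := by
    refine Metric.tendsto_nhds.2 fun e he => ?_
    obtain ⟨X₁, h₁⟩ := exists_lawTailMoment_le hl hint (δ := e / 3) (by positivity)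
    obtain ⟨X₂, h₂⟩ := exists_lawTruncThirdMoment_le hl (δ := e / 3) (by positivity)
    filter_upwards [hηt.eventually_ge_atTop X₁, hηt.eventually_ge_atTop X₂,
      eventually_ge_atTop 1] with j hj₁ hj₂ hj
    have a₁ := (div_le_iff₀ (hl0 hj)).2 (h₁ _ hj₁)
    have a₂ := (div_le_iff₀ (mul_pos (hη0 hj) (hl0 hj))).2 (h₂ _ hj₂)
    rw [Real.dist_eq, sub_zero, abs_of_nonneg (add_nonneg (hnonneg hj).1 (hnonneg hj).2)]
    linarith
  obtain ⟨Θ, hΘ, -, hΘle⟩ := exists_tendsto_majorant hf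
  refine ⟨Θ, hΘ, fun n j hn hnj => ?_⟩
  have hj := hn.trans hnj
  have h := hΘle n j hnj
  exact ⟨(div_le_iff₀ (hl0 hj)).1 (by linarith [(hnonneg hj).2]),
    (div_le_iff₀ (mul_pos (hη0 hj) (hl0 hj))).1 (by linarith [(hnonneg hj).1])⟩

/-- The truncation levels at horizon `n` and at distance `|x| n` from the origin are comparable. -/
theorem tendsto_truncMoment_shift_ratio (hl : SlowlyVarying (lawTruncSecondMoment ν)) (x : ℝ) :
    Tendsto (fun n : ℕ => lawTruncSecondMoment ν
        (truncLevel (lawTruncSecondMoment ν) (n + ⌊(n : ℝ) * x⌋.natAbs)) /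
      lawTruncSecondMoment ν (truncLevel (lawTruncSecondMoment ν) n)) atTop (𝓝 1) := by
  refine tendsto_truncMoment_ratio hl lawTruncSecondMoment_mono lawTruncSecondMoment_rightCont
    (y := |x| + 2) (by positivity) ?_
  filter_upwards [eventually_ge_atTop 1] with n hn
  refine ⟨Nat.le_add_right _ _, ?_⟩
  have hn1 : (1 : ℝ) ≤ n := by exact_mod_cast hn
  have h1 : |((⌊(n : ℝ) * x⌋ : ℤ) : ℝ)| ≤ n * |x| + 1 := by
    have a := Int.floor_le ((n : ℝ) * x)
    have b := Int.lt_floor_add_one ((n : ℝ) * x)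
    have c : |(n : ℝ) * x| = n * |x| := by rw [abs_mul, Nat.abs_cast]
    have d := abs_le.1 c.le
    exact abs_le.2 ⟨by linarith, by linarith⟩
  push_cast [Nat.cast_natAbs]
  nlinarith

end Model

/-! ### Convergence to fractional Brownian motion -/

section Conclusion

variable {Ω : Type*} [MeasurableSpace Ω] {P : Measure Ω} {ε : ℤ → Ω → ℝ}
  {ν : Measure ℝ} {a : ℕ → ℝ} {α δ K C₀ : ℝ} {Λ η σ Θ : ℕ → ℝ} {h : ℝ → ℝ} {b : ℕ → ℝ}

theorem LinearModel.aemeasurable_truncError (M : LinearModel P ε ν a α δ K C₀ Λ η σ Θ) (n : ℕ) :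
    AEMeasurable (truncError a ε ν η n) P :=
  AEMeasurable.tsum fun r => (((M.aemeasurable r).sub
    (M.aemeasurable_truncInnov n r)).const_mul _).abs.ennreal_ofReal

variable [IsProbabilityMeasure P]

/-- The truncation error is negligible against the normalization. -/
theorem LinearModel.tendsto_measure_truncError (M : LinearModel P ε ν a α δ K C₀ Λ η σ Θ) {κ : ℝ}
    (hκ : 0 < κ) (hb : ∀ᶠ n in atTop, b n = κ * sumScale α Λ σ n) {e : ℝ} (he : 0 < e) :
    Tendsto (fun n => P {ω | ENNReal.ofReal (e * b n) ≤ truncError a ε ν η n ω}) atTop (𝓝 0) := by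
  obtain ⟨C, hC, H⟩ := M.exists_truncError_le
  have h0 : Tendsto (fun n => ENNReal.ofReal (C / (e * κ) * Θ n)) atTop (𝓝 0) := by
    have := ENNReal.tendsto_ofReal (M.small.const_mul (C / (e * κ)))
    simpa using this
  refine tendsto_of_tendsto_of_tendsto_of_le_of_le' tendsto_const_nhds h0
    (Eventually.of_forall fun _ => zero_le) ?_
  filter_upwards [hb, eventually_ge_atTop 1] with n hbn hn
  have hs := sumScale_pos (α := α) M.coeff_regular M.trunc_regular hn
  have hbp : 0 < e * b n := by rw [hbn]; positivity
  have hm : AEMeasurable (truncError a ε ν η n) P := M.aemeasurable_truncError n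
  calc _ ≤ (∫⁻ ω, truncError a ε ν η n ω ∂P) / ENNReal.ofReal (e * b n) :=
        meas_ge_le_lintegral_div hm (by simpa using hbp) ENNReal.ofReal_ne_top
    _ ≤ ENNReal.ofReal (C * Θ n * sumScale α Λ σ n) / ENNReal.ofReal (e * b n) := by
        gcongr
        exact (H n hn).2
    _ = _ := by
        rw [← ENNReal.ofReal_div_of_pos hbp, hbn]
        congr 1
        field_simp

/-- Under a linear model with regularly varying coefficients the normalized step paths converge to
the law of a continuous path with the characteristic functions of fractional Brownian motion. -/
theorem LinearModel.exists_tendstoInDistribution (M : LinearModel P ε ν a α δ K C₀ Λ η σ Θ)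
    (hh : SlowlyVarying h) (ha : ∀ n : ℕ, 1 ≤ n → a n = (n : ℝ) ^ (-α) * h n)
    (hΛh : ∀ᶠ n : ℕ in atTop, h n = Λ n) (hα1 : α + 2 * δ < 1)
    (hp : 1 < 2 * α - 6 * δ)
    (hσ1 : ∀ x : ℝ, Tendsto (fun n : ℕ => σ (n + ⌊(n : ℝ) * x⌋.natAbs) ^ 2 / σ n ^ 2) atTop (𝓝 1))
    (hb0 : b 0 = 0) (hb : ∀ᶠ n in atTop, b n = Real.sqrt (cAlpha α) * sumScale α Λ σ n) :
    ∃ (μ : Measure C(unitInterval, ℝ)) (_ : IsProbabilityMeasure μ)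
      (_ : IsProbabilityMeasure (μ.map CadlagPath.ofContinuous)),
      (∀ u, ∫ w, Complex.exp (evalPairing w u * Complex.I) ∂μ =
        Complex.exp (-(fbmForm (3 / 2 - α) u u : ℝ) / 2)) ∧
      TendstoInDistribution (fun n ω => stepPath (fun m => linearSum a ε m ω / b n) n) atTop
        (fun w => w) (fun _ => P) (μ.map CadlagPath.ofContinuous) := by
  have hδ := M.delta_pos
  have hc : 0 < cAlpha α :=
    (M.tendsto_tsum_sq hh ha hΛh hα1 hp hσ1 (le_refl 0) zero_le_one le_rfl).2
  set κ := Real.sqrt (cAlpha α) with hκ'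
  have hκ : 0 < κ := Real.sqrt_pos.2 hc
  -- the index is capped at `n` because the truncation of horizon `n` controls only the sums up to
  -- `n`
  set X : ℕ → ℕ → Ω → ℝ := fun n k ω => truncSum a ε ν η n (min k n) ω / b n with hXdef
  have hX : ∀ n k, AEMeasurable (X n k) P := by
    intro n k
    rcases Nat.eq_zero_or_pos n with rfl | hn
    · simp only [hXdef, hb0, div_zero]
      exact aemeasurable_const
    · exact (M.aemeasurable_truncSum hn (min_le_right _ _)).div_const _
  have hX0 : ∀ n ω, X n 0 ω = 0 := by
    intro n ω
    simp [hXdef, truncSum, linearSum, windowCoeff]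
  obtain ⟨C, hC, HC⟩ := M.exists_lintegral_truncSum_sub_sq_le
  have hbpos : ∀ᶠ n in atTop, 0 < b n := by
    filter_upwards [hb, eventually_ge_atTop 1] with n hbn hn
    rw [hbn]
    exact mul_pos hκ (sumScale_pos M.coeff_regular M.trunc_regular hn)
  have H : ∀ᶠ n : ℕ in atTop, ∀ j k : ℕ, j ≤ k → k ≤ n →
      ∫⁻ ω, ENNReal.ofReal ((X n k ω - X n j ω) ^ 2) ∂P ≤
        ENNReal.ofReal (C / κ ^ 2 * (((k : ℝ) - j) / n) ^ (3 - 2 * α - 2 * δ)) := by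
    filter_upwards [hb, hbpos, eventually_ge_atTop 1] with n hbn hbp hn j k hjk hkn
    have hs := sumScale_pos (α := α) M.coeff_regular M.trunc_regular hn
    have e : ∀ ω, ENNReal.ofReal ((X n k ω - X n j ω) ^ 2) = ENNReal.ofReal ((b n ^ 2)⁻¹) *
        ENNReal.ofReal ((truncSum a ε ν η n k ω - truncSum a ε ν η n j ω) ^ 2) := by
      intro ω
      rw [← ENNReal.ofReal_mul (by positivity)]
      simp only [hXdef, min_eq_left hkn, min_eq_left (hjk.trans hkn)]
      congr 1
      field_simp
    simp_rw [e]
    rw [lintegral_const_mul' _ _ ENNReal.ofReal_ne_top]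
    refine (mul_le_mul_right (HC n hn j k hjk hkn) _).trans (le_of_eq ?_)
    rw [← ENNReal.ofReal_mul (by positivity), hbn]
    congr 1
    field_simp
  have hφ : ∀ u : unitInterval →₀ ℝ, Tendsto (fun n : ℕ => ∫ ω, Complex.exp ((∑ t ∈ u.support,
      u t * X n ⌊(n : ℝ) * t⌋₊ ω : ℝ) * Complex.I) ∂P) atTop
      (𝓝 (Complex.exp (-(fbmForm (3 / 2 - α) u u : ℝ) / 2))) := by
    intro u
    have := M.tendsto_charFun_truncSum hh ha hΛh hα1 hp hσ1 hb u
    simpa only [hXdef, min_eq_left (natFloor_mul_le _ _)] using this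
  have hq : 1 < 3 - 2 * α - 2 * δ := by linarith
  obtain ⟨μ, hμ, hchar⟩ := exists_tendsto_polygon hX hX0 (by positivity) hq (by linarith) H hφ
  have hprob : IsProbabilityMeasure ((μ : Measure C(unitInterval, ℝ)).map
      CadlagPath.ofContinuous) :=
    Measure.isProbabilityMeasure_map
      CadlagPath.isClosedEmbedding_ofContinuous.continuous.measurable.aemeasurable
  refine ⟨μ, inferInstance, hprob, hchar, ?_⟩
  have hY : ∀ n, AEMeasurable (fun ω => stepPath (fun m => linearSum a ε m ω / b n) n) P :=
    fun n => CadlagPath.aemeasurable_stepPath (fun k => (M.aemeasurable_linearSum k).div_const _) n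
  refine CadlagPath.tendstoInDistribution_of_close hY
    -- the distance to the polygon of the truncated sums: truncation error plus the largest step
    (D := fun n ω => (truncError a ε ν η n ω).toReal / b n + Real.sqrt (stepEnergy X n ω))
    (fun n => aemeasurable_polygon (fun k => hX n k) n) ?_ ?_ hμ _ rfl
  · obtain ⟨C', -, HC'⟩ := M.exists_truncError_le
    filter_upwards [hbpos, eventually_ge_atTop 1] with n hbp hn
    have hfin : ∀ᵐ ω ∂P, truncError a ε ν η n ω < ⊤ :=
      ae_lt_top' (M.aemeasurable_truncError n) ((HC' n hn).2.trans_lt ENNReal.ofReal_lt_top).ne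
    filter_upwards [hfin, M.ae_abs_linearSum_sub_truncSum_le hn] with ω hω hle
    refine CadlagPath.edist_stepPath_polygon_le hn (Real.sqrt_nonneg _) (fun k hk => ?_)
      fun k hk => abs_step_le n ω hk
    simp only [hXdef, min_eq_left hk]
    rw [← sub_div, abs_div, abs_of_pos hbp]
    gcongr
    exact (ENNReal.ofReal_le_iff_le_toReal hω.ne).1 (hle k hk)
  · intro e he
    have h1 := M.tendsto_measure_truncError hκ hb (half_pos he)
    have h2 := tendsto_measure_sqrt_stepEnergy hX hq H (half_pos he)
    have h3 := h1.add h2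
    rw [add_zero] at h3
    refine tendsto_of_tendsto_of_tendsto_of_le_of_le' tendsto_const_nhds h3
      (Eventually.of_forall fun _ => zero_le) ?_
    filter_upwards [hbpos] with n hbp
    refine (measure_mono fun ω hω => ?_).trans (measure_union_le _ _)
    by_contra hcon
    simp only [mem_union, mem_ofPred_eq, not_or, not_le, not_lt] at hcon hω
    have h4 : (truncError a ε ν η n ω).toReal ≤ e / 2 * b n :=
      ENNReal.toReal_le_of_le_ofReal (by positivity) hcon.1.le
    have h5 := (div_le_iff₀ hbp).2 h4
    linarith [hcon.2]

end Conclusion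

theorem theorem1 {Ω : Type*} [MeasurableSpace Ω] (P : Measure Ω) [IsProbabilityMeasure P]
    (ε : ℤ → Ω → ℝ)
    (h_indep : iIndepFun ε P)
    (h_ident : ∀ k, IdentDistrib (ε k) (ε 0) P P)
    (h_int : Integrable (ε 0) P)
    (h_centered : ∫ ω, ε 0 ω ∂P = 0)
    (h_domain : SlowlyVarying (truncSecondMoment P (ε 0)))
    (α : ℝ) (hα : 1 / 2 < α) (hα1 : α < 1)
    (L : ℕ → ℝ) (hL : ∃ h : ℝ → ℝ, SlowlyVarying h ∧ ∀ n : ℕ, L n = h n)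
    (a : ℕ → ℝ) (ha : ∀ n : ℕ, 1 ≤ n → a n = (n : ℝ) ^ (-α) * L n) :
    -- the series defining the linear process converge almost surely
    (∀ k : ℤ, ∀ᵐ ω ∂P,
      Tendsto (linearPartial a ε k ω) atTop (𝓝 (linearProcess a ε k ω))) ∧
    -- functional convergence in `D[0,1]` to fractional Brownian motion
    (∃ (μ : Measure CadlagPath) (_ : IsProbabilityMeasure μ),
      IsFractionalBrownianMotion (3 / 2 - α) (fun t (w : CadlagPath) => w t) μ ∧
      TendstoInDistribution
        (fun (n : ℕ) ω => stepPath
          (fun m => linearSum a ε m ω / normalizer α (truncSecondMoment P (ε 0)) L n) n)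
        atTop (fun w : CadlagPath => w) (fun _ => P) μ) ∧
    -- the central limit theorem
    TendstoInDistribution
      (fun (n : ℕ) ω => linearSum a ε n ω / normalizer α (truncSecondMoment P (ε 0)) L n)
      atTop (fun x : ℝ => x) (fun _ => P) (gaussianReal 0 1) := by
  obtain ⟨h, hh, hLh⟩ := hL
  have hah : ∀ n : ℕ, 1 ≤ n → a n = (n : ℝ) ^ (-α) * h n := fun n hn => by rw [ha n hn, hLh]
  have hm0 : AEMeasurable (ε 0) P := h_int.aemeasurable
  have hprob : IsProbabilityMeasure (P.map (ε 0)) := Measure.isProbabilityMeasure_map hm0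
  rw [truncSecondMoment_eq_law hm0] at h_domain ⊢
  set ν := P.map (ε 0) with hν
  set l := lawTruncSecondMoment ν with hl
  have hid : AEStronglyMeasurable (fun y : ℝ => y) ν := aestronglyMeasurable_id
  have hνint : Integrable (fun y => y) ν := (integrable_map_measure hid hm0).2 h_int
  -- small enough for every exponent condition: `α + 2δ < 1` and `1 < 2α - 6δ`
  obtain ⟨δ, hδ0, hδ1, hδ2⟩ : ∃ δ : ℝ, 0 < δ ∧ α + 2 * δ < 1 ∧ 1 < 2 * α - 6 * δ := by
    refine ⟨min (2 * α - 1) (1 - α) / 8, ?_, ?_, ?_⟩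
    · have : 0 < min (2 * α - 1) (1 - α) := lt_min (by linarith) (by linarith)
      positivity
    · linarith [min_le_right (2 * α - 1) (1 - α)]
    · linarith [min_le_left (2 * α - 1) (1 - α)]
  obtain ⟨C₀, hreg⟩ := exists_truncationRegular h_domain hδ0
  obtain ⟨Θ, hΘ, hmom⟩ := exists_uniform_moment_bound h_domain hνint
  obtain ⟨K, Λ, hΛ, hΛh, hale⟩ := exists_potterRegular_coeff hh (by linarith) hah hδ0
  have hsq : ∀ j, Real.sqrt (l (truncLevel l j)) ^ 2 = l (truncLevel l j) := fun j =>
    Real.sq_sqrt (lawTruncSecondMoment_nonneg _)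
  have M : LinearModel P ε ν a α δ K C₀ Λ (truncLevel l)
      (fun j => Real.sqrt (l (truncLevel l j))) Θ :=
    { indep := h_indep
      aemeasurable := fun k => (h_ident k).aemeasurable_fst
      law := fun k => (h_ident k).map_eq
      integrable := hνint
      centered := (integral_map hm0 hid).trans h_centered
      coeff_regular := hΛ
      coeff_le := hale
      trunc_regular := hreg
      exponent_lt := by linarith
      lt_exponent := by linarith
      sq_eq := fun j _ => (hsq j).symm
      small := hΘ
      tail_le := fun n j hn hnj => by
        rw [hsq]
        exact (hmom n j hn hnj).1
      third_le := fun n j hn hnj => by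
        rw [hsq]
        exact (hmom n j hn hnj).2 }
  have hσ1 : ∀ x : ℝ, Tendsto (fun n : ℕ =>
      Real.sqrt (l (truncLevel l (n + ⌊(n : ℝ) * x⌋.natAbs))) ^ 2 /
        Real.sqrt (l (truncLevel l n)) ^ 2) atTop (𝓝 1) := fun x => by
    simp_rw [hsq]
    exact tendsto_truncMoment_shift_ratio h_domain x
  have hb0 : normalizer α l L 0 = 0 := by
    rw [normalizer, Nat.cast_zero, Real.zero_rpow (by linarith), mul_zero, zero_mul,
      Real.sqrt_zero]
  have hc : 0 < cAlpha α :=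
    (M.tendsto_tsum_sq hh hah hΛh hδ1 hδ2 hσ1 (le_refl 0) zero_le_one le_rfl).2
  have hb : ∀ᶠ n in atTop, normalizer α l L n = Real.sqrt (cAlpha α) *
      sumScale α Λ (fun j => Real.sqrt (l (truncLevel l j))) n := by
    filter_upwards [hΛh, eventually_ge_atTop 1] with n hn hn1
    have hs := sumScale_pos (α := α) hΛ hreg hn1
    rw [← Real.sqrt_sq hs.le, ← Real.sqrt_mul hc.le, sumScale_sq _ _ _ hn1, hsq, normalizer, hLh,
      hn]
    congr 1
    ring
  obtain ⟨μ, hμ, hμ', hchar, hconv⟩ :=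
    M.exists_tendstoInDistribution hh hah hΛh hδ1 hδ2 hσ1 hb0 hb
  exact ⟨M.ae_tendsto_linearPartial, ⟨_, hμ', isFractionalBrownianMotion_map_ofContinuous hchar,
    hconv⟩, tendstoInDistribution_end_of_stepPath (by linarith) hchar hconv⟩
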